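/- **Conventions.** Let $p\in(1,\infty)$. A curve $\gamma\in W^{2,p}(0,1;\mathbf{R}^2)$ (identified with its $C^1([0,1])$ representative) is *immersed* if $\gamma'(t)\neq0$ for all $t\in[0,1]$. Write $k=\det(\gamma',\gamma'')/|\gamma'|^3$ for its signed curvature, $\mathcal{L}[\gamma]=\int_0^1|\gamma'|\,dt$ for its length and $\mathcal{B}_p[\gamma]=\int_0^1|k|^p|\gamma'|\,dt$ for its $p$-bending energy. An immersed $\gamma\in W^{2,p}(0,1;\mathbf{R}^2)$ is a *$p$-elastica* if there is $\lambda\in\mathbf{R}$ such that $\frac{d}{d\varepsilon}\big(\mathcal{B}_p[\gamma+\varepsilon\eta]+\lambda\mathcal{L}[\gamma+\varepsilon\eta]\big)\big|_{\varepsilon=0}=0$ for every $\eta\in C_c^\infty(0,1;\mathbf{R}^2)$. For $q\in[0,1)$ and $x\in\mathbf{R}$ put $$\mathrm{F}_{1,p}(x,q)=\int_0^x\frac{|\cos\theta|^{1-\frac2p}}{\sqrt{1-q^2\sin^2\theta}}\,d\theta,\qquad \mathrm{F}_{2,p}(x,q)=\int_0^x\frac{d\theta}{\sqrt[p]{1-q^2\sin^2\theta}},$$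 and $\mathrm{F}_{1,p}(x,1)=\mathrm{F}_{2,p}(x,1)=\int_0^x|\cos\theta|^{-\frac2p}\,d\theta$, where $x\in(-\frac\pi2,\frac\pi2)$ if $p\le2$ and $x\in\mathbf{R}$ if $p>2$. For $q\in[0,1]$ and $x\in\mathbf{R}$ put $$\mathrm{E}_{1,p}(x,q)=\int_0^x\sqrt{1-q^2\sin^2\theta}\,|\cos\theta|^{1-\frac2p}\,d\theta,\qquad \mathrm{E}_{2,p}(x,q)=\int_0^x\sqrt[p]{1-q^2\sin^2\theta}\,d\theta.$$ Let $\mathrm{am}_{i,p}(\cdot,q):\mathbf{R}\to\mathbf{R}$ be the inverse function of $\mathrm{F}_{i,p}(\cdot,q)$, $i=1,2$, and let $$\mathrm{sn}_p=\sin\mathrm{am}_{1,p},\quad \mathrm{cn}_p=|\cos\mathrm{am}_{1,p}|^{\frac2p-1}\cos\mathrm{am}_{1,p},\quad \mathrm{dn}_p(\cdot,q)=\sqrt[p]{1-q^2\sin^2\mathrm{am}_{2,p}(\cdot,q)}.$$ For $p\le2$ let $\mathrm{sech}_p\,x=\mathrm{cn}_p(x,1)=\mathrm{dn}_p(x,1)$,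 $x\in\mathbf{R}$, and $\tanh_p x=\int_0^x(\mathrm{sech}_p\,t)^p\,dt$. **Theorem.** Let $p\in(1,2]$ and let $\gamma$ be a $p$-elastica in $\mathbf{R}^2$. Then, up to similarity (translation, rotation, reflection, and dilation) and reparameterization by arclength, $\gamma$ is represented by $\gamma(s)=\gamma_*(s+s_0)$ with some $s_0\in\mathbf{R}$; that is, there is a similarity $S$ of the plane such that $$S(\gamma(t))=\gamma_*\Big(\int_0^t|(S\circ\gamma)'(r)|\,dr+s_0\Big)\quad\text{for all }t\in[0,1],$$ where $\gamma_*:\mathbf{R}\to\mathbf{R}^2$ is one of the following five arclength parameterizations: * (Case I, linear) $\gamma_\ell(s)=(s,0)$, with $\theta_\ell\equiv0$ and $k_\ell\equiv0$. * (Case II, wavelike) for some $q\in(0,1)$, $$\gamma_w(s,q)=\begin{pmatrix}2\mathrm{E}_{1,p}(\mathrm{am}_{1,p}(s,q),q)-s\\-q\frac{p}{p-1}|\mathrm{cn}_p(s,q)|^{p-2}\mathrm{cn}_p(s,q)\end{pmatrix},$$ with $\theta_w(s)=2\arcsin(q\,\mathrm{sn}_p(s,q))$ and $k_w(s)=2q\,\mathrm{cn}_p(s,q)$.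 * (Case III, borderline) $$\gamma_b(s)=\begin{pmatrix}2\tanh_p s-s\\-\frac{p}{p-1}(\mathrm{sech}_p\,s)^{p-1}\end{pmatrix},$$ with $\theta_b(s)=2\mathrm{am}_{1,p}(s,1)=2\mathrm{am}_{2,p}(s,1)$ and $k_b(s)=2\,\mathrm{sech}_p\,s$. * (Case IV, orbitlike) for some $q\in(0,1)$, $$\gamma_o(s,q)=\frac1{q^2}\begin{pmatrix}2\mathrm{E}_{2,\frac{p}{p-1}}(\mathrm{am}_{2,p}(s,q),q)+(q^2-2)s\\-\frac{p}{p-1}\mathrm{dn}_p(s,q)^{p-1}\end{pmatrix},$$ with $\theta_o(s)=2\mathrm{am}_{2,p}(s,q)$ and $k_o(s)=2\,\mathrm{dn}_p(s,q)$. * (Case V, circular) $\gamma_c(s)=(\cos s,\sin s)$, with $\theta_c(s)=s+\frac\pi2$ and $k_c\equiv1$. Here $\theta_*$ denotes the tangential angle, $\partial_s\gamma_*=(\cos\theta_*,\sin\theta_*)$, and $k_*=\partial_s\theta_*$ the counterclockwise signed curvature. These formulae for $\theta_*$ and $k_*$ hold for all $s\in\mathbf{R}$ (and all $q\in(0,1)$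 in Cases II and IV). When $p<2$, the expression $|x|^{p-2}x$ is read as $0$ at $x=0$. -/

import Mathlib

open Real Set MeasureTheory
open scoped ContDiff Topology

noncomputable section

/-- The Euclidean plane. -/
abbrev Plane : Type := EuclideanSpace ℝ (Fin 2)

/-! ### Sobolev curves on the unit interval -/

/-- `η` is a smooth function with compact support in the open interval `(0,1)`. -/
def IsTestFunction {E : Type*} [NormedAddCommGroup E] [NormedSpace ℝ E] (η : ℝ → E) : Prop :=
  ContDiff ℝ ∞ η ∧ HasCompactSupport η ∧ tsupport η ⊆ Ioo (0 : ℝ) 1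

/-- `g` is the weak derivative of `f` on `(0,1)`. -/
def HasWeakDeriv (f g : ℝ → Plane) : Prop :=
  LocallyIntegrableOn f (Ioo (0 : ℝ) 1) ∧ LocallyIntegrableOn g (Ioo (0 : ℝ) 1) ∧
    ∀ φ : ℝ → ℝ, IsTestFunction φ →
      ∫ t in Ioo (0 : ℝ) 1, deriv φ t • f t = -∫ t in Ioo (0 : ℝ) 1, φ t • g t

/-- `f` belongs to `Lᵖ(0,1; ℝ²)`. -/
def MemLpUnit (p : ℝ) (f : ℝ → Plane) : Prop :=
  MemLp f (ENNReal.ofReal p) (volume.restrict (Ioo (0 : ℝ) 1))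

/-- `γ` belongs to the Sobolev space `W^{2,p}(0,1; ℝ²)`. -/
def MemW2p (p : ℝ) (γ : ℝ → Plane) : Prop :=
  MemLpUnit p γ ∧ ∃ v w : ℝ → Plane,
    MemLpUnit p v ∧ MemLpUnit p w ∧ HasWeakDeriv γ v ∧ HasWeakDeriv v w

/-- `W^{2,p}`-immersed curves `[0,1] → ℝ²`. Only the values of `γ` on `[0,1]` matter. By
continuity `γ` is the representative of its Sobolev class that is `C¹` on `[0,1]`; its derivative
(one-sided at the end points) must not vanish anywhere on `[0,1]`. -/
def IsImmersedW2p (p : ℝ) (γ : ℝ → Plane) : Prop :=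
  MemW2p p γ ∧ ContinuousOn γ (Icc 0 1) ∧ ∀ t ∈ Icc (0 : ℝ) 1, derivWithin γ (Icc 0 1) t ≠ 0

/-! ### Length, curvature, bending energy, elasticae -/

/-- The arclength of `γ` measured from the parameter `0`. -/
def arclength (γ : ℝ → Plane) (t : ℝ) : ℝ := ∫ r in (0 : ℝ)..t, ‖deriv γ r‖

/-- The length of a curve defined on `[0,1]`. -/
def curveLength (γ : ℝ → Plane) : ℝ := ∫ t in (0 : ℝ)..1, ‖deriv γ t‖

/-- The (counterclockwise) signed curvature `det(γ', γ'') / |γ'|³`. For a `W^{2,p}`-immersed curve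
`γ'` is absolutely continuous on `[0,1]`, so that its pointwise derivative exists almost everywhere
on `(0,1)` and coincides with the weak second derivative of `γ`. -/
def signedCurvature (γ : ℝ → Plane) (t : ℝ) : ℝ :=
  (deriv γ t 0 * deriv (deriv γ) t 1 - deriv γ t 1 * deriv (deriv γ) t 0) / ‖deriv γ t‖ ^ 3

/-- The `p`-bending energy `∫ |k|ᵖ ds` of a curve on `[0,1]`, with `ds = |γ'(t)| dt`. -/
def bendingEnergy (p : ℝ) (γ : ℝ → Plane) : ℝ :=
  ∫ t in (0 : ℝ)..1, |signedCurvature γ t| ^ p * ‖deriv γ t‖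

/-- Planar `p`-elasticae: immersed `W^{2,p}`-curves which for some `lam` are critical points of the
bending energy plus `lam` times the length. -/
def IsPElastica (p : ℝ) (γ : ℝ → Plane) : Prop :=
  IsImmersedW2p p γ ∧ ∃ lam : ℝ, ∀ η : ℝ → Plane, IsTestFunction η →
    HasDerivAt (fun ε : ℝ => bendingEnergy p (γ + ε • η) + lam * curveLength (γ + ε • η)) 0 0

/-! ### `p`-elliptic integrals -/

/-- Incomplete `p`-elliptic integral of the first kind `F_{1,p}(x,q)`. -/
def ellF1 (p x q : ℝ) : ℝ :=
  if q = 1 then ∫ θ in (0 : ℝ)..x, 1 / |cos θ| ^ (2 / p)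
  else ∫ θ in (0 : ℝ)..x, |cos θ| ^ (1 - 2 / p) / √(1 - q ^ 2 * sin θ ^ 2)

/-- Incomplete `p`-elliptic integral of the first kind `F_{2,p}(x,q)`. -/
def ellF2 (p x q : ℝ) : ℝ :=
  if q = 1 then ∫ θ in (0 : ℝ)..x, 1 / |cos θ| ^ (2 / p)
  else ∫ θ in (0 : ℝ)..x, 1 / (1 - q ^ 2 * sin θ ^ 2) ^ (1 / p)

/-- The set of amplitudes `x` on which `F_{1,p}(x,q)` and `F_{2,p}(x,q)` are considered: the whole
line, except for `q = 1` and `p ≤ 2`, when it is the interval `(-π/2, π/2)`. -/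
def ellDomain (p q : ℝ) : Set ℝ :=
  if q = 1 ∧ p ≤ 2 then Ioo (-(π / 2)) (π / 2) else univ

/-- The complete integral `K_p(1)`, infinite for `p ≤ 2`. -/
def ellKOne (p : ℝ) : EReal :=
  if p ≤ 2 then ⊤ else ((∫ θ in (0 : ℝ)..(π / 2), 1 / cos θ ^ (2 / p) : ℝ) : EReal)

/-- Incomplete `p`-elliptic integral of the second kind `E_{1,p}(x,q)`. -/
def ellE1 (p x q : ℝ) : ℝ :=
  ∫ θ in (0 : ℝ)..x, √(1 - q ^ 2 * sin θ ^ 2) * |cos θ| ^ (1 - 2 / p)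

/-- Incomplete `p`-elliptic integral of the second kind `E_{2,p}(x,q)`. -/
def ellE2 (p x q : ℝ) : ℝ :=
  ∫ θ in (0 : ℝ)..x, (1 - q ^ 2 * sin θ ^ 2) ^ (1 / p)

/-! ### `p`-elliptic and `p`-hyperbolic functions -/

/-- The amplitude `am_{1,p}(·,q)`, the inverse function of `F_{1,p}(·,q)`. -/
def am1 (p x q : ℝ) : ℝ := Function.invFunOn (fun y => ellF1 p y q) (ellDomain p q) x

/-- The amplitude `am_{2,p}(·,q)`, the inverse function of `F_{2,p}(·,q)`. -/
def am2 (p x q : ℝ) : ℝ := Function.invFunOn (fun y => ellF2 p y q) (ellDomain p q) x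

/-- The `p`-elliptic sine. -/
def snP (p x q : ℝ) : ℝ := sin (am1 p x q)

/-- The `p`-elliptic cosine. -/
def cnP (p x q : ℝ) : ℝ := |cos (am1 p x q)| ^ (2 / p - 1) * cos (am1 p x q)

/-- The `p`-delta amplitude. -/
def dnP (p x q : ℝ) : ℝ := (1 - q ^ 2 * sin (am2 p x q) ^ 2) ^ (1 / p)

open Classical in
/-- The `p`-hyperbolic secant: `cn_p(·,1) = dn_p(·,1)` on `(-K_p(1), K_p(1))`, zero elsewhere. -/
def sechP (p x : ℝ) : ℝ := if ((|x| : ℝ) : EReal) < ellKOne p then cnP p x 1 else 0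

/-- The `p`-hyperbolic tangent. -/
def tanhP (p x : ℝ) : ℝ := ∫ t in (0 : ℝ)..x, sechP p t ^ p

/-! ### The five profile curves -/

/-- Linear profile. -/
def gammaLinear (s : ℝ) : Plane := !₂[s, 0]

/-- Wavelike profile with modulus `q`. -/
def gammaWavelike (p q s : ℝ) : Plane :=
  !₂[2 * ellE1 p (am1 p s q) q - s, -(q * (p / (p - 1)) * (|cnP p s q| ^ (p - 2) * cnP p s q))]

/-- Borderline profile. -/
def gammaBorderline (p s : ℝ) : Plane :=
  !₂[2 * tanhP p s - s, -(p / (p - 1) * sechP p s ^ (p - 1))]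

/-- Orbitlike profile with modulus `q`. -/
def gammaOrbitlike (p q s : ℝ) : Plane :=
  (1 / q ^ 2) • !₂[2 * ellE2 (p / (p - 1)) (am2 p s q) q + (q ^ 2 - 2) * s,
    -(p / (p - 1) * dnP p s q ^ (p - 1))]

/-- Circular profile. -/
def gammaCircular (s : ℝ) : Plane := !₂[cos s, sin s]

/-- `Γ` is an arclength parametrized curve on `ℝ` with tangential angle `θ`, that is
`Γ' = (cos θ, sin θ)`, and signed curvature `k = θ'`. -/
def HasAngleCurvature (Γ : ℝ → Plane) (θ k : ℝ → ℝ) : Prop :=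
  ∀ s : ℝ, HasDerivAt Γ !₂[cos (θ s), sin (θ s)] s ∧ HasDerivAt θ (k s) s

end

open Real Set MeasureTheory
open scoped ContDiff Topology

noncomputable section

/-! The key fact is that the power u = |k|^(p-2) k of the curvature of a p-elastica is an affine
function of position. The energies depend on γ only through its derivatives, so testing the first
variation with φ e for a constant vector e gives a weak equation containing only φ' and φ''. It
integrates to a first-order identity with one free constant for each of the two coordinate
directions. In the cross product of these identities with the velocity V = γ', the multiplier `lam`,
the tangential term and the second derivatives all cancel, leaving u' = V₀ c₁ - V₁ c₀ for constants
c₀, c₁ (`exists_curvaturePower`). No regularity beyond absolute continuity of V is needed.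

Write p' = p/(p-1) and V = σ (cos, sin) of a tangential angle (`exists_tangent`), measured from the
direction of (c₀, c₁). This gives a generalized pendulum θ' = σ |u|^(p'-2) u, u' = -A σ sin θ with A
≥ 0 (`IsPElastica.exists_system`). Since p ≤ 2 means p' ≥ 2, the right-hand side is locally
Lipschitz and a solution is determined by its values at t = 0 (`angle_eq`).

It remains to find an explicit solution for each initial datum. Every profile satisfies |k|^(p-2) k
= C - As y, where y is its second coordinate, so it solves the same system with As for A
(`isRepresentedBy_of_profile`). A dilation by r divides A by r^p, and a reflection changes the signs
of θ and u. Equilibria give lines and A = 0 gives circles. Otherwise the value at t = 0 of the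
pendulum energy e = |u|^p' / (p' A) - cos θ lies above -1 and selects the profile: wavelike with q²
= (1+e)/2 if e < 1, borderline if e = 1, orbitlike with q² = 2/(1+e) if e > 1. Conservation of e
along the curve is never needed, because uniqueness for the system replaces it.

The formulas for the angles and curvatures of the profiles follow from the inverse function rule for
the amplitudes. Two points are delicate: the integrand of F₁ is singular where cos vanishes, which
continuity of the candidate derivative repairs, and for q = 1 the integral must diverge at ±π/2 so
that the amplitude is defined on the whole line. -/

namespace IsTestFunction

/-! ### Test functions and the du Bois-Reymond lemmas -/

variable {φ ψ : ℝ → ℝ}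

lemma eq_zero (h : IsTestFunction φ) {t : ℝ} (ht : t ∉ Ioo (0 : ℝ) 1) : φ t = 0 :=
  image_eq_zero_of_notMem_tsupport fun h' => ht (h.2.2 h')

lemma sub (hφ : IsTestFunction φ) (hψ : IsTestFunction ψ) :
    IsTestFunction (fun t => φ t - ψ t) :=
  ⟨hφ.1.sub hψ.1, hφ.2.1.sub hψ.2.1,
    (tsupport_sub φ ψ).trans (union_subset hφ.2.2 hψ.2.2)⟩

lemma const_mul (c : ℝ) (hφ : IsTestFunction φ) : IsTestFunction (fun t => c * φ t) :=
  ⟨contDiff_const.mul hφ.1, hφ.2.1.mul_left, (tsupport_mul_subset_right).trans hφ.2.2⟩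

lemma deriv (hφ : IsTestFunction φ) : IsTestFunction (deriv φ) :=
  ⟨(contDiff_infty_iff_deriv.1 hφ.1).2, hφ.2.1.deriv, (tsupport_deriv_subset).trans hφ.2.2⟩

lemma hasDerivAt (hφ : IsTestFunction φ) (t : ℝ) : HasDerivAt φ (_root_.deriv φ t) t :=
  ((contDiff_infty_iff_deriv.1 hφ.1).1 t).hasDerivAt

lemma continuous (hφ : IsTestFunction φ) : Continuous φ := hφ.1.continuous

lemma absolutelyContinuous (hφ : IsTestFunction φ) : AbsolutelyContinuousOnInterval φ 0 1 :=
  ((hφ.1.of_le (by exact_mod_cast le_top)).contDiffOn).absolutelyContinuousOnInterval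

/-- The primitive from 0 vanishes left of the support trivially and right of it because the total
integral is zero, so its support is again compact in (0,1). -/
lemma exists_primitive (hφ : IsTestFunction φ) (h0 : ∫ t in (0 : ℝ)..1, φ t = 0) :
    ∃ η : ℝ → ℝ, IsTestFunction η ∧ _root_.deriv η = φ := by
  have hc := hφ.continuous
  have hd : ∀ t, HasDerivAt (fun t => ∫ r in (0 : ℝ)..t, φ r) (φ t) t := fun t =>
    intervalIntegral.integral_hasDerivAt_right (hc.intervalIntegrable _ _)
      (hc.stronglyMeasurableAtFilter _ _) hc.continuousAt
  have hde : _root_.deriv (fun t => ∫ r in (0 : ℝ)..t, φ r) = φ := funext fun t => (hd t).deriv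
  rcases (tsupport φ).eq_empty_or_nonempty with he | hne
  · refine ⟨fun _ => 0, ⟨contDiff_const, HasCompactSupport.zero, by simp [tsupport]⟩, ?_⟩
    funext t
    simp [image_eq_zero_of_notMem_tsupport (f := φ) (x := t) (by simp [he])]
  obtain ⟨a, ha⟩ := hφ.2.1.exists_isLeast hne
  obtain ⟨b, hb⟩ := hφ.2.1.exists_isGreatest hne
  have ha0 := hφ.2.2 ha.1
  have hb0 := hφ.2.2 hb.1
  have hz : ∀ t, t ∉ Icc a b → φ t = 0 := fun t ht =>
    image_eq_zero_of_notMem_tsupport fun h' => ht ⟨ha.2 h', hb.2 h'⟩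
  have hsupp : tsupport (fun t => ∫ r in (0 : ℝ)..t, φ r) ⊆ Icc a b := by
    refine closure_minimal (fun t ht => ?_) isClosed_Icc
    by_contra hn
    refine ht ?_
    rcases lt_or_ge t a with h | h
    · have : ∀ r ∈ uIcc 0 t, φ r = 0 := by
        intro r hr
        refine hz r fun h' => ?_
        rcases mem_uIcc.1 hr with h2 | h2 <;> linarith [h'.1, ha0.1, h2.2]
      change ∫ r in (0 : ℝ)..t, φ r = 0
      rw [intervalIntegral.integral_congr (g := fun _ => 0) this]; simp
    -- Right of the support the primitive equals the full integral over [0,1], which is zero.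
    · have hbt : b < t := by by_contra h3; exact hn ⟨h, not_lt.1 h3⟩
      have : ∀ r ∈ uIcc 1 t, r ≠ b → φ r = 0 := by
        intro r hr hrb
        refine hz r fun h' => ?_
        rcases mem_uIcc.1 hr with h2 | h2 <;> linarith [h'.2, hb0.2, h2.1]
      have h1 : ∫ r in (1 : ℝ)..t, φ r = 0 := by
        rw [intervalIntegral.integral_congr (g := fun _ => 0)]
        · simp
        · intro r hr
          refine this r hr ?_
          rintro rfl
          rcases mem_uIcc.1 hr with h2 | h2 <;> linarith [hb0.2, h2.1]
      change ∫ r in (0 : ℝ)..t, φ r = 0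
      rw [← intervalIntegral.integral_add_adjacent_intervals (hc.intervalIntegrable 0 1)
        (hc.intervalIntegrable 1 t), h0, h1, add_zero]
  refine ⟨_, ⟨contDiff_infty_iff_deriv.2 ⟨fun t => (hd t).differentiableAt, by
    rw [hde]; exact hφ.1⟩,
    HasCompactSupport.of_support_subset_isCompact isCompact_Icc (subset_closure.trans hsupp),
    hsupp.trans (Icc_subset_Ioo ha0.1 hb0.2)⟩, hde⟩

lemma exists_integral_eq_one : ∃ ρ : ℝ → ℝ, IsTestFunction ρ ∧ ∫ t in (0 : ℝ)..1, ρ t = 1 := by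
  let f : ContDiffBump (1 / 2 : ℝ) := ⟨1 / 8, 1 / 4, by norm_num, by norm_num⟩
  have ht : tsupport (f.normed volume) ⊆ Ioo 0 1 := by
    rw [f.tsupport_normed_eq, Real.closedBall_eq_Icc]
    exact Icc_subset_Ioo (by norm_num [f]) (by norm_num [f])
  refine ⟨f.normed volume, ⟨f.contDiff_normed, f.hasCompactSupport_normed, ht⟩, ?_⟩
  rw [intervalIntegral.integral_of_le zero_le_one]
  refine (setIntegral_eq_integral_of_forall_compl_eq_zero fun t h => ?_).trans f.integral_normed
  exact image_eq_zero_of_notMem_tsupport fun h' => h (Ioo_subset_Ioc_self (ht h'))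

/-- Integration by parts of a test function against an indefinite integral. -/
lemma integral_deriv_mul_integral (hφ : IsTestFunction φ) {g : ℝ → ℝ}
    (hg : IntervalIntegrable g volume 0 1) :
    ∫ t in (0 : ℝ)..1, _root_.deriv φ t * ∫ r in (0 : ℝ)..t, g r
      = -∫ t in (0 : ℝ)..1, φ t * g t := by
  have hG := hg.absolutelyContinuousOnInterval_intervalIntegral (c := 0) (by simp)
  have h := AbsolutelyContinuousOnInterval.integral_mul_deriv_eq_deriv_mul hφ.absolutelyContinuous
    hG
  rw [hφ.eq_zero (by simp), hφ.eq_zero (by simp)] at h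
  have h2 : ∫ t in (0 : ℝ)..1, φ t * g t =
      ∫ t in (0 : ℝ)..1, φ t * _root_.deriv (fun x => ∫ r in (0 : ℝ)..x, g r) t := by
    refine intervalIntegral.integral_congr_ae ?_
    filter_upwards [hg.ae_hasDerivAt_integral] with t ht ht'
    rw [(ht (uIoc_subset_uIcc ht') 0 (by simp)).deriv]
  rw [h2, h]; ring

end IsTestFunction

/-- A function with vanishing weak derivative is constant. -/
theorem ae_eq_const_of_forall_integral_deriv_mul {h : ℝ → ℝ}
    (hh : IntervalIntegrable h volume 0 1)
    (H : ∀ φ : ℝ → ℝ, IsTestFunction φ → ∫ t in (0 : ℝ)..1, deriv φ t * h t = 0) :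
    ∃ c : ℝ, ∀ᵐ t, t ∈ Ioo (0 : ℝ) 1 → h t = c := by
  obtain ⟨ρ, hρ, hρ1⟩ := IsTestFunction.exists_integral_eq_one
  have hi : ∀ {f : ℝ → ℝ}, IsTestFunction f →
      IntervalIntegrable (fun t => f t * h t) volume 0 1 := fun hf =>
    hh.continuousOn_mul hf.continuous.continuousOn
  refine ⟨∫ t in (0 : ℝ)..1, ρ t * h t, ?_⟩
  set c := ∫ t in (0 : ℝ)..1, ρ t * h t
  have hloc : IntegrableOn (fun t => h t - c) (Ioo 0 1) := by
    have := (hh.sub (intervalIntegrable_const (c := c)))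
    rw [intervalIntegrable_iff_integrableOn_Ioo_of_le zero_le_one] at this
    exact this
  have := isOpen_Ioo.ae_eq_zero_of_integral_contDiff_smul_eq_zero hloc.locallyIntegrableOn ?_
  · filter_upwards [this] with t ht ht'
    exact sub_eq_zero.1 (ht ht')
  intro ψ h1 h2 h3
  have hψ : IsTestFunction ψ := ⟨h1, h2, h3⟩
  have : ∫ t, ψ t • (h t - c) = ∫ t in (0 : ℝ)..1, ψ t * (h t - c) := by
    rw [intervalIntegral.integral_of_le zero_le_one]
    refine (setIntegral_eq_integral_of_forall_compl_eq_zero fun t ht => ?_).symm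
    simp only [smul_eq_mul]
    rw [hψ.eq_zero fun h' => ht (Ioo_subset_Ioc_self h'), zero_mul]
  rw [this]
  set m := ∫ t in (0 : ℝ)..1, ψ t
  -- Subtracting m ρ makes the mean of ψ zero, so the difference is the derivative of a test
  -- function and the hypothesis applies to it.
  obtain ⟨η, hη, hη'⟩ := (hψ.sub (hρ.const_mul m)).exists_primitive (by
    rw [intervalIntegral.integral_sub (hψ.continuous.intervalIntegrable _ _)
      ((hρ.const_mul m).continuous.intervalIntegrable _ _),
      intervalIntegral.integral_const_mul, hρ1]; simp [m])
  have h4 := H η hη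
  rw [hη'] at h4
  have h5 : ∀ t, (ψ t - m * ρ t) * h t = ψ t * h t - m * (ρ t * h t) := fun t => by ring
  simp_rw [h5] at h4
  rw [intervalIntegral.integral_sub (hi hψ) ((hi hρ).const_mul m),
    intervalIntegral.integral_const_mul] at h4
  simp_rw [mul_sub]
  rw [intervalIntegral.integral_sub (hi hψ) ((hψ.continuous.intervalIntegrable _ _).mul_const c),
    intervalIntegral.integral_mul_const]
  exact h4

/-- A function with vanishing weak second derivative is affine. -/
theorem ae_eq_affine_of_forall_integral_deriv_deriv_mul {h : ℝ → ℝ}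
    (hh : IntervalIntegrable h volume 0 1)
    (H : ∀ φ : ℝ → ℝ, IsTestFunction φ → ∫ t in (0 : ℝ)..1, deriv (deriv φ) t * h t = 0) :
    ∃ c d : ℝ, ∀ᵐ t, t ∈ Ioo (0 : ℝ) 1 → h t = c + d * t := by
  obtain ⟨ρ, hρ, hρ1⟩ := IsTestFunction.exists_integral_eq_one
  have hi : ∀ {f : ℝ → ℝ}, IsTestFunction f →
      IntervalIntegrable (fun t => f t * h t) volume 0 1 := fun hf =>
    hh.continuousOn_mul hf.continuous.continuousOn
  -- For an affine h of slope b this integral is -b, so adding d t should leave a constant.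
  set d := ∫ t in (0 : ℝ)..1, deriv ρ t * h t with hd
  have hid : IntervalIntegrable (fun t : ℝ => d * t) volume 0 1 :=
    (continuous_const.mul continuous_id).intervalIntegrable _ _
  obtain ⟨c, hc⟩ := ae_eq_const_of_forall_integral_deriv_mul
    (h := fun t => h t + d * t) (hh.add hid) (fun φ hφ => by
    set m := ∫ t in (0 : ℝ)..1, φ t with hm
    obtain ⟨η, hη, hη'⟩ := (hφ.sub (hρ.const_mul m)).exists_primitive (by
      rw [intervalIntegral.integral_sub (hφ.continuous.intervalIntegrable _ _)
        ((hρ.const_mul m).continuous.intervalIntegrable _ _),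
        intervalIntegral.integral_const_mul, hρ1]; simp [m])
    have h4 := H η hη
    have h6 : deriv (deriv η) = fun t => deriv φ t - m * deriv ρ t := by
      rw [hη']
      exact funext fun t => ((hφ.hasDerivAt t).sub ((hρ.hasDerivAt t).const_mul m)).deriv
    rw [h6] at h4
    have h5 : ∀ t, (deriv φ t - m * deriv ρ t) * h t
        = deriv φ t * h t - m * (deriv ρ t * h t) := fun t => by ring
    simp_rw [h5] at h4
    rw [intervalIntegral.integral_sub (hi hφ.deriv) ((hi hρ.deriv).const_mul m),
      intervalIntegral.integral_const_mul] at h4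
    have h7 := hφ.integral_deriv_mul_integral (g := fun _ => d) intervalIntegrable_const
    simp only [intervalIntegral.integral_const, sub_zero, smul_eq_mul,
      intervalIntegral.integral_mul_const] at h7
    simp_rw [mul_add]
    rw [intervalIntegral.integral_add (hi hφ.deriv)
      (hid.continuousOn_mul hφ.deriv.continuous.continuousOn)]
    simp_rw [mul_comm d]
    rw [h7]; linarith)
  refine ⟨c, -d, ?_⟩
  filter_upwards [hc] with t ht ht'
  linarith [ht ht']

/-- A function with an integrable weak derivative is an indefinite integral of it. -/
theorem ae_eq_const_add_integral {f g : ℝ → ℝ} (hf : IntervalIntegrable f volume 0 1)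
    (hg : IntervalIntegrable g volume 0 1)
    (H : ∀ φ : ℝ → ℝ, IsTestFunction φ →
      ∫ t in (0 : ℝ)..1, deriv φ t * f t = -∫ t in (0 : ℝ)..1, φ t * g t) :
    ∃ c : ℝ, ∀ᵐ t, t ∈ Ioo (0 : ℝ) 1 → f t = c + ∫ r in (0 : ℝ)..t, g r := by
  have hG := (hg.absolutelyContinuousOnInterval_intervalIntegral (c := 0) (by simp)).continuousOn
  obtain ⟨c, hc⟩ := ae_eq_const_of_forall_integral_deriv_mul
    (h := fun t => f t - ∫ r in (0 : ℝ)..t, g r) (hf.sub hG.intervalIntegrable) (fun φ hφ => by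
    simp_rw [mul_sub]
    rw [intervalIntegral.integral_sub (hf.continuousOn_mul hφ.deriv.continuous.continuousOn)
      (hG.intervalIntegrable.continuousOn_mul hφ.deriv.continuous.continuousOn), H φ hφ,
      hφ.integral_deriv_mul_integral hg, sub_self])
  refine ⟨c, ?_⟩
  filter_upwards [hc] with t ht ht'
  linarith [ht ht']

/-! ### Regularity of immersed Sobolev curves -/

namespace Plane

lemma hasDerivWithinAt_iff {f : ℝ → Plane} {f' : Plane} {s : Set ℝ} {t : ℝ} :
    HasDerivWithinAt f f' s t ↔ ∀ i, HasDerivWithinAt (fun x => f x i) (f' i) s t := by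
  rw [hasDerivWithinAt_iff_hasFDerivWithinAt,
    ← (EuclideanSpace.equiv (Fin 2) ℝ).comp_hasFDerivWithinAt_iff, ← hasDerivWithinAt_pi]
  constructor <;> intro h
  · convert! h.hasDerivWithinAt using 1
    ext i
    simp
  · convert! h.hasFDerivWithinAt using 1

lemma hasDerivAt_iff {f : ℝ → Plane} {f' : Plane} {t : ℝ} :
    HasDerivAt f f' t ↔ ∀ i, HasDerivAt (fun x => f x i) (f' i) t := by
  simp only [← hasDerivWithinAt_univ, hasDerivWithinAt_iff]

lemma hasDerivAt_mk {x y : ℝ → ℝ} {x' y' t : ℝ} (hx : HasDerivAt x x' t)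
    (hy : HasDerivAt y y' t) : HasDerivAt (fun t => (!₂[x t, y t] : Plane)) !₂[x', y'] t := by
  rw [hasDerivAt_iff]
  intro i
  fin_cases i <;> simpa

lemma norm_eq_sqrt (x : Plane) : ‖x‖ = √(x 0 ^ 2 + x 1 ^ 2) := by
  simp [EuclideanSpace.norm_eq]

end Plane

lemma hasDerivWithinAt_integral_of_continuousOn {f : ℝ → ℝ} (hf : ContinuousOn f (Icc 0 1))
    {t : ℝ} (ht : t ∈ Icc (0 : ℝ) 1) :
    HasDerivWithinAt (fun x => ∫ r in (0 : ℝ)..x, f r) (f t) (Icc 0 1) t := by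
  have : Fact (t ∈ Icc (0 : ℝ) 1) := ⟨ht⟩
  refine intervalIntegral.integral_hasDerivWithinAt_right ?_
    (hf.stronglyMeasurableAtFilter_nhdsWithin measurableSet_Icc t) (hf t ht)
  exact (hf.mono (by rw [uIcc_of_le ht.1]; exact Icc_subset_Icc_right ht.2)).intervalIntegrable

lemma uIcc_zero_one : uIcc (0 : ℝ) 1 = Icc 0 1 := uIcc_of_le zero_le_one

lemma ae_mem_Icc_iff_Ioo {P : ℝ → Prop} (h : ∀ᵐ t, t ∈ Ioo (0 : ℝ) 1 → P t) :
    ∀ᵐ t, t ∈ Icc (0 : ℝ) 1 → P t := by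
  have h0 : ∀ᵐ t : ℝ, t ≠ 0 := by simp [ae_iff, measure_singleton]
  have h1 : ∀ᵐ t : ℝ, t ≠ 1 := by simp [ae_iff, measure_singleton]
  filter_upwards [h, h0, h1] with t ht a b hm
  exact ht ⟨lt_of_le_of_ne hm.1 (Ne.symm a), lt_of_le_of_ne hm.2 b⟩

lemma eqOn_Icc_of_ae_eq_Ioo {f g : ℝ → ℝ} (h : ∀ᵐ t, t ∈ Ioo (0 : ℝ) 1 → f t = g t)
    (hf : ContinuousOn f (Icc 0 1)) (hg : ContinuousOn g (Icc 0 1)) : EqOn f g (Icc 0 1) :=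
  volume.eqOn_Icc_of_ae_eq zero_ne_one
    ((ae_restrict_iff' measurableSet_Icc).2 (ae_mem_Icc_iff_Ioo h)) hf hg

lemma MemLpUnit.component {p : ℝ} {f : ℝ → Plane} (h : MemLpUnit p f) (i : Fin 2) :
    MemLp (fun t => f t i) (ENNReal.ofReal p) (volume.restrict (Ioo (0 : ℝ) 1)) :=
  (EuclideanSpace.proj (𝕜 := ℝ) i).comp_memLp' h

lemma MeasureTheory.MemLp.intervalIntegrable_unit {p : ℝ} (hp : 1 < p) {f : ℝ → ℝ}
    (h : MemLp f (ENNReal.ofReal p) (volume.restrict (Ioo (0 : ℝ) 1))) :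
    IntervalIntegrable f volume 0 1 := by
  rw [intervalIntegrable_iff_integrableOn_Ioo_of_le zero_le_one]
  exact h.integrable (by simpa using hp.le)

lemma HasWeakDeriv.component {f g : ℝ → Plane} (h : HasWeakDeriv f g)
    (hf : ∀ i, IntervalIntegrable (fun t => f t i) volume 0 1)
    (hg : ∀ i, IntervalIntegrable (fun t => g t i) volume 0 1)
    (i : Fin 2) {φ : ℝ → ℝ} (hφ : IsTestFunction φ) :
    ∫ t in (0 : ℝ)..1, deriv φ t * f t i = -∫ t in (0 : ℝ)..1, φ t * g t i := by
  have key : ∀ {ψ : ℝ → ℝ} {F : ℝ → Plane}, Continuous ψ →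
      (∀ i, IntervalIntegrable (fun t => F t i) volume 0 1) →
      (∫ t in Ioo (0 : ℝ) 1, ψ t • F t) i = ∫ t in (0 : ℝ)..1, ψ t * F t i := by
    intro ψ F hψ hF
    rw [intervalIntegral.integral_of_le zero_le_one, integral_Ioc_eq_integral_Ioo]
    have := (EuclideanSpace.proj (𝕜 := ℝ) i).integral_comp_comm
      (μ := volume.restrict (Ioo (0 : ℝ) 1)) (φ := fun t => ψ t • F t) ?_
    · simpa using this.symm
    · rw [← EuclideanSpace.equiv (Fin 2) ℝ |>.integrable_comp_iff]
      refine Integrable.of_eval fun j => ?_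
      have := (hF j).continuousOn_mul (g := ψ) hψ.continuousOn
      rw [intervalIntegrable_iff_integrableOn_Ioo_of_le zero_le_one] at this
      exact this
  have h2 := congrArg (fun x : Plane => x i) (h.2.2 φ hφ)
  simpa only [PiLp.neg_apply, key hφ.deriv.continuous hf, key hφ.continuous hg] using h2

/-- Regularity of immersed `W^{2,p}` curves: `V` is the derivative of `γ` and `w` the second
derivative. -/
theorem IsImmersedW2p.exists_derivatives {p : ℝ} (hp : 1 < p) {γ : ℝ → Plane}
    (hγ : IsImmersedW2p p γ) :
    ∃ V w : Fin 2 → ℝ → ℝ,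
      (∀ i, MemLp (w i) (ENNReal.ofReal p) (volume.restrict (Ioo (0 : ℝ) 1))) ∧
      (∀ i, AbsolutelyContinuousOnInterval (V i) 0 1) ∧
      (∀ i, ∀ᵐ t, t ∈ Icc (0 : ℝ) 1 → HasDerivAt (V i) (w i t) t) ∧
      (∀ t ∈ Icc (0 : ℝ) 1, HasDerivWithinAt γ !₂[V 0 t, V 1 t] (Icc 0 1) t) ∧
      ∀ t ∈ Icc (0 : ℝ) 1, 0 < V 0 t ^ 2 + V 1 t ^ 2 := by
  obtain ⟨⟨hγp, v, w, hv, hw, hγv, hvw⟩, hc, himm⟩ := hγ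
  have iγ := fun i => (hγp.component i).intervalIntegrable_unit hp
  have iv := fun i => (hv.component i).intervalIntegrable_unit hp
  have iw := fun i => (hw.component i).intervalIntegrable_unit hp
  have h1 := fun i => ae_eq_const_add_integral (iγ i) (iv i)
    fun φ hφ => hγv.component iγ iv i hφ
  have h2 := fun i => ae_eq_const_add_integral (iv i) (iw i)
    fun φ hφ => hvw.component iv iw i hφ
  choose c hc' using h1
  choose d hd using h2
  have hVac : ∀ i, AbsolutelyContinuousOnInterval
      (fun t => d i + ∫ r in (0 : ℝ)..t, w r i) 0 1 := fun i =>
    (contDiffOn_const.absolutelyContinuousOnInterval).fun_add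
      ((iw i).absolutelyContinuousOnInterval_intervalIntegral (c := 0) (by simp))
  have hVc : ∀ i, ContinuousOn (fun t => d i + ∫ r in (0 : ℝ)..t, w r i) (Icc 0 1) := fun i =>
    uIcc_zero_one ▸ (hVac i).continuousOn
  have hγ' : ∀ i, EqOn (fun t => γ t i)
      (fun t => c i + ∫ r in (0 : ℝ)..t, (d i + ∫ r in (0 : ℝ)..r, w r i)) (Icc 0 1) := by
    intro i
    -- The weak derivatives give this identity only almost everywhere; continuity of γ extends it to
    -- all of [0,1], end points included.
    refine eqOn_Icc_of_ae_eq_Ioo ?_ ?_ ?_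
    · filter_upwards [hc' i] with t ht hm
      rw [ht hm]
      congr 1
      refine intervalIntegral.integral_congr_ae ?_
      filter_upwards [hd i] with r hr hm'
      rw [uIoc_of_le hm.1.le] at hm'
      exact hr ⟨hm'.1, hm'.2.trans_lt hm.2⟩
    · exact (EuclideanSpace.proj (𝕜 := ℝ) i).continuous.comp_continuousOn hc
    · intro t ht
      exact ((hasDerivWithinAt_integral_of_continuousOn (hVc i) ht).const_add _).continuousWithinAt
  have hder : ∀ t ∈ Icc (0 : ℝ) 1, HasDerivWithinAt γ
      !₂[d 0 + ∫ r in (0 : ℝ)..t, w r 0, d 1 + ∫ r in (0 : ℝ)..t, w r 1] (Icc 0 1) t := by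
    intro t ht
    rw [Plane.hasDerivWithinAt_iff]
    intro i
    have := ((hasDerivWithinAt_integral_of_continuousOn (hVc i) ht).const_add (c i)).congr
      (hγ' i) (hγ' i ht)
    fin_cases i <;> exact this
  refine ⟨fun i t => d i + ∫ r in (0 : ℝ)..t, w r i, fun i t => w t i, hw.component, hVac,
    fun i => ?_, hder, fun t ht => ?_⟩
  · filter_upwards [(iw i).ae_hasDerivAt_integral] with t ht hm
    exact (ht (uIcc_zero_one ▸ hm) 0 (by simp)).const_add _
  · have h := himm t ht
    rw [(hder t ht).derivWithin (uniqueDiffOn_Icc zero_lt_one t ht)] at h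
    by_contra hn
    refine h ?_
    have e0 : d 0 + ∫ r in (0 : ℝ)..t, w r 0 = 0 := by
      nlinarith [sq_nonneg (d 1 + ∫ r in (0 : ℝ)..t, w r 1),
        sq_nonneg (d 0 + ∫ r in (0 : ℝ)..t, w r 0)]
    have e1 : d 1 + ∫ r in (0 : ℝ)..t, w r 1 = 0 := by
      nlinarith [sq_nonneg (d 1 + ∫ r in (0 : ℝ)..t, w r 1),
        sq_nonneg (d 0 + ∫ r in (0 : ℝ)..t, w r 0)]
    ext i
    fin_cases i <;> simp [e0, e1]

/-! ### Signed powers -/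

/-- The signed power `|x|^(r-2) x`. -/
def sgnPow (r x : ℝ) : ℝ := |x| ^ (r - 2) * x

lemma sgnPow_zero (r : ℝ) : sgnPow r 0 = 0 := by simp [sgnPow]

lemma sgnPow_neg (r x : ℝ) : sgnPow r (-x) = -sgnPow r x := by simp [sgnPow]

lemma sgnPow_mul (r x y : ℝ) : sgnPow r (x * y) = sgnPow r x * sgnPow r y := by
  simp only [sgnPow, abs_mul, mul_rpow (abs_nonneg x) (abs_nonneg y)]; ring

lemma sgnPow_of_pos (r : ℝ) {x : ℝ} (hx : 0 < x) : sgnPow r x = x ^ (r - 1) := by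
  rw [sgnPow, abs_of_pos hx, ← rpow_add_one hx.ne']; congr 1; ring

lemma sgnPow_pos (r : ℝ) {x : ℝ} (hx : 0 < x) : 0 < sgnPow r x := by
  rw [sgnPow_of_pos r hx]; positivity

lemma abs_sgnPow {r : ℝ} (hr : 1 < r) (x : ℝ) : |sgnPow r x| = |x| ^ (r - 1) := by
  rcases eq_or_ne x 0 with rfl | hx
  · rw [sgnPow_zero, abs_zero, zero_rpow (by linarith)]
  · rw [sgnPow, abs_mul, abs_rpow_of_nonneg (abs_nonneg x), abs_abs,
      ← rpow_add_one (abs_pos.2 hx).ne']; congr 1; ring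

/-- The exponents p - 1 and p/(p-1) - 1 = 1/(p-1) are reciprocal. This recovers the curvature k from
u = |k|^(p-2) k. -/
lemma sgnPow_sgnPow {p : ℝ} (hp : 1 < p) (x : ℝ) : sgnPow (p / (p - 1)) (sgnPow p x) = x := by
  have hp1 : p - 1 ≠ 0 := by linarith
  have key : ∀ {x : ℝ}, 0 < x → sgnPow (p / (p - 1)) (sgnPow p x) = x := fun hx => by
    rw [sgnPow_of_pos _ (sgnPow_pos _ hx), sgnPow_of_pos _ hx, ← rpow_mul hx.le]
    convert rpow_one _ using 2
    field_simp; ring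
  rcases lt_trichotomy x 0 with hx | rfl | hx
  · have := key (neg_pos.2 hx)
    rw [sgnPow_neg, sgnPow_neg] at this; linarith
  · simp [sgnPow_zero]
  · exact key hx

lemma sgnPow_comp (r s x : ℝ) : sgnPow r (sgnPow s x) = sgnPow ((r - 1) * (s - 1) + 1) x := by
  have key : ∀ {x : ℝ}, 0 < x → sgnPow r (sgnPow s x) = sgnPow ((r - 1) * (s - 1) + 1) x :=
    fun hx => by
      rw [sgnPow_of_pos _ (sgnPow_pos _ hx), sgnPow_of_pos _ hx, sgnPow_of_pos _ hx,
        ← rpow_mul hx.le]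
      congr 1; ring
  rcases lt_trichotomy x 0 with hx | rfl | hx
  · have := key (neg_pos.2 hx)
    rwa [sgnPow_neg, sgnPow_neg, sgnPow_neg, neg_inj] at this
  · simp [sgnPow_zero]
  · exact key hx

lemma continuous_sgnPow {r : ℝ} (hr : 1 < r) : Continuous (sgnPow r) := by
  rw [continuous_iff_continuousAt]
  intro x
  rcases eq_or_ne x 0 with rfl | hx
  · rw [ContinuousAt, sgnPow_zero]
    refine squeeze_zero_norm (a := fun x => |x| ^ (r - 1)) (fun x => (abs_sgnPow hr x).le) ?_
    have : ContinuousAt (fun x : ℝ => |x| ^ (r - 1)) 0 :=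
      continuous_abs.continuousAt.rpow_const (Or.inr (by linarith))
    simpa [ContinuousAt, zero_rpow (show r - 1 ≠ 0 by linarith)] using this
  · exact (continuous_abs.continuousAt.rpow_const (Or.inl (abs_ne_zero.2 hx))).mul continuousAt_id

lemma hasDerivAt_sgnPow_of_ne (r : ℝ) {x : ℝ} (hx : x ≠ 0) :
    HasDerivAt (sgnPow r) ((r - 1) * |x| ^ (r - 2)) x := by
  have h0 : ∀ {x : ℝ}, 0 < x → HasDerivAt (sgnPow r) ((r - 1) * |x| ^ (r - 2)) x := by
    intro x hx
    rw [abs_of_pos hx]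
    have := hasDerivAt_rpow_const (x := x) (p := r - 1) (Or.inl hx.ne')
    rw [show r - 1 - 1 = r - 2 by ring] at this
    refine this.congr_of_eventuallyEq ?_
    filter_upwards [lt_mem_nhds hx] with y hy using sgnPow_of_pos r hy
  rcases lt_or_gt_of_ne hx with h | h
  · have := ((h0 (neg_pos.2 h)).scomp x (hasDerivAt_neg x)).neg
    simp only [abs_neg, smul_eq_mul, neg_mul, one_mul, neg_neg] at this
    convert! this using 1
    funext z
    simp [sgnPow_neg]
  · exact h0 h

lemma hasDerivAt_sgnPow {r : ℝ} (hr : 2 ≤ r) (x : ℝ) :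
    HasDerivAt (sgnPow r) ((r - 1) * |x| ^ (r - 2)) x := by
  refine hasDerivAt_of_hasDerivAt_of_ne' (x := 0) (g := fun x => (r - 1) * |x| ^ (r - 2))
    (fun y hy => hasDerivAt_sgnPow_of_ne r hy)
    (continuous_sgnPow (by linarith)).continuousAt ?_ x
  exact continuousAt_const.mul
    (continuous_abs.continuousAt.rpow_const (Or.inr (by linarith)))

/-- For r ≥ 2 the signed power is continuously differentiable even at 0. Applied with r = p/(p-1),
this is how p ≤ 2 yields uniqueness for the curvature system. -/
lemma exists_lipschitzOnWith_sgnPow {r : ℝ} (hr : 2 ≤ r) (M : ℝ) :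
    ∃ K : NNReal, LipschitzOnWith K (sgnPow r) (Icc (-M) M) := by
  have : ContDiff ℝ 1 (sgnPow r) := by
    rw [contDiff_one_iff_deriv]
    refine ⟨fun x => (hasDerivAt_sgnPow hr x).differentiableAt, ?_⟩
    rw [funext fun x => (hasDerivAt_sgnPow hr x).deriv]
    exact continuous_const.mul
      (continuous_abs.rpow_const fun x => Or.inr (by linarith))
  exact this.contDiffOn.exists_lipschitzOnWith (by decide) (convex_Icc _ _) isCompact_Icc

/-- The sum covers both signs of b: for b ≥ 0 the term at M suffices, for b ≤ 0 the term at m. -/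
lemma rpow_le_add_of_mem_Icc {m M x : ℝ} (hm : 0 < m) (h1 : m ≤ x) (h2 : x ≤ M) (b : ℝ) :
    x ^ b ≤ m ^ b + M ^ b := by
  have hx := hm.trans_le h1
  have hM := hx.trans_le h2
  rcases le_total 0 b with hb | hb
  · exact (rpow_le_rpow hx.le h2 hb).trans (le_add_of_nonneg_left (by positivity))
  · exact (rpow_le_rpow_of_nonpos hm h1 hb).trans (le_add_of_nonneg_right (by positivity))

/-! ### First variation of bending energy and length -/

/-- Differentiation under the integral sign of `∫ |a₀ + ε a₁|^p (q₀ + ε q₁ + ε² q₂)^a`. -/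
theorem hasDerivAt_integral_abs_rpow_mul_rpow {p a m M C δ : ℝ} (hp : 1 < p) (hm : 0 < m)
    (hδ : 0 < δ) (hδ1 : δ ≤ 1) {a₀ a₁ q₀ q₁ q₂ Ω : ℝ → ℝ}
    (ma₀ : AEStronglyMeasurable a₀ (volume.restrict (uIoc (0 : ℝ) 1)))
    (ma₁ : AEStronglyMeasurable a₁ (volume.restrict (uIoc (0 : ℝ) 1)))
    (mq₀ : AEStronglyMeasurable q₀ (volume.restrict (uIoc (0 : ℝ) 1)))
    (mq₁ : AEStronglyMeasurable q₁ (volume.restrict (uIoc (0 : ℝ) 1)))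
    (mq₂ : AEStronglyMeasurable q₂ (volume.restrict (uIoc (0 : ℝ) 1)))
    (ha₀ : ∀ t ∈ uIoc (0 : ℝ) 1, |a₀ t| ≤ Ω t) (ha₁ : ∀ t ∈ uIoc (0 : ℝ) 1, |a₁ t| ≤ Ω t)
    (hΩ : IntervalIntegrable (fun t => Ω t ^ p) volume 0 1)
    (hq₁ : ∀ t ∈ uIoc (0 : ℝ) 1, |q₁ t| ≤ C) (hq₂ : ∀ t ∈ uIoc (0 : ℝ) 1, |q₂ t| ≤ C)
    (hQ : ∀ t ∈ uIoc (0 : ℝ) 1, ∀ ε : ℝ, |ε| < δ →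
      q₀ t + ε * q₁ t + ε ^ 2 * q₂ t ∈ Icc m M) :
    IntervalIntegrable (fun t => p * sgnPow p (a₀ t) * a₁ t * q₀ t ^ a +
        |a₀ t| ^ p * (a * q₀ t ^ (a - 1) * q₁ t)) volume 0 1 ∧
    HasDerivAt (fun ε => ∫ t in (0 : ℝ)..1,
        |a₀ t + ε * a₁ t| ^ p * (q₀ t + ε * q₁ t + ε ^ 2 * q₂ t) ^ a)
      (∫ t in (0 : ℝ)..1, (p * sgnPow p (a₀ t) * a₁ t * q₀ t ^ a +
        |a₀ t| ^ p * (a * q₀ t ^ (a - 1) * q₁ t))) 0 := by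
  let F : ℝ → ℝ → ℝ := fun ε t =>
    |a₀ t + ε * a₁ t| ^ p * (q₀ t + ε * q₁ t + ε ^ 2 * q₂ t) ^ a
  let F' : ℝ → ℝ → ℝ := fun ε t =>
    (p * sgnPow p (a₀ t + ε * a₁ t) * a₁ t) * (q₀ t + ε * q₁ t + ε ^ 2 * q₂ t) ^ a +
      |a₀ t + ε * a₁ t| ^ p *
        (a * (q₀ t + ε * q₁ t + ε ^ 2 * q₂ t) ^ (a - 1) * (q₁ t + 2 * ε * q₂ t))
  have mD : ∀ ε : ℝ, AEStronglyMeasurable (fun t => a₀ t + ε * a₁ t)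
      (volume.restrict (uIoc (0 : ℝ) 1)) := fun ε => ma₀.add (ma₁.const_mul ε)
  have mQ : ∀ ε : ℝ, AEStronglyMeasurable (fun t => q₀ t + ε * q₁ t + ε ^ 2 * q₂ t)
      (volume.restrict (uIoc (0 : ℝ) 1)) := fun ε =>
    (mq₀.add (mq₁.const_mul ε)).add (mq₂.const_mul _)
  have mabs : ∀ ε : ℝ, AEStronglyMeasurable (fun t => |a₀ t + ε * a₁ t| ^ p)
      (volume.restrict (uIoc (0 : ℝ) 1)) := fun ε =>
    ((mD ε).norm.aemeasurable.pow_const p).aestronglyMeasurable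
  have mrp : ∀ ε b : ℝ, AEStronglyMeasurable (fun t => (q₀ t + ε * q₁ t + ε ^ 2 * q₂ t) ^ b)
      (volume.restrict (uIoc (0 : ℝ) 1)) := fun ε b =>
    ((mQ ε).aemeasurable.pow_const b).aestronglyMeasurable
  have mF : ∀ ε, AEStronglyMeasurable (F ε) (volume.restrict (uIoc (0 : ℝ) 1)) := fun ε =>
    (mabs ε).mul (mrp ε a)
  have mF' : AEStronglyMeasurable (F' 0) (volume.restrict (uIoc (0 : ℝ) 1)) :=
    (((((continuous_sgnPow hp).comp_aestronglyMeasurable (mD 0)).const_mul p).mul ma₁).mul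
      (mrp 0 a)).add ((mabs 0).mul (((mrp 0 (a - 1)).const_mul a).mul
        (mq₁.add (mq₂.const_mul (2 * 0)))))
  -- Both terms of F' are bounded by a constant times (2 Ω)^p. The factor 3 C bounds |q₁ + 2 ε q₂|,
  -- because |ε| ≤ 1.
  let K : ℝ := p * (m ^ a + M ^ a) + |a| * (m ^ (a - 1) + M ^ (a - 1)) * (3 * C)
  have hDb : ∀ t ∈ uIoc (0 : ℝ) 1, ∀ ε : ℝ, |ε| < δ → |a₀ t + ε * a₁ t| ≤ 2 * Ω t := by
    intro t ht ε hε
    have h1 := abs_add_le (a₀ t) (ε * a₁ t)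
    rw [abs_mul] at h1
    have h2 : |ε| * |a₁ t| ≤ 1 * Ω t :=
      mul_le_mul (hε.le.trans hδ1) (ha₁ t ht) (abs_nonneg _) zero_le_one
    linarith [ha₀ t ht]
  have hΩ0 : ∀ t ∈ uIoc (0 : ℝ) 1, 0 ≤ Ω t := fun t ht => (abs_nonneg _).trans (ha₀ t ht)
  have hpow : ∀ t ∈ uIoc (0 : ℝ) 1, ∀ ε : ℝ, |ε| < δ →
      |a₀ t + ε * a₁ t| ^ p ≤ (2 * Ω t) ^ p := fun t ht ε hε =>
    rpow_le_rpow (abs_nonneg _) (hDb t ht ε hε) (by linarith)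
  have i2Ω : ∀ c : ℝ, IntervalIntegrable (fun t => c * (2 ^ p * Ω t ^ p)) volume 0 1 := fun c =>
    (hΩ.const_mul _).const_mul _
  have e2Ω : ∀ t ∈ uIoc (0 : ℝ) 1, (2 * Ω t) ^ p = 2 ^ p * Ω t ^ p := fun t ht =>
    mul_rpow zero_le_two (hΩ0 t ht)
  have main := intervalIntegral.hasDerivAt_integral_of_dominated_loc_of_deriv_le (μ := volume)
    (F := F) (F' := F') (x₀ := (0 : ℝ)) (a := 0) (b := 1) (s := Metric.ball 0 δ)
    (bound := fun t => K * (2 ^ p * Ω t ^ p)) (Metric.ball_mem_nhds 0 hδ)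
    (Filter.Eventually.of_forall mF) ?_ mF' ?_ (i2Ω K) ?_
  · have e : F' 0 = fun t => p * sgnPow p (a₀ t) * a₁ t * q₀ t ^ a +
        |a₀ t| ^ p * (a * q₀ t ^ (a - 1) * q₁ t) := by
      funext t
      simp [F']
    rw [e] at main
    exact main
  · rw [intervalIntegrable_iff]
    have h := (i2Ω (m ^ a + M ^ a))
    rw [intervalIntegrable_iff] at h
    refine h.mono' (mF 0) ?_
    rw [ae_restrict_iff' measurableSet_uIoc]
    refine Filter.Eventually.of_forall fun t ht => ?_
    have h0 : |(0 : ℝ)| < δ := by simpa using hδ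
    have hq := hQ t ht 0 h0
    have hq0 := hm.trans_le hq.1
    rw [← e2Ω t ht, norm_eq_abs, abs_mul, abs_of_nonneg (rpow_nonneg (abs_nonneg _) _),
      abs_of_pos (rpow_pos_of_pos hq0 _), mul_comm]
    exact mul_le_mul (rpow_le_add_of_mem_Icc hm hq.1 hq.2 a) (hpow t ht 0 h0)
      (rpow_nonneg (abs_nonneg _) _)
      ((rpow_nonneg hq0.le a).trans (rpow_le_add_of_mem_Icc hm hq.1 hq.2 a))
  · refine Filter.Eventually.of_forall fun t ht ε hε => ?_
    rw [mem_ball_zero_iff, norm_eq_abs] at hε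
    have hq := hQ t ht ε hε
    have hq0 := hm.trans_le hq.1
    have hC : 0 ≤ C := (abs_nonneg _).trans (hq₁ t ht)
    have hD := hDb t ht ε hε
    have b1 : |sgnPow p (a₀ t + ε * a₁ t)| ≤ (2 * Ω t) ^ (p - 1) := by
      rw [abs_sgnPow hp]
      exact rpow_le_rpow (abs_nonneg _) hD (by linarith)
    have b2 : |a₁ t| ≤ 2 * Ω t := by linarith [ha₁ t ht, hΩ0 t ht]
    have b3 : |q₁ t + 2 * ε * q₂ t| ≤ 3 * C := by
      have h1 := abs_add_le (q₁ t) (2 * ε * q₂ t)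
      rw [abs_mul, abs_mul, abs_two] at h1
      have h2 : |ε| * |q₂ t| ≤ 1 * C :=
        mul_le_mul (hε.le.trans hδ1) (hq₂ t ht) (abs_nonneg _) zero_le_one
      linarith [hq₁ t ht]
    have b4 := rpow_le_add_of_mem_Icc hm hq.1 hq.2 a
    have b5 := rpow_le_add_of_mem_Icc hm hq.1 hq.2 (a - 1)
    have e1 : (2 * Ω t) ^ (p - 1) * (2 * Ω t) = (2 * Ω t) ^ p := by
      rcases (mul_nonneg zero_le_two (hΩ0 t ht)).eq_or_lt with h | h
      · rw [← h, mul_zero, zero_rpow (by linarith)]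
      · rw [← rpow_add_one h.ne']; congr 1; ring
    have n0 := hΩ0 t ht
    rw [← e2Ω t ht]
    calc ‖F' ε t‖ ≤ |p * sgnPow p (a₀ t + ε * a₁ t) * a₁ t *
          (q₀ t + ε * q₁ t + ε ^ 2 * q₂ t) ^ a| + abs (|a₀ t + ε * a₁ t| ^ p *
        (a * (q₀ t + ε * q₁ t + ε ^ 2 * q₂ t) ^ (a - 1) * (q₁ t + 2 * ε * q₂ t))) :=
          abs_add_le _ _
      _ = p * (|sgnPow p (a₀ t + ε * a₁ t)| * |a₁ t|) *
          (q₀ t + ε * q₁ t + ε ^ 2 * q₂ t) ^ a + |a₀ t + ε * a₁ t| ^ p *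
        (|a| * (q₀ t + ε * q₁ t + ε ^ 2 * q₂ t) ^ (a - 1) * |q₁ t + 2 * ε * q₂ t|) := by
          simp only [abs_mul, abs_of_nonneg (rpow_nonneg (abs_nonneg (a₀ t + ε * a₁ t)) p),
            abs_of_pos (rpow_pos_of_pos hq0 a), abs_of_pos (rpow_pos_of_pos hq0 (a - 1)),
            abs_of_pos (show 0 < p by linarith)]
          ring
      _ ≤ p * ((2 * Ω t) ^ (p - 1) * (2 * Ω t)) * (m ^ a + M ^ a) + (2 * Ω t) ^ p *
        (|a| * (m ^ (a - 1) + M ^ (a - 1)) * (3 * C)) := by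
          have := hpow t ht ε hε
          have : 0 ≤ m ^ a + M ^ a := (rpow_nonneg hq0.le a).trans b4
          have : 0 ≤ m ^ (a - 1) + M ^ (a - 1) := (rpow_nonneg hq0.le _).trans b5
          gcongr
      _ = K * (2 * Ω t) ^ p := by rw [e1]; simp only [K]; ring
  · refine Filter.Eventually.of_forall fun t ht ε hε => ?_
    rw [mem_ball_zero_iff, norm_eq_abs] at hε
    have hq0 := hm.trans_le (hQ t ht ε hε).1
    have d1 : HasDerivAt (fun ε => a₀ t + ε * a₁ t) (a₁ t) ε := by
      simpa using ((hasDerivAt_id ε).mul_const (a₁ t)).const_add (a₀ t)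
    have d2 : HasDerivAt (fun ε => q₀ t + ε * q₁ t + ε ^ 2 * q₂ t) (q₁ t + 2 * ε * q₂ t) ε := by
      simpa using (((hasDerivAt_id ε).mul_const (q₁ t)).const_add (q₀ t)).fun_add
        ((hasDerivAt_pow 2 ε).mul_const (q₂ t))
    have d3 := (hasDerivAt_abs_rpow (a₀ t + ε * a₁ t) hp).comp ε d1
    have d4 := d2.rpow_const (p := a) (Or.inl hq0.ne')
    convert! d3.mul d4 using 1
    simp only [F', sgnPow, Function.comp_apply]
    ring

/-- `V` is the first and `w` the second derivative of the immersed `W^{2,p}`-curve `γ`. -/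
structure IsDerivPair (p : ℝ) (γ : ℝ → Plane) (V w : Fin 2 → ℝ → ℝ) : Prop where
  memLp : ∀ i, MemLp (w i) (ENNReal.ofReal p) (volume.restrict (Ioo (0 : ℝ) 1))
  ac : ∀ i, AbsolutelyContinuousOnInterval (V i) 0 1
  ae_hasDerivAt : ∀ i, ∀ᵐ t, t ∈ Icc (0 : ℝ) 1 → HasDerivAt (V i) (w i t) t
  hasDerivWithinAt : ∀ t ∈ Icc (0 : ℝ) 1, HasDerivWithinAt γ !₂[V 0 t, V 1 t] (Icc 0 1) t
  pos : ∀ t ∈ Icc (0 : ℝ) 1, 0 < V 0 t ^ 2 + V 1 t ^ 2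

namespace IsDerivPair

variable {p : ℝ} {γ : ℝ → Plane} {V w : Fin 2 → ℝ → ℝ}

lemma continuousOn (h : IsDerivPair p γ V w) (i : Fin 2) : ContinuousOn (V i) (Icc 0 1) :=
  uIcc_zero_one ▸ (h.ac i).continuousOn

lemma hasDerivAt (h : IsDerivPair p γ V w) {t : ℝ} (ht : t ∈ Ioo (0 : ℝ) 1) :
    HasDerivAt γ !₂[V 0 t, V 1 t] t :=
  (h.hasDerivWithinAt t (Ioo_subset_Icc_self ht)).hasDerivAt (Icc_mem_nhds ht.1 ht.2)

lemma aestronglyMeasurable (h : IsDerivPair p γ V w) (i : Fin 2) :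
    AEStronglyMeasurable (V i) (volume.restrict (uIoc (0 : ℝ) 1)) := by
  rw [uIoc_of_le zero_le_one]
  exact ((h.continuousOn i).mono Ioc_subset_Icc_self).aestronglyMeasurable measurableSet_Ioc

lemma aestronglyMeasurable' (h : IsDerivPair p γ V w) (i : Fin 2) :
    AEStronglyMeasurable (w i) (volume.restrict (uIoc (0 : ℝ) 1)) := by
  rw [uIoc_of_le zero_le_one, ← Measure.restrict_congr_set Ioo_ae_eq_Ioc]
  exact (h.memLp i).1

lemma intervalIntegrable_dominating (h : IsDerivPair p γ V w) (hp : 1 < p) {K : ℝ} (hK : 0 ≤ K) :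
    IntervalIntegrable (fun t => (K * (1 + |w 0 t| + |w 1 t|)) ^ p) volume 0 1 := by
  have h0 : MemLp (fun _ : ℝ => (1 : ℝ)) (ENNReal.ofReal p)
      (volume.restrict (Ioo (0 : ℝ) 1)) := memLp_const 1
  have h1 := ((h0.add (h.memLp 0).abs).add (h.memLp 1).abs).integrable_norm_rpow
    (by simp; linarith) (by simp)
  rw [ENNReal.toReal_ofReal (by linarith)] at h1
  rw [intervalIntegrable_iff_integrableOn_Ioo_of_le zero_le_one]
  refine (h1.const_mul (K ^ p)).congr (Filter.Eventually.of_forall fun t => ?_)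
  have : 0 ≤ 1 + |w 0 t| + |w 1 t| := by positivity
  change _ = (K * (1 + |w 0 t| + |w 1 t|)) ^ p
  rw [mul_rpow hK this, ← norm_of_nonneg this]
  rfl

/-- The energies of the perturbed curve `γ + ε φ e`, `e = (e₀, e₁)`. -/
lemma energies_eq (h : IsDerivPair p γ V w) {φ : ℝ → ℝ} (hφ : IsTestFunction φ) (e₀ e₁ ε : ℝ)
    {Q : ℝ → ℝ} (hQ : ∀ t ∈ Ioo (0 : ℝ) 1, 0 < Q t)
    (hQe : ∀ t, Q t = V 0 t ^ 2 + V 1 t ^ 2 + ε * (2 * deriv φ t * (V 0 t * e₀ + V 1 t * e₁)) +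
      ε ^ 2 * (deriv φ t ^ 2 * (e₀ ^ 2 + e₁ ^ 2))) :
    bendingEnergy p (γ + ε • fun t => φ t • (!₂[e₀, e₁] : Plane)) =
      (∫ t in (0 : ℝ)..1, |V 0 t * w 1 t - V 1 t * w 0 t + ε * (deriv φ t * (e₀ * w 1 t - e₁ * w 0 t)
        + deriv (deriv φ) t * (V 0 t * e₁ - V 1 t * e₀))| ^ p * Q t ^ ((1 - 3 * p) / 2)) ∧
    curveLength (γ + ε • fun t => φ t • (!₂[e₀, e₁] : Plane)) =
      ∫ t in (0 : ℝ)..1, Q t ^ (1 / 2 : ℝ) := by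
  set Γ : ℝ → Plane := γ + ε • fun t => φ t • (!₂[e₀, e₁] : Plane) with hΓ
  have d1 : ∀ t ∈ Ioo (0 : ℝ) 1,
      deriv Γ t = !₂[V 0 t + ε * (deriv φ t * e₀), V 1 t + ε * (deriv φ t * e₁)] := by
    intro t ht
    have := (h.hasDerivAt ht).add (((hφ.hasDerivAt t).smul_const (!₂[e₀, e₁] : Plane)).const_smul ε)
    rw [show Γ = γ + ε • fun t => φ t • (!₂[e₀, e₁] : Plane) from rfl]
    refine (this.deriv).trans ?_
    ext i
    fin_cases i <;> simp
  have nQ : ∀ t ∈ Ioo (0 : ℝ) 1, ‖deriv Γ t‖ = Q t ^ (1 / 2 : ℝ) := by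
    intro t ht
    rw [← sqrt_eq_rpow, Plane.norm_eq_sqrt, d1 t ht, hQe]
    congr 1
    simp
    ring
  have d2 : ∀ᵐ t, t ∈ Ioo (0 : ℝ) 1 → deriv (deriv Γ) t =
      !₂[w 0 t + ε * (deriv (deriv φ) t * e₀), w 1 t + ε * (deriv (deriv φ) t * e₁)] := by
    filter_upwards [h.ae_hasDerivAt 0, h.ae_hasDerivAt 1] with t h0 h1 ht
    have ht' := Ioo_subset_Icc_self ht
    have dφ := hφ.deriv.hasDerivAt t
    have := Plane.hasDerivAt_mk ((h0 ht').add ((dφ.mul_const e₀).const_mul ε))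
      ((h1 ht').add ((dφ.mul_const e₁).const_mul ε))
    refine (this.congr_of_eventuallyEq ?_).deriv
    filter_upwards [Ioo_mem_nhds ht.1 ht.2] with r hr using d1 r hr
  have n1 : ∀ᵐ t : ℝ, t ≠ 1 := by simp [ae_iff, measure_singleton]
  have mIoo : ∀ t, t ∈ uIoc (0 : ℝ) 1 → t ≠ 1 → t ∈ Ioo (0 : ℝ) 1 := fun t ht h1 => by
    rw [uIoc_of_le zero_le_one] at ht
    exact ⟨ht.1, lt_of_le_of_ne ht.2 h1⟩
  constructor
  · refine intervalIntegral.integral_congr_ae ?_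
    filter_upwards [d2, n1] with t h2 hn ht
    have ht := mIoo t ht hn
    have hq := hQ t ht
    have hn := nQ t ht
    simp only [signedCurvature, hn]
    rw [h2 ht, d1 t ht]
    simp only [Matrix.cons_val_zero, Matrix.cons_val_one]
    rw [abs_div, div_rpow (abs_nonneg _) (abs_nonneg _), abs_of_pos (pow_pos (rpow_pos_of_pos hq _) 3),
      div_mul_eq_mul_div,
      mul_div_assoc]
    congr 1
    · congr 2; ring
    -- |k|^p ds carries the speed to the power 1 - 3 p, hence its square Q to half that power.
    · rw [← rpow_natCast, ← rpow_mul hq.le, ← rpow_mul hq.le, ← rpow_sub hq]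
      congr 1
      push_cast; ring
  · refine intervalIntegral.integral_congr_ae ?_
    filter_upwards [n1] with t hn ht
    exact nQ t (mIoo t ht hn)

end IsDerivPair

/-- `det (V, w)`. -/
def detPair (V w : Fin 2 → ℝ → ℝ) (t : ℝ) : ℝ := V 0 t * w 1 t - V 1 t * w 0 t

/-- `|V|²`. -/
def speedSq (V : Fin 2 → ℝ → ℝ) (t : ℝ) : ℝ := V 0 t ^ 2 + V 1 t ^ 2

/-- The coefficient of the normal part of the first variation. -/
def normalCoeff (p : ℝ) (V w : Fin 2 → ℝ → ℝ) (t : ℝ) : ℝ :=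
  sgnPow p (detPair V w t) * (p * speedSq V t ^ ((1 - 3 * p) / 2))

/-- The coefficient of the tangential part of the first variation. -/
def tangentCoeff (p lam : ℝ) (V w : Fin 2 → ℝ → ℝ) (t : ℝ) : ℝ :=
  |detPair V w t| ^ p * ((1 - 3 * p) * speedSq V t ^ ((1 - 3 * p) / 2 - 1)) +
    lam * speedSq V t ^ (1 / 2 - 1 : ℝ)

namespace IsDerivPair

variable {p : ℝ} {γ : ℝ → Plane} {V w : Fin 2 → ℝ → ℝ}

lemma continuousOn_speedSq (h : IsDerivPair p γ V w) : ContinuousOn (speedSq V) (Icc 0 1) :=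
  ((h.continuousOn 0).pow 2).add ((h.continuousOn 1).pow 2)

lemma continuousOn_speedSq_rpow (h : IsDerivPair p γ V w) (b : ℝ) :
    ContinuousOn (fun t => speedSq V t ^ b) (Icc 0 1) :=
  h.continuousOn_speedSq.rpow_const fun t ht => Or.inl (h.pos t ht).ne'

lemma exists_bound (h : IsDerivPair p γ V w) : ∃ K : ℝ, 1 ≤ K ∧
    ∀ i, ∀ t ∈ Icc (0 : ℝ) 1, |V i t| ≤ K := by
  obtain ⟨K0, h0⟩ := isCompact_Icc.exists_bound_of_continuousOn (h.continuousOn 0)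
  obtain ⟨K1, h1⟩ := isCompact_Icc.exists_bound_of_continuousOn (h.continuousOn 1)
  refine ⟨max 1 (max K0 K1), le_max_left _ _, fun i t ht => ?_⟩
  fin_cases i
  · exact (h0 t ht).trans (by simp)
  · exact (h1 t ht).trans (by simp)

lemma abs_detPair_le {K t : ℝ} (h0 : |V 0 t| ≤ K) (h1 : |V 1 t| ≤ K) :
    |detPair V w t| ≤ K * (1 + |w 0 t| + |w 1 t|) := by
  have hK : 0 ≤ K := (abs_nonneg _).trans h0
  have := abs_sub (V 0 t * w 1 t) (V 1 t * w 0 t)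
  rw [abs_mul, abs_mul] at this
  have a := mul_le_mul_of_nonneg_right h0 (abs_nonneg (w 1 t))
  have b := mul_le_mul_of_nonneg_right h1 (abs_nonneg (w 0 t))
  rw [detPair]; linarith

lemma aestronglyMeasurable_detPair (h : IsDerivPair p γ V w) :
    AEStronglyMeasurable (detPair V w) (volume.restrict (uIoc (0 : ℝ) 1)) :=
  ((h.aestronglyMeasurable 0).mul (h.aestronglyMeasurable' 1)).sub
    ((h.aestronglyMeasurable 1).mul (h.aestronglyMeasurable' 0))

lemma intervalIntegrable_aux (h : IsDerivPair p γ V w) (hp : 1 < p) :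
    IntervalIntegrable (fun t => sgnPow p (detPair V w t)) volume 0 1 ∧
    (∀ i, IntervalIntegrable (fun t => sgnPow p (detPair V w t) * w i t) volume 0 1) ∧
    IntervalIntegrable (fun t => |detPair V w t| ^ p) volume 0 1 := by
  obtain ⟨K, hK1, hK⟩ := h.exists_bound
  have hd := h.intervalIntegrable_dominating hp (zero_le_one.trans hK1)
  have mD := h.aestronglyMeasurable_detPair
  have mS := (continuous_sgnPow hp).comp_aestronglyMeasurable mD
  have hsub : ∀ t ∈ uIoc (0 : ℝ) 1, t ∈ Icc (0 : ℝ) 1 := fun t ht =>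
    uIcc_zero_one ▸ uIoc_subset_uIcc ht
  have hD : ∀ t ∈ uIoc (0 : ℝ) 1, |detPair V w t| ≤ K * (1 + |w 0 t| + |w 1 t|) := fun t ht =>
    abs_detPair_le (hK 0 t (hsub t ht)) (hK 1 t (hsub t ht))
  -- The summand 1 keeps the dominating function above 1, so its lower power p - 1 is dominated by
  -- its p-th power.
  have hΩ : ∀ t, 1 ≤ K * (1 + |w 0 t| + |w 1 t|) := fun t => by
    nlinarith [abs_nonneg (w 0 t), abs_nonneg (w 1 t)]
  have hS : ∀ t ∈ uIoc (0 : ℝ) 1, |sgnPow p (detPair V w t)| ≤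
      (K * (1 + |w 0 t| + |w 1 t|)) ^ (p - 1) := fun t ht => by
    rw [abs_sgnPow hp]
    exact rpow_le_rpow (abs_nonneg _) (hD t ht) (by linarith)
  refine ⟨hd.mono_fun' mS ?_, fun i => hd.mono_fun' (mS.mul (h.aestronglyMeasurable' i)) ?_,
    hd.mono_fun' (mD.norm.aemeasurable.pow_const p).aestronglyMeasurable ?_⟩
  all_goals
    refine (ae_restrict_iff' measurableSet_uIoc).2 (Filter.Eventually.of_forall fun t ht => ?_)
    simp only [norm_eq_abs]
  · exact (hS t ht).trans (rpow_le_rpow_of_exponent_le (hΩ t) (by linarith))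
  · have hw : |w i t| ≤ K * (1 + |w 0 t| + |w 1 t|) := by
      have : |w i t| ≤ 1 + |w 0 t| + |w 1 t| := by
        fin_cases i
        · simp only [Fin.zero_eta]; linarith [abs_nonneg (w 1 t)]
        · simp only [Fin.mk_one]; linarith [abs_nonneg (w 0 t)]
      nlinarith [abs_nonneg (w 0 t), abs_nonneg (w 1 t)]
    rw [abs_mul]
    refine (mul_le_mul (hS t ht) hw (abs_nonneg _)
      (rpow_nonneg (zero_le_one.trans (hΩ t)) _)).trans_eq ?_
    rw [← rpow_add_one (by linarith [hΩ t])]; congr 1; ring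
  · rw [abs_of_nonneg (rpow_nonneg (abs_nonneg _) _)]
    exact rpow_le_rpow (abs_nonneg _) (hD t ht) (by linarith)

lemma intervalIntegrable_normalCoeff_mul (h : IsDerivPair p γ V w) (hp : 1 < p) (i : Fin 2) :
    IntervalIntegrable (fun t => normalCoeff p V w t * w i t) volume 0 1 := by
  have := ((h.intervalIntegrable_aux hp).2.1 i).mul_continuousOn
    (g := fun t => p * speedSq V t ^ ((1 - 3 * p) / 2))
    (uIcc_zero_one ▸ continuousOn_const.mul (h.continuousOn_speedSq_rpow _))
  refine this.congr fun t _ => ?_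
  simp only [normalCoeff]; ring

lemma intervalIntegrable_normalCoeff (h : IsDerivPair p γ V w) (hp : 1 < p) :
    IntervalIntegrable (normalCoeff p V w) volume 0 1 :=
  (h.intervalIntegrable_aux hp).1.mul_continuousOn
    (uIcc_zero_one ▸ continuousOn_const.mul (h.continuousOn_speedSq_rpow _))

lemma intervalIntegrable_tangentCoeff (h : IsDerivPair p γ V w) (hp : 1 < p) (lam : ℝ) :
    IntervalIntegrable (tangentCoeff p lam V w) volume 0 1 :=
  ((h.intervalIntegrable_aux hp).2.2.mul_continuousOn
    (uIcc_zero_one ▸ continuousOn_const.mul (h.continuousOn_speedSq_rpow _))).add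
    (ContinuousOn.intervalIntegrable
      (uIcc_zero_one ▸ continuousOn_const.mul (h.continuousOn_speedSq_rpow _)))

/-- The weak Euler–Lagrange equation in the direction `e = (e₀, e₁)`. -/
theorem weak_equation (h : IsDerivPair p γ V w) (hp : 1 < p) {lam : ℝ}
    (hcrit : ∀ η : ℝ → Plane, IsTestFunction η → HasDerivAt
      (fun ε : ℝ => bendingEnergy p (γ + ε • η) + lam * curveLength (γ + ε • η)) 0 0)
    {e₀ e₁ : ℝ} (he₀ : |e₀| ≤ 1) (he₁ : |e₁| ≤ 1) {φ : ℝ → ℝ} (hφ : IsTestFunction φ) :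
    ∫ t in (0 : ℝ)..1, (deriv φ t * (normalCoeff p V w t * (e₀ * w 1 t - e₁ * w 0 t) +
        tangentCoeff p lam V w t * (V 0 t * e₀ + V 1 t * e₁)) +
      deriv (deriv φ) t * (normalCoeff p V w t * (V 0 t * e₁ - V 1 t * e₀))) = 0 := by
  obtain ⟨K, hK1, hK⟩ := h.exists_bound
  have hsub : ∀ t ∈ uIoc (0 : ℝ) 1, t ∈ Icc (0 : ℝ) 1 := fun t ht =>
    uIcc_zero_one ▸ uIoc_subset_uIcc ht
  obtain ⟨C1, hC1⟩ := isCompact_Icc.exists_bound_of_continuousOn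
    (hφ.deriv.continuous.continuousOn (s := Icc (0 : ℝ) 1))
  obtain ⟨C2, hC2⟩ := isCompact_Icc.exists_bound_of_continuousOn
    (hφ.deriv.deriv.continuous.continuousOn (s := Icc (0 : ℝ) 1))
  have hC1' : 0 ≤ C1 := (norm_nonneg _).trans (hC1 0 (by simp))
  have hC2' : 0 ≤ C2 := (norm_nonneg _).trans (hC2 0 (by simp))
  set q₁ : ℝ → ℝ := fun t => 2 * deriv φ t * (V 0 t * e₀ + V 1 t * e₁) with hq₁
  set q₂ : ℝ → ℝ := fun t => deriv φ t ^ 2 * (e₀ ^ 2 + e₁ ^ 2) with hq₂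
  have cq₁ : ContinuousOn q₁ (Icc 0 1) := (continuousOn_const.mul hφ.deriv.continuous.continuousOn).mul
    (((h.continuousOn 0).mul continuousOn_const).add ((h.continuousOn 1).mul continuousOn_const))
  have cq₂ : ContinuousOn q₂ (Icc 0 1) :=
    (hφ.deriv.continuous.continuousOn.pow 2).mul continuousOn_const
  obtain ⟨c₁, hc₁⟩ := isCompact_Icc.exists_bound_of_continuousOn cq₁
  obtain ⟨c₂, hc₂⟩ := isCompact_Icc.exists_bound_of_continuousOn cq₂
  set C := max c₁ c₂
  have bq₁ : ∀ t ∈ Icc (0 : ℝ) 1, |q₁ t| ≤ C := fun t ht => (hc₁ t ht).trans (le_max_left _ _)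
  have bq₂ : ∀ t ∈ Icc (0 : ℝ) 1, |q₂ t| ≤ C := fun t ht => (hc₂ t ht).trans (le_max_right _ _)
  have hC : 0 ≤ C := (abs_nonneg _).trans (bq₁ 0 (by simp))
  obtain ⟨tm, htm, hmin⟩ := isCompact_Icc.exists_isMinOn (nonempty_Icc.2 zero_le_one)
    h.continuousOn_speedSq
  obtain ⟨tM, htM, hmax⟩ := isCompact_Icc.exists_isMaxOn (nonempty_Icc.2 zero_le_one)
    h.continuousOn_speedSq
  set m := speedSq V tm
  have hm : 0 < m := h.pos tm htm
  -- For |ε| < δ the squared speed changes by at most 2 δ C ≤ m/2, so it stays at least m/2 and the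
  -- perturbed curves remain immersed.
  set δ := min 1 (m / (4 * (C + 1)))
  have hδ : 0 < δ := lt_min one_pos (by positivity)
  have hδ1 : δ ≤ 1 := min_le_left _ _
  have hδC : δ * (2 * C) ≤ m / 2 := by
    have h1 : δ ≤ m / (4 * (C + 1)) := min_le_right _ _
    rw [le_div_iff₀ (by positivity)] at h1
    nlinarith
  have hQ : ∀ t ∈ Icc (0 : ℝ) 1, ∀ ε : ℝ, |ε| < δ →
      speedSq V t + ε * q₁ t + ε ^ 2 * q₂ t ∈ Icc (m / 2) (speedSq V tM + m / 2) := by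
    intro t ht ε hε
    have h1 : |ε * q₁ t + ε ^ 2 * q₂ t| ≤ m / 2 := by
      have e1 : |ε * q₁ t| ≤ δ * C := by
        rw [abs_mul]; exact mul_le_mul hε.le (bq₁ t ht) (abs_nonneg _) hδ.le
      have e2 : |ε ^ 2 * q₂ t| ≤ δ * C := by
        rw [abs_mul, abs_pow]
        refine mul_le_mul ?_ (bq₂ t ht) (abs_nonneg _) hδ.le
        nlinarith [abs_nonneg ε]
      have := abs_add_le (ε * q₁ t) (ε ^ 2 * q₂ t)
      linarith
    have h2 := abs_le.1 h1
    have h3 : m ≤ speedSq V t := hmin ht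
    have h4 : speedSq V t ≤ speedSq V tM := hmax ht
    constructor <;> linarith
  have hφm : ∀ {ψ : ℝ → ℝ}, Continuous ψ →
      AEStronglyMeasurable ψ (volume.restrict (uIoc (0 : ℝ) 1)) := fun hψ =>
    hψ.aestronglyMeasurable
  have mIcc : ∀ {f : ℝ → ℝ}, ContinuousOn f (Icc 0 1) →
      AEStronglyMeasurable f (volume.restrict (uIoc (0 : ℝ) 1)) := fun hf => by
    rw [uIoc_of_le zero_le_one]
    exact (hf.mono Ioc_subset_Icc_self).aestronglyMeasurable measurableSet_Ioc
  set a₁ : ℝ → ℝ := fun t => deriv φ t * (e₀ * w 1 t - e₁ * w 0 t) +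
    deriv (deriv φ) t * (V 0 t * e₁ - V 1 t * e₀) with ha₁
  have ma₁ : AEStronglyMeasurable a₁ (volume.restrict (uIoc (0 : ℝ) 1)) :=
    ((hφm hφ.deriv.continuous).mul (((h.aestronglyMeasurable' 1).const_mul e₀).sub
      ((h.aestronglyMeasurable' 0).const_mul e₁))).add
    ((hφm hφ.deriv.deriv.continuous).mul (((h.aestronglyMeasurable 0).mul_const e₁).sub
      ((h.aestronglyMeasurable 1).mul_const e₀)))
  -- One constant dominating both the unperturbed determinant and its derivative a₁ in ε.
  set L := K + C1 + 2 * C2 * K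
  have hL : K ≤ L := by
    have : 0 ≤ 2 * C2 * K := by positivity
    simp only [L]; linarith
  have hLΩ : ∀ t ∈ Icc (0 : ℝ) 1, |a₁ t| ≤ L * (1 + |w 0 t| + |w 1 t|) := by
    intro t ht
    have hw0 := abs_nonneg (w 0 t)
    have hw1 := abs_nonneg (w 1 t)
    have k0 : |e₀ * w 1 t - e₁ * w 0 t| ≤ |w 0 t| + |w 1 t| := by
      have := abs_sub (e₀ * w 1 t) (e₁ * w 0 t)
      rw [abs_mul, abs_mul] at this
      nlinarith
    have k1 : |V 0 t * e₁ - V 1 t * e₀| ≤ 2 * K := by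
      have := abs_sub (V 0 t * e₁) (V 1 t * e₀)
      rw [abs_mul, abs_mul] at this
      have a := mul_le_mul (hK 0 t ht) he₁ (abs_nonneg _) (by linarith)
      have b := mul_le_mul (hK 1 t ht) he₀ (abs_nonneg _) (by linarith)
      linarith
    have k2 : |deriv φ t * (e₀ * w 1 t - e₁ * w 0 t)| ≤ C1 * (|w 0 t| + |w 1 t|) := by
      rw [abs_mul]; exact mul_le_mul (hC1 t ht) k0 (abs_nonneg _) hC1'
    have k3 : |deriv (deriv φ) t * (V 0 t * e₁ - V 1 t * e₀)| ≤ C2 * (2 * K) := by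
      rw [abs_mul]; exact mul_le_mul (hC2 t ht) k1 (abs_nonneg _) hC2'
    have k4 := abs_add_le (deriv φ t * (e₀ * w 1 t - e₁ * w 0 t))
      (deriv (deriv φ) t * (V 0 t * e₁ - V 1 t * e₀))
    have k5 : 0 ≤ (K + 2 * C2 * K) * (|w 0 t| + |w 1 t|) := by positivity
    simp only [ha₁, L]
    nlinarith
  have hΩint := h.intervalIntegrable_dominating hp (K := L) (by linarith)
  have hB := hasDerivAt_integral_abs_rpow_mul_rpow (a := (1 - 3 * p) / 2) hp (half_pos hm) hδ hδ1
    h.aestronglyMeasurable_detPair ma₁ (mIcc h.continuousOn_speedSq) (mIcc cq₁) (mIcc cq₂)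
    (fun t ht => abs_detPair_le ((hK 0 t (hsub t ht)).trans hL) ((hK 1 t (hsub t ht)).trans hL))
    (fun t ht => hLΩ t (hsub t ht)) hΩint (fun t ht => bq₁ t (hsub t ht))
    (fun t ht => bq₂ t (hsub t ht)) (fun t ht => hQ t (hsub t ht))
  -- The length is the case a₀ = 1, a₁ = 0 of the same integral, with exponent 1/2.
  have hLen := hasDerivAt_integral_abs_rpow_mul_rpow (a := 1 / 2) (a₀ := fun _ => 1)
    (a₁ := fun _ => 0) (Ω := fun _ => 1) hp (half_pos hm) hδ hδ1
    aestronglyMeasurable_const aestronglyMeasurable_const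
    (mIcc h.continuousOn_speedSq) (mIcc cq₁) (mIcc cq₂)
    (fun t _ => by simp) (fun t _ => by simp) (by simp) (fun t ht => bq₁ t (hsub t ht))
    (fun t ht => bq₂ t (hsub t ht)) (fun t ht => hQ t (hsub t ht))
  have hη : IsTestFunction (fun t => φ t • (!₂[e₀, e₁] : Plane)) :=
    ⟨hφ.1.smul contDiff_const, hφ.2.1.smul_right, (tsupport_smul_subset_left _ _).trans hφ.2.2⟩
  have hsum := hB.2.add (hLen.2.const_mul lam)
  have huniq := hsum.unique ((hcrit _ hη).congr_of_eventuallyEq ?_)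
  · have e := intervalIntegral.integral_add hB.1 (hLen.1.const_mul lam)
    rw [intervalIntegral.integral_const_mul, huniq] at e
    refine Eq.trans (intervalIntegral.integral_congr fun t _ => ?_) e
    simp only [normalCoeff, tangentCoeff, ha₁, hq₁, abs_one, one_rpow]
    ring
  · filter_upwards [Metric.ball_mem_nhds (0 : ℝ) hδ] with ε hε
    rw [mem_ball_zero_iff, norm_eq_abs] at hε
    obtain ⟨e1, e2⟩ := h.energies_eq hφ e₀ e₁ ε
      (Q := fun t => speedSq V t + ε * q₁ t + ε ^ 2 * q₂ t)
      (fun t ht => (half_pos hm).trans_le (hQ t (Ioo_subset_Icc_self ht) ε hε).1) (fun t => rfl)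
    rw [e1, e2]
    simp [detPair, ha₁]

end IsDerivPair

/-! ### Integration of the Euler–Lagrange equation -/

lemma LipschitzOnWith.comp_absolutelyContinuousOnInterval {f Φ : ℝ → ℝ} {K : NNReal} {a b : ℝ}
    {s : Set ℝ} (hΦ : LipschitzOnWith K Φ s) (hf : AbsolutelyContinuousOnInterval f a b)
    (hs : MapsTo f (uIcc a b) s) : AbsolutelyContinuousOnInterval (fun t => Φ (f t)) a b := by
  rw [absolutelyContinuousOnInterval_iff] at hf ⊢
  intro ε hε
  -- K + 1 instead of K, so that K = 0 causes no division by zero.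
  obtain ⟨δ, hδ, h⟩ := hf (ε / (K + 1)) (by positivity)
  refine ⟨δ, hδ, fun E hE hlt => ?_⟩
  calc ∑ i ∈ Finset.range E.1, dist (Φ (f (E.2 i).1)) (Φ (f (E.2 i).2))
      ≤ ∑ i ∈ Finset.range E.1, (K + 1) * dist (f (E.2 i).1) (f (E.2 i).2) := by
        refine Finset.sum_le_sum fun i hi => ?_
        have := hΦ.dist_le_mul _ (hs (hE.1 i hi).1) _ (hs (hE.1 i hi).2)
        nlinarith [dist_nonneg (x := f (E.2 i).1) (y := f (E.2 i).2)]
    _ = (K + 1) * ∑ i ∈ Finset.range E.1, dist (f (E.2 i).1) (f (E.2 i).2) := by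
        rw [Finset.mul_sum]
    _ < (K + 1) * (ε / (K + 1)) := by
        have := h E hE hlt
        gcongr
    _ = ε := by field_simp

/-- Two absolutely continuous functions with the same derivative differ by a constant. -/
lemma AbsolutelyContinuousOnInterval.eqOn_of_ae_hasDerivAt {f g f' : ℝ → ℝ}
    (hf : AbsolutelyContinuousOnInterval f 0 1) (hg : AbsolutelyContinuousOnInterval g 0 1)
    (hf' : ∀ᵐ t, t ∈ Icc (0 : ℝ) 1 → HasDerivAt f (f' t) t)
    (hg' : ∀ᵐ t, t ∈ Icc (0 : ℝ) 1 → HasDerivAt g (f' t) t) :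
    ∃ c : ℝ, ∀ t ∈ Icc (0 : ℝ) 1, f t = c + g t := by
  obtain ⟨c, hc⟩ := (hf.fun_sub hg).const_of_ae_hasDerivAt_zero (by
    filter_upwards [hf', hg'] with t h1 h2 ht
    rw [uIcc_zero_one] at ht
    simpa using (h1 ht).fun_sub (h2 ht))
  refine ⟨c, fun t ht => ?_⟩
  linarith [hc t (uIcc_zero_one ▸ ht)]

lemma ae_hasDerivAt_integral_of_continuousOn {f : ℝ → ℝ} (hf : ContinuousOn f (Icc 0 1)) :
    ∀ᵐ t, t ∈ Icc (0 : ℝ) 1 → HasDerivAt (fun x => ∫ r in (0 : ℝ)..x, f r) (f t) t :=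
  ae_mem_Icc_iff_Ioo (Filter.Eventually.of_forall fun _ ht =>
    (hasDerivWithinAt_integral_of_continuousOn hf (Ioo_subset_Icc_self ht)).hasDerivAt
      (Icc_mem_nhds ht.1 ht.2))

lemma absolutelyContinuous_integral_of_continuousOn {f : ℝ → ℝ} (hf : ContinuousOn f (Icc 0 1)) :
    AbsolutelyContinuousOnInterval (fun x => ∫ r in (0 : ℝ)..x, f r) 0 1 :=
  (uIcc_zero_one ▸ hf : ContinuousOn f (uIcc 0 1)).intervalIntegrable
    |>.absolutelyContinuousOnInterval_intervalIntegral (by simp)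

/-- An absolutely continuous function with continuous derivative is continuously
differentiable. -/
lemma AbsolutelyContinuousOnInterval.hasDerivWithinAt_of_ae {f f' : ℝ → ℝ}
    (hf : AbsolutelyContinuousOnInterval f 0 1)
    (hf' : ∀ᵐ t, t ∈ Icc (0 : ℝ) 1 → HasDerivAt f (f' t) t) (hc : ContinuousOn f' (Icc 0 1))
    {t : ℝ} (ht : t ∈ Icc (0 : ℝ) 1) : HasDerivWithinAt f (f' t) (Icc 0 1) t := by
  obtain ⟨c, h⟩ := hf.eqOn_of_ae_hasDerivAt (absolutelyContinuous_integral_of_continuousOn hc) hf'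
    (ae_hasDerivAt_integral_of_continuousOn hc)
  exact ((hasDerivWithinAt_integral_of_continuousOn hc ht).const_add c).congr h (h t ht)

/-- If `-A' + B'' = 0` weakly then `B` is absolutely continuous with derivative `A + d`. -/
lemma exists_absolutelyContinuous_of_weak {A B : ℝ → ℝ} (hA : IntervalIntegrable A volume 0 1)
    (hB : IntervalIntegrable B volume 0 1)
    (H : ∀ φ : ℝ → ℝ, IsTestFunction φ →
      ∫ t in (0 : ℝ)..1, (deriv φ t * A t + deriv (deriv φ) t * B t) = 0) :
    ∃ (G : ℝ → ℝ) (d : ℝ), AbsolutelyContinuousOnInterval G 0 1 ∧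
      (∀ᵐ t, t ∈ Icc (0 : ℝ) 1 → B t = G t) ∧
      ∀ᵐ t, t ∈ Icc (0 : ℝ) 1 → HasDerivAt G (A t + d) t := by
  have hP := hA.absolutelyContinuousOnInterval_intervalIntegral (c := 0) (by simp)
  have hPi : IntervalIntegrable (fun t => ∫ r in (0 : ℝ)..t, A r) volume 0 1 :=
    hP.continuousOn.intervalIntegrable
  -- Integrating φ' A by parts turns the hypothesis into ∫ φ'' (B - ∫ A) = 0, so B - ∫ A is affine.
  obtain ⟨c, d, hcd⟩ := ae_eq_affine_of_forall_integral_deriv_deriv_mul (hB.sub hPi) (by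
    intro φ hφ
    have c1 := hφ.deriv.continuous.continuousOn (s := uIcc (0 : ℝ) 1)
    have c2 := hφ.deriv.deriv.continuous.continuousOn (s := uIcc (0 : ℝ) 1)
    have h1 := H φ hφ
    rw [intervalIntegral.integral_add (hA.continuousOn_mul c1) (hB.continuousOn_mul c2)] at h1
    have h2 := hφ.deriv.integral_deriv_mul_integral hA
    simp only [mul_sub]
    rw [intervalIntegral.integral_sub (hB.continuousOn_mul c2) (hPi.continuousOn_mul c2), h2]
    linarith)
  refine ⟨fun t => (c + d * t) + ∫ r in (0 : ℝ)..t, A r, d, ?_, ?_, ?_⟩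
  · have : ContDiffOn ℝ 1 (fun t : ℝ => c + d * t) (uIcc 0 1) :=
      (contDiff_const.add (contDiff_const.mul contDiff_id)).contDiffOn
    exact this.absolutelyContinuousOnInterval.fun_add hP
  · refine ae_mem_Icc_iff_Ioo ?_
    filter_upwards [hcd] with t ht hm
    linarith [ht hm]
  · filter_upwards [hA.ae_hasDerivAt_integral] with t ht hm
    have := (((hasDerivAt_id t).const_mul d).const_add c).fun_add
      (ht (uIcc_zero_one ▸ hm) 0 (by simp))
    rw [mul_one, add_comm d] at this
    exact this

namespace IsDerivPair

variable {p : ℝ} {γ : ℝ → Plane} {V w : Fin 2 → ℝ → ℝ}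

/-- The curvature equation: `u` is the signed power `|k|^(p-2) k` of the curvature, and its
derivative is a fixed linear function of the velocity. -/
theorem exists_curvaturePower (h : IsDerivPair p γ V w) (hp : 1 < p) {lam : ℝ}
    (hcrit : ∀ η : ℝ → Plane, IsTestFunction η → HasDerivAt
      (fun ε : ℝ => bendingEnergy p (γ + ε • η) + lam * curveLength (γ + ε • η)) 0 0) :
    ∃ (u : ℝ → ℝ) (c₀ c₁ : ℝ),
      (∀ t ∈ Icc (0 : ℝ) 1, HasDerivWithinAt u (V 0 t * c₁ - V 1 t * c₀) (Icc 0 1) t) ∧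
      ∀ᵐ t, t ∈ Icc (0 : ℝ) 1 →
        detPair V w t = sgnPow (p / (p - 1)) (u t) * √(speedSq V t) ^ 3 := by
  have iw := h.intervalIntegrable_normalCoeff_mul hp
  have iκV : ∀ i, IntervalIntegrable (fun t => normalCoeff p V w t * V i t) volume 0 1 := fun i =>
    (h.intervalIntegrable_normalCoeff hp).mul_continuousOn (uIcc_zero_one ▸ h.continuousOn i)
  have iX : ∀ i, IntervalIntegrable (fun t => tangentCoeff p lam V w t * V i t) volume 0 1 :=
    fun i => (h.intervalIntegrable_tangentCoeff hp lam).mul_continuousOn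
      (uIcc_zero_one ▸ h.continuousOn i)
  -- With N the normal and T the tangential coefficient, the directions (1,0) and (0,1) give, almost
  -- everywhere, G₀ = -N V₁ with G₀' = N w₁ + T V₀ + d₀, and G₁ = N V₀ with G₁' = T V₁ - N w₀ + d₁.
  obtain ⟨G₀, d₀, hG₀, hB₀, hd₀⟩ := exists_absolutelyContinuous_of_weak
    ((iw 1).add (iX 0)) (iκV 1).neg (fun φ hφ => by
      refine Eq.trans (intervalIntegral.integral_congr fun t _ => ?_)
        (h.weak_equation hp hcrit (e₀ := 1) (e₁ := 0) (by simp) (by simp) hφ)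
      simp only [Pi.neg_apply]
      ring)
  obtain ⟨G₁, d₁, hG₁, hB₁, hd₁⟩ := exists_absolutelyContinuous_of_weak
    ((iX 1).sub (iw 0)) (iκV 0) (fun φ hφ => by
      refine Eq.trans (intervalIntegral.integral_congr fun t _ => ?_)
        (h.weak_equation hp hcrit (e₀ := 0) (e₁ := 1) (by simp) (by simp) hφ)
      ring)
  -- V₀ G₁ - V₁ G₀ equals N |V|² = p |k|^(p-2) k almost everywhere. In its derivative all terms with
  -- N, T and w cancel and only V₀ d₁ - V₁ d₀ remains; `lam` disappears together with T.
  have hac : AbsolutelyContinuousOnInterval (fun t => p⁻¹ * (V 0 t * G₁ t - V 1 t * G₀ t)) 0 1 :=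
    (((h.ac 0).fun_mul hG₁).fun_sub ((h.ac 1).fun_mul hG₀)).const_mul p⁻¹
  refine ⟨fun t => p⁻¹ * (V 0 t * G₁ t - V 1 t * G₀ t), d₀ / p, d₁ / p, fun t ht => ?_, ?_⟩
  · refine hac.hasDerivWithinAt_of_ae (f' := fun t => V 0 t * (d₁ / p) - V 1 t * (d₀ / p)) ?_
      (((h.continuousOn 0).mul continuousOn_const).sub ((h.continuousOn 1).mul continuousOn_const))
      ht
    filter_upwards [hB₀, hd₀, hB₁, hd₁, h.ae_hasDerivAt 0, h.ae_hasDerivAt 1]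
      with t b0 e0 b1 e1 v0 v1 hm
    have := (((v0 hm).fun_mul (e1 hm)).fun_sub ((v1 hm).fun_mul (e0 hm))).const_mul p⁻¹
    convert! this using 1
    rw [← b0 hm, ← b1 hm]
    simp only [Pi.neg_apply]
    ring
  · filter_upwards [hB₀, hB₁] with t b0 b1 hm
    have hQ : 0 < speedSq V t := h.pos t hm
    have hp0 : p ≠ 0 := by linarith
    have hp1 : p - 1 ≠ 0 := by linarith
    have e1 : p⁻¹ * (V 0 t * G₁ t - V 1 t * G₀ t) =
        sgnPow p (detPair V w t) * speedSq V t ^ ((3 - 3 * p) / 2) := by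
      rw [← b0 hm, ← b1 hm, show (3 - 3 * p) / 2 = (1 - 3 * p) / 2 + 1 by ring, rpow_add_one hQ.ne']
      simp only [Pi.neg_apply, normalCoeff, speedSq]
      field_simp
      ring
    rw [e1, sgnPow_mul, sgnPow_sgnPow hp, sgnPow_of_pos _ (rpow_pos_of_pos hQ _), sqrt_eq_rpow,
      ← rpow_natCast, ← rpow_mul hQ.le, ← rpow_mul hQ.le, mul_assoc, ← rpow_add hQ]
    rw [show (3 - 3 * p) / 2 * (p / (p - 1) - 1) + 1 / 2 * ((3 : ℕ) : ℝ) = 0 by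
      push_cast; field_simp; ring]
    simp

end IsDerivPair

/-! ### The tangential angle and the elastic system -/

lemma exists_polar (x y : ℝ) : ∃ θ ∈ Ioc (-π) π,
    x = √(x ^ 2 + y ^ 2) * cos θ ∧ y = √(x ^ 2 + y ^ 2) * sin θ := by
  have e : ‖(⟨x, y⟩ : ℂ)‖ = √(x ^ 2 + y ^ 2) := by
    rw [Complex.norm_def, Complex.normSq_mk]; congr 1; ring
  refine ⟨Complex.arg ⟨x, y⟩, Complex.arg_mem_Ioc _, ?_, ?_⟩
  · rw [← e, Complex.norm_mul_cos_arg]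
  · rw [← e, Complex.norm_mul_sin_arg]

/-- The tangential angle `θ`, the speed `σ` and the signed power `u = |k|^(p-2) k` of the curvature
of a `p`-elastica solve an autonomous system up to the factor `σ`. -/
structure IsElasticSystem (p A : ℝ) (σ θ u : ℝ → ℝ) : Prop where
  continuousOn : ContinuousOn σ (Icc 0 1)
  pos : ∀ t ∈ Icc (0 : ℝ) 1, 0 < σ t
  angle : ∀ t ∈ Icc (0 : ℝ) 1,
    HasDerivWithinAt θ (σ t * sgnPow (p / (p - 1)) (u t)) (Icc 0 1) t
  power : ∀ t ∈ Icc (0 : ℝ) 1, HasDerivWithinAt u (-(A * (σ t * sin (θ t)))) (Icc 0 1) t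

namespace IsDerivPair

variable {p : ℝ} {γ : ℝ → Plane} {V w : Fin 2 → ℝ → ℝ}

/-- The angle is the integral of σ k from a polar angle of V at 0. The unit tangent turns at the
same rate, so its components in the frame rotating with θ have zero derivative almost everywhere. As
V has a derivative only almost everywhere, constancy requires absolute continuity of every factor.
-/
lemma exists_tangent (h : IsDerivPair p γ V w) {k : ℝ → ℝ} (hk : ContinuousOn k (Icc 0 1))
    (hD : ∀ᵐ t, t ∈ Icc (0 : ℝ) 1 → detPair V w t = k t * √(speedSq V t) ^ 3) :
    ∃ θ : ℝ → ℝ, ∀ t ∈ Icc (0 : ℝ) 1,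
      HasDerivWithinAt θ (√(speedSq V t) * k t) (Icc 0 1) t ∧
      V 0 t = √(speedSq V t) * cos (θ t) ∧ V 1 t = √(speedSq V t) * sin (θ t) := by
  obtain ⟨θ₀, -, hx, hy⟩ := exists_polar (V 0 0) (V 1 0)
  have hσ0 : ∀ t ∈ Icc (0 : ℝ) 1, 0 < √(speedSq V t) := fun t ht => sqrt_pos.2 (h.pos t ht)
  have hσc : ContinuousOn (fun t => √(speedSq V t)) (Icc 0 1) := h.continuousOn_speedSq.sqrt
  have hσk : ContinuousOn (fun t => √(speedSq V t) * k t) (Icc 0 1) := hσc.mul hk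
  set θ : ℝ → ℝ := fun t => θ₀ + ∫ r in (0 : ℝ)..t, √(speedSq V r) * k r with hθ
  have hθac : AbsolutelyContinuousOnInterval θ 0 1 :=
    contDiffOn_const.absolutelyContinuousOnInterval.fun_add
      (absolutelyContinuous_integral_of_continuousOn hσk)
  have hθd : ∀ t ∈ Icc (0 : ℝ) 1, HasDerivWithinAt θ (√(speedSq V t) * k t) (Icc 0 1) t :=
    fun t ht => (hasDerivWithinAt_integral_of_continuousOn hσk ht).const_add _
  have hθ' : ∀ᵐ t, t ∈ Icc (0 : ℝ) 1 → HasDerivAt θ (√(speedSq V t) * k t) t := by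
    filter_upwards [ae_hasDerivAt_integral_of_continuousOn hσk] with t ht hm
    exact (ht hm).const_add _
  have lc : LipschitzOnWith 1 cos univ := by
    refine (LipschitzWith.of_dist_le_mul fun x y => ?_).lipschitzOnWith
    simpa [Real.dist_eq] using Real.abs_cos_sub_cos_le x y
  have ls : LipschitzOnWith 1 sin univ := by
    refine (LipschitzWith.of_dist_le_mul fun x y => ?_).lipschitzOnWith
    simpa [Real.dist_eq] using Real.abs_sin_sub_sin_le x y
  have hcac := lc.comp_absolutelyContinuousOnInterval hθac (mapsTo_univ _ _)
  have hsac := ls.comp_absolutelyContinuousOnInterval hθac (mapsTo_univ _ _)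
  obtain ⟨tm, htm, hmin⟩ := isCompact_Icc.exists_isMinOn (nonempty_Icc.2 zero_le_one)
    h.continuousOn_speedSq
  obtain ⟨tM, htM, hmax⟩ := isCompact_Icc.exists_isMaxOn (nonempty_Icc.2 zero_le_one)
    h.continuousOn_speedSq
  have hinv : ContDiffOn ℝ 1 (fun x : ℝ => (√x)⁻¹) (Icc (speedSq V tm) (speedSq V tM)) := by
    intro x hx
    have hx0 : 0 < x := (h.pos tm htm).trans_le hx.1
    exact (((Real.contDiffAt_sqrt hx0.ne').inv (sqrt_pos.2 hx0).ne')).contDiffWithinAt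
  obtain ⟨K, hK⟩ := hinv.exists_lipschitzOnWith (by decide) (convex_Icc _ _) isCompact_Icc
  have hQac : AbsolutelyContinuousOnInterval (speedSq V) 0 1 := by
    have := ((h.ac 0).fun_mul (h.ac 0)).fun_add ((h.ac 1).fun_mul (h.ac 1))
    convert! this using 1
    funext t
    simp only [speedSq]; ring
  have hiac := hK.comp_absolutelyContinuousOnInterval hQac (fun t ht => by
    rw [uIcc_zero_one] at ht
    exact ⟨hmin ht, hmax ht⟩)
  have hT0 := (h.ac 0).fun_mul hiac
  have hT1 := (h.ac 1).fun_mul hiac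
  have hTd : ∀ᵐ t, t ∈ Icc (0 : ℝ) 1 →
      HasDerivAt (fun t => V 0 t * (√(speedSq V t))⁻¹) (-(V 1 t * k t)) t ∧
      HasDerivAt (fun t => V 1 t * (√(speedSq V t))⁻¹) (V 0 t * k t) t := by
    filter_upwards [hD, h.ae_hasDerivAt 0, h.ae_hasDerivAt 1] with t hd v0 v1 hm
    have hq := h.pos t hm
    have hs := hσ0 t hm
    have hQ : HasDerivAt (speedSq V) (2 * V 0 t * w 0 t + 2 * V 1 t * w 1 t) t :=
      (((v0 hm).fun_pow 2).fun_add ((v1 hm).fun_pow 2)).congr_deriv (by simp)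
    have hi := (hQ.sqrt hq.ne').fun_inv hs.ne'
    have hd := hd hm
    simp only [detPair] at hd
    have hs2 : √(speedSq V t) ^ 2 = V 0 t ^ 2 + V 1 t ^ 2 := sq_sqrt hq.le
    set s := √(speedSq V t)
    constructor
    · refine ((v0 hm).fun_mul hi).congr_deriv ?_
      change w 0 t * s⁻¹ + V 0 t * _ = _
      -- First component of |V|² w - (V · w) V = det(V, w) J V, where J is the rotation by π/2.
      have : w 0 t * s ^ 2 - V 0 t * (V 0 t * w 0 t + V 1 t * w 1 t) = -V 1 t * (k t * s ^ 3) := by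
        rw [← hd, hs2]; ring
      field_simp
      linarith
    · refine ((v1 hm).fun_mul hi).congr_deriv ?_
      change w 1 t * s⁻¹ + V 1 t * _ = _
      have : w 1 t * s ^ 2 - V 1 t * (V 0 t * w 0 t + V 1 t * w 1 t) = V 0 t * (k t * s ^ 3) := by
        rw [← hd, hs2]; ring
      field_simp
      linarith
  -- The two functions are the components of the unit tangent along (cos θ, sin θ) and its normal;
  -- they keep their initial values 1 and 0.
  have key : ∀ᵐ t, t ∈ Icc (0 : ℝ) 1 →
      HasDerivAt (fun t => V 0 t * (√(speedSq V t))⁻¹ * cos (θ t) +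
        V 1 t * (√(speedSq V t))⁻¹ * sin (θ t)) 0 t ∧
      HasDerivAt (fun t => V 1 t * (√(speedSq V t))⁻¹ * cos (θ t) -
        V 0 t * (√(speedSq V t))⁻¹ * sin (θ t)) 0 t := by
    filter_upwards [hTd, hθ'] with t ht hθ hm
    have hs := hσ0 t hm
    obtain ⟨t0, t1⟩ := ht hm
    have hθ := hθ hm
    constructor
    · convert! (t0.fun_mul hθ.cos).fun_add (t1.fun_mul hθ.sin) using 1
      field_simp; ring
    · convert! (t1.fun_mul hθ.cos).fun_sub (t0.fun_mul hθ.sin) using 1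
      field_simp; ring
  obtain ⟨c, hc⟩ := ((hT0.fun_mul hcac).fun_add (hT1.fun_mul hsac)).const_of_ae_hasDerivAt_zero
    (by filter_upwards [key] with t ht hm using (ht (uIcc_zero_one ▸ hm)).1)
  obtain ⟨d, hd⟩ := ((hT1.fun_mul hcac).fun_sub (hT0.fun_mul hsac)).const_of_ae_hasDerivAt_zero
    (by filter_upwards [key] with t ht hm using (ht (uIcc_zero_one ▸ hm)).2)
  rw [uIcc_zero_one] at hc hd
  have h0 : (0 : ℝ) ∈ Icc (0 : ℝ) 1 := by simp
  have hs0 := hσ0 0 h0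
  have hθ0 : θ 0 = θ₀ := by simp [hθ]
  have hx' : V 0 0 = √(speedSq V 0) * cos θ₀ := hx
  have hy' : V 1 0 = √(speedSq V 0) * sin θ₀ := hy
  have hc1 : c = 1 := by
    rw [← hc 0 h0, hθ0, hx', hy']
    field_simp
    linarith [sin_sq_add_cos_sq θ₀]
  have hd1 : d = 0 := by
    rw [← hd 0 h0, hθ0, hx', hy']
    field_simp
    ring
  refine ⟨θ, fun t ht => ⟨hθd t ht, ?_, ?_⟩⟩
  · have a := hc t ht
    have b := hd t ht
    rw [hc1] at a; rw [hd1] at b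
    have hs := hσ0 t ht
    have e := sin_sq_add_cos_sq (θ t)
    field_simp at a b
    linear_combination cos (θ t) * a - sin (θ t) * b - V 0 t * e
  · have a := hc t ht
    have b := hd t ht
    rw [hc1] at a; rw [hd1] at b
    have hs := hσ0 t ht
    have e := sin_sq_add_cos_sq (θ t)
    field_simp at a b
    linear_combination sin (θ t) * a + cos (θ t) * b - V 1 t * e

end IsDerivPair

/-- First integration of the Euler–Lagrange equation of a `p`-elastica. -/
theorem IsPElastica.exists_system {p : ℝ} (hp : 1 < p) {γ : ℝ → Plane} (hγ : IsPElastica p γ) :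
    ∃ (σ θ u : ℝ → ℝ) (α A : ℝ), α ∈ Ioc (-π) π ∧ 0 ≤ A ∧
      (∀ t ∈ Icc (0 : ℝ) 1, HasDerivWithinAt γ
        !₂[σ t * cos (θ t + α), σ t * sin (θ t + α)] (Icc 0 1) t) ∧
      IsElasticSystem p A σ θ u := by
  obtain ⟨himm, lam, hcrit⟩ := hγ
  obtain ⟨V, w, h1, h2, h3, h4, h5⟩ := himm.exists_derivatives hp
  have h : IsDerivPair p γ V w := ⟨h1, h2, h3, h4, h5⟩
  obtain ⟨u, c₀, c₁, hu, hD⟩ := h.exists_curvaturePower hp hcrit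
  have hp1 : 0 < p - 1 := by linarith
  have hk : ContinuousOn (fun t => sgnPow (p / (p - 1)) (u t)) (Icc 0 1) :=
    (continuous_sgnPow ((one_lt_div hp1).2 (by linarith))).comp_continuousOn
      fun t ht => (hu t ht).continuousWithinAt
  obtain ⟨θ, hθ⟩ := h.exists_tangent hk hD
  obtain ⟨α, hα, hα0, hα1⟩ := exists_polar c₀ c₁
  refine ⟨fun t => √(speedSq V t), fun t => θ t - α, u, α, √(c₀ ^ 2 + c₁ ^ 2), hα, sqrt_nonneg _,
    fun t ht => ?_, h.continuousOn_speedSq.sqrt, fun t ht => sqrt_pos.2 (h.pos t ht),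
    fun t ht => (hθ t ht).1.sub_const α, fun t ht => ?_⟩
  · rw [sub_add_cancel, ← (hθ t ht).2.1, ← (hθ t ht).2.2]
    exact h4 t ht
  · convert hu t ht using 1
    set R := √(c₀ ^ 2 + c₁ ^ 2)
    rw [(hθ t ht).2.1, (hθ t ht).2.2, hα0, hα1, sin_sub]
    ring

/-! ### Symmetries and uniqueness of the elastic system -/

namespace IsElasticSystem

variable {p A : ℝ} {σ θ u : ℝ → ℝ}

lemma neg (h : IsElasticSystem p A σ θ u) :
    IsElasticSystem p A σ (fun t => -θ t) (fun t => -u t) where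
  continuousOn := h.continuousOn
  pos := h.pos
  angle t ht := (h.angle t ht).fun_neg.congr_deriv (by rw [sgnPow_neg]; ring)
  power t ht := (h.power t ht).fun_neg.congr_deriv (by rw [sin_neg]; ring)

lemma add_int_mul_two_pi (h : IsElasticSystem p A σ θ u) (n : ℤ) :
    IsElasticSystem p A σ (fun t => θ t + n * (2 * π)) u where
  continuousOn := h.continuousOn
  pos := h.pos
  angle t ht := (h.angle t ht).add_const _
  power t ht := (h.power t ht).congr_deriv (by rw [sin_add_int_mul_two_pi])

/-- Dilating by r divides the curvature by r, hence u by r^(p-1), and A by one further factor r. -/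
lemma scale (h : IsElasticSystem p A σ θ u) (hp : 1 < p) {r : ℝ} (hr : 0 < r) :
    IsElasticSystem p (A / r ^ p) (fun t => r * σ t) θ (fun t => u t / r ^ (p - 1)) where
  continuousOn := continuousOn_const.mul h.continuousOn
  pos t ht := mul_pos hr (h.pos t ht)
  angle t ht := (h.angle t ht).congr_deriv (by
    have hp1 : p - 1 ≠ 0 := by linarith
    have e : sgnPow (p / (p - 1)) (r ^ (p - 1))⁻¹ = r⁻¹ := by
      rw [sgnPow_of_pos _ (by positivity), ← rpow_neg hr.le, ← rpow_mul hr.le, ← rpow_neg_one]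
      congr 1; field_simp; ring
    rw [div_eq_mul_inv (u t), sgnPow_mul, e]
    field_simp)
  power t ht := ((h.power t ht).div_const (r ^ (p - 1))).congr_deriv (by
    rw [show p = (p - 1) + 1 by ring, rpow_add_one hr.ne']
    field_simp
    ring_nf)

/-- Solutions of the elastic system are determined by their initial values. -/
theorem angle_eq (h : IsElasticSystem p A σ θ u) (hp1 : 1 < p) (hp2 : p ≤ 2) {θs us : ℝ → ℝ}
    (hθs : ∀ s, HasDerivAt θs (sgnPow (p / (p - 1)) (us s)) s)
    (hus : ∀ s, HasDerivAt us (-(A * sin (θs s))) s) {s₀ : ℝ} (h0 : θs s₀ = θ 0)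
    (h1 : us s₀ = u 0) : ∀ t ∈ Icc (0 : ℝ) 1, θ t = θs ((∫ r in (0 : ℝ)..t, σ r) + s₀) := by
  have hℓ : ∀ t ∈ Icc (0 : ℝ) 1,
      HasDerivWithinAt (fun t => (∫ r in (0 : ℝ)..t, σ r) + s₀) (σ t) (Icc 0 1) t := fun t ht =>
    (hasDerivWithinAt_integral_of_continuousOn h.continuousOn ht).add_const _
  set ℓ : ℝ → ℝ := fun t => (∫ r in (0 : ℝ)..t, σ r) + s₀ with hℓdef
  have hθc : ∀ t ∈ Icc (0 : ℝ) 1, HasDerivWithinAt (fun t => θs (ℓ t))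
      (σ t * sgnPow (p / (p - 1)) (us (ℓ t))) (Icc 0 1) t := fun t ht =>
    ((hθs (ℓ t)).comp_hasDerivWithinAt t (hℓ t ht)).congr_deriv (mul_comm _ _)
  have huc : ∀ t ∈ Icc (0 : ℝ) 1, HasDerivWithinAt (fun t => us (ℓ t))
      (-(A * (σ t * sin (θs (ℓ t))))) (Icc 0 1) t := fun t ht =>
    ((hus (ℓ t)).comp_hasDerivWithinAt t (hℓ t ht)).congr_deriv (by ring)
  obtain ⟨M1, hM1⟩ := isCompact_Icc.exists_bound_of_continuousOn
    fun t ht => (h.power t ht).continuousWithinAt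
  obtain ⟨M2, hM2⟩ := isCompact_Icc.exists_bound_of_continuousOn
    fun t ht => (huc t ht).continuousWithinAt
  obtain ⟨B, hB⟩ := isCompact_Icc.exists_bound_of_continuousOn h.continuousOn
  -- The signed power is Lipschitz only on bounded sets, so uniqueness is applied on the strip |u| ≤
  -- M containing both solutions.
  set M := max M1 M2
  have hp' : 2 ≤ p / (p - 1) := by rw [le_div_iff₀ (by linarith)]; linarith
  obtain ⟨K, hK⟩ := exists_lipschitzOnWith_sgnPow hp' M
  have hB0 : 0 ≤ B := (norm_nonneg _).trans (hB 0 (by simp))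
  have hlip : ∀ t ∈ Ico (0 : ℝ) 1, LipschitzOnWith (Real.toNNReal (B * (K + |A|)))
      (fun x : ℝ × ℝ => (σ t * sgnPow (p / (p - 1)) x.2, -(A * (σ t * sin x.1))))
      (univ ×ˢ Icc (-M) M) := by
    intro t ht
    refine LipschitzOnWith.of_dist_le_mul fun x hx y hy => ?_
    have hσ : |σ t| ≤ B := hB t (Ico_subset_Icc_self ht)
    rw [Real.coe_toNNReal _ (by positivity), Prod.dist_eq, Prod.dist_eq]
    have d1 : |x.1 - y.1| ≤ max (dist x.1 y.1) (dist x.2 y.2) := le_max_left _ _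
    have d2 : |x.2 - y.2| ≤ max (dist x.1 y.1) (dist x.2 y.2) := le_max_right _ _
    set d := max (dist x.1 y.1) (dist x.2 y.2)
    have hd : 0 ≤ d := (abs_nonneg _).trans d1
    refine max_le ?_ ?_
    · rw [Real.dist_eq, ← mul_sub, abs_mul]
      have k := hK.dist_le_mul _ hx.2 _ hy.2
      rw [Real.dist_eq, Real.dist_eq] at k
      calc |σ t| * |sgnPow (p / (p - 1)) x.2 - sgnPow (p / (p - 1)) y.2|
          ≤ B * (K * |x.2 - y.2|) := mul_le_mul hσ k (abs_nonneg _) hB0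
        _ ≤ B * ((K + |A|) * d) := by
          have : (0 : ℝ) ≤ K := K.2
          have := abs_nonneg A
          gcongr
          linarith
        _ = B * (K + |A|) * d := by ring
    · rw [Real.dist_eq]
      have k := Real.abs_sin_sub_sin_le x.1 y.1
      calc |-(A * (σ t * sin x.1)) - -(A * (σ t * sin y.1))|
          = |σ t| * (|A| * |sin x.1 - sin y.1|) := by
            rw [← abs_mul, ← abs_mul, ← abs_neg]; congr 1; ring
        _ ≤ B * ((K + |A|) * d) := by
          have : (0 : ℝ) ≤ K := K.2
          have := abs_nonneg A
          have := k.trans d1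
          gcongr
          linarith
        _ = B * (K + |A|) * d := by ring
  have hIci : ∀ t ∈ Ico (0 : ℝ) 1, Icc (0 : ℝ) 1 ∈ 𝓝[Ici t] t := fun t ht =>
    Filter.mem_of_superset (Icc_mem_nhdsGE ht.2) (Icc_subset_Icc_left ht.1)
  have key := ODE_solution_unique_of_mem_Icc_right (a := 0) (b := 1)
    (f := fun t => (θ t, u t)) (g := fun t => (θs (ℓ t), us (ℓ t))) hlip
    (fun t ht => ((h.angle t ht).prodMk (h.power t ht)).continuousWithinAt)
    (fun t ht => ((h.angle t (Ico_subset_Icc_self ht)).prodMk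
      (h.power t (Ico_subset_Icc_self ht))).mono_of_mem_nhdsWithin (hIci t ht))
    (fun t ht => ⟨mem_univ _, abs_le.1 ((hM1 t (Ico_subset_Icc_self ht)).trans (le_max_left _ _))⟩)
    (fun t ht => ((hθc t ht).prodMk (huc t ht)).continuousWithinAt)
    (fun t ht => ((hθc t (Ico_subset_Icc_self ht)).prodMk
      (huc t (Ico_subset_Icc_self ht))).mono_of_mem_nhdsWithin (hIci t ht))
    (fun t ht => ⟨mem_univ _, abs_le.1 ((hM2 t (Ico_subset_Icc_self ht)).trans (le_max_right _ _))⟩)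
    (by simp [hℓdef, h0, h1])
  exact fun t ht => congrArg Prod.fst (key ht)

end IsElasticSystem

/-! ### Similarities and comparison with a profile -/

namespace Plane

/-- The similarity with ratio `r`, composed of the rotation by `-α`, the reflection
`(x, y) ↦ (x, e y)`, a dilation and the translation by `b`. -/
def similarity (r e α : ℝ) (b : Plane) (hr : 0 < r) (he : e ^ 2 = 1) : Plane ≃ᵈ Plane where
  toFun x := !₂[r * (cos α * x 0 + sin α * x 1), e * (r * (cos α * x 1 - sin α * x 0))] + b
  invFun y := !₂[(cos α * (y 0 - b 0) - sin α * (e * (y 1 - b 1))) / r,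
    (sin α * (y 0 - b 0) + cos α * (e * (y 1 - b 1))) / r]
  left_inv x := by
    have h := sin_sq_add_cos_sq α
    ext i
    fin_cases i
    · simp
      field_simp
      linear_combination x 0 * h + (cos α * sin α * x 1 * (-1) + sin α ^ 2 * x 0) * he
    · simp
      field_simp
      linear_combination x 1 * h + (cos α ^ 2 * x 1 - cos α * sin α * x 0) * he
  right_inv y := by
    have h := sin_sq_add_cos_sq α
    ext i
    fin_cases i
    · simp
      field_simp
      linear_combination (y 0 - b 0) * h
    · simp
      field_simp
      linear_combination (e ^ 2 * (y 1 - b 1)) * h + (y 1 - b 1) * he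
  edist_eq' := by
    refine ⟨r.toNNReal, (Real.toNNReal_pos.2 hr).ne', fun x y => ?_⟩
    have h := sin_sq_add_cos_sq α
    rw [edist_dist, edist_dist, ← ENNReal.ofReal, ← ENNReal.ofReal_mul hr.le]
    congr 1
    rw [dist_eq_norm, dist_eq_norm, Plane.norm_eq_sqrt, Plane.norm_eq_sqrt]
    have hrs : ∀ z, r * √z = √(r ^ 2 * z) := fun z => by
      rw [sqrt_mul (sq_nonneg r), sqrt_sq hr.le]
    rw [hrs]
    congr 1
    simp
    linear_combination r ^ 2 * ((x 0 - y 0) ^ 2 + (x 1 - y 1) ^ 2) * h +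
      (r * (cos α * (x 1 - y 1) - sin α * (x 0 - y 0))) ^ 2 * he

lemma similarity_apply (r e α : ℝ) (b : Plane) (hr : 0 < r) (he : e ^ 2 = 1) (x : Plane) :
    similarity r e α b hr he x =
      !₂[r * (cos α * x 0 + sin α * x 1), e * (r * (cos α * x 1 - sin α * x 0))] + b := rfl

end Plane

/-- Up to similarity and reparametrization by arclength, `γ` is a piece of `Γ`. -/
def IsRepresentedBy (γ Γ : ℝ → Plane) : Prop :=
  ∃ (S : Plane ≃ᵈ Plane) (s₀ : ℝ), ∀ t ∈ Icc (0 : ℝ) 1,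
    S (γ t) = Γ (arclength (fun r => S (γ r)) t + s₀)

/-- A curve whose elastic system agrees initially, after reflection and scaling, with that of a
profile curve is represented by this profile. -/
theorem IsElasticSystem.isRepresentedBy {p A α r e s₀ As : ℝ} {σ θ u : ℝ → ℝ} {γ Γ : ℝ → Plane}
    {θs ks us : ℝ → ℝ} (hp1 : 1 < p) (hp2 : p ≤ 2)
    (hγ : ∀ t ∈ Icc (0 : ℝ) 1, HasDerivWithinAt γ
        !₂[σ t * cos (θ t + α), σ t * sin (θ t + α)] (Icc 0 1) t)
    (h : IsElasticSystem p A σ θ u) (hΓ : HasAngleCurvature Γ θs ks)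
    (hks : ∀ s, ks s = sgnPow (p / (p - 1)) (us s))
    (hus : ∀ s, HasDerivAt us (-(As * sin (θs s))) s) (hr : 0 < r) (he : e = 1 ∨ e = -1)
    (hA : A = As * r ^ p) (hθ : θs s₀ = e * θ 0) (hu : us s₀ * r ^ (p - 1) = e * u 0) :
    IsRepresentedBy γ Γ := by
  have he2 : e ^ 2 = 1 := by rcases he with rfl | rfl <;> norm_num
  have hsys : IsElasticSystem p As (fun t => r * σ t) (fun t => e * θ t)
      (fun t => e * u t / r ^ (p - 1)) := by
    have h1 : IsElasticSystem p A σ (fun t => e * θ t) (fun t => e * u t) := by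
      rcases he with rfl | rfl
      · simpa using h
      · simpa using h.neg
    have h2 := h1.scale hp1 hr
    rwa [hA, mul_div_cancel_right₀ _ (rpow_pos_of_pos hr p).ne'] at h2
  have hang := hsys.angle_eq hp1 hp2 (fun s => hks s ▸ (hΓ s).2) hus (s₀ := s₀) hθ
    (by rw [eq_div_iff (by positivity), hu])
  have hS : ∀ b, ∀ t ∈ Icc (0 : ℝ) 1,
      HasDerivWithinAt (fun x => Plane.similarity r e α b hr he2 (γ x))
        ((r * σ t) • !₂[cos (e * θ t), sin (e * θ t)]) (Icc 0 1) t := by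
    intro b t ht
    have hd := Plane.hasDerivWithinAt_iff.1 (hγ t ht)
    have d0 := hd 0
    have d1 := hd 1
    simp only [Matrix.cons_val_zero, Matrix.cons_val_one] at d0 d1
    have hce : cos (e * θ t) = cos (θ t) := by rcases he with rfl | rfl <;> simp
    have hse : sin (e * θ t) = e * sin (θ t) := by rcases he with rfl | rfl <;> simp
    have hc : cos (θ t) = cos (θ t + α) * cos α + sin (θ t + α) * sin α := by
      rw [← cos_sub]; congr 1; ring
    have hs : sin (θ t) = sin (θ t + α) * cos α - cos (θ t + α) * sin α := by
      rw [← sin_sub]; congr 1; ring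
    simp only [Plane.similarity_apply]
    refine HasDerivWithinAt.add_const b ?_
    rw [Plane.hasDerivWithinAt_iff]
    intro i
    fin_cases i
    · refine (((d0.const_mul (cos α)).fun_add (d1.const_mul (sin α))).const_mul r).congr_deriv ?_
      simp [hce, hc]
      ring
    · refine ((((d1.const_mul (cos α)).fun_sub (d0.const_mul (sin α))).const_mul r).const_mul
        e).congr_deriv ?_
      simp [hse, hs]
      ring
  have harc : ∀ b, ∀ t ∈ Icc (0 : ℝ) 1,
      arclength (fun x => Plane.similarity r e α b hr he2 (γ x)) t =
        ∫ x in (0 : ℝ)..t, r * σ x := by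
    intro b t ht
    refine intervalIntegral.integral_congr_ae ?_
    have n1 : ∀ᵐ t : ℝ, t ≠ 1 := by simp [ae_iff, measure_singleton]
    filter_upwards [n1] with x hx1 hx
    rw [uIoc_of_le ht.1] at hx
    have hx2 : x < 1 := lt_of_le_of_ne (hx.2.trans ht.2) hx1
    have hxm : x ∈ Icc (0 : ℝ) 1 := ⟨hx.1.le, hx2.le⟩
    rw [((hS b x hxm).hasDerivAt (Icc_mem_nhds hx.1 hx2)).deriv, norm_smul, Plane.norm_eq_sqrt]
    simp [abs_of_pos hr, abs_of_pos (h.pos x hxm)]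
  set ℓ : ℝ → ℝ := fun t => (∫ x in (0 : ℝ)..t, r * σ x) + s₀ with hℓ
  have hG : ∀ t ∈ Icc (0 : ℝ) 1, HasDerivWithinAt (fun x => Γ (ℓ x))
      ((r * σ t) • !₂[cos (e * θ t), sin (e * θ t)]) (Icc 0 1) t := by
    intro t ht
    have := (hΓ (ℓ t)).1.scomp_hasDerivWithinAt t
      ((hasDerivWithinAt_integral_of_continuousOn hsys.continuousOn ht).add_const s₀)
    rw [← hang t ht] at this
    exact this
  -- Velocities and arclength do not depend on the translation, which is therefore free to make the
  -- two curves agree at t = 0.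
  set b : Plane := Γ (ℓ 0) - Plane.similarity r e α 0 hr he2 (γ 0) with hb
  refine ⟨Plane.similarity r e α b hr he2, s₀, fun t ht => ?_⟩
  rw [harc b t ht]
  have hdiff : ∀ t ∈ Icc (0 : ℝ) 1, HasDerivWithinAt
      (fun x => Plane.similarity r e α b hr he2 (γ x) - Γ (ℓ x)) 0 (Icc 0 1) t := fun t ht => by
    simpa using (hS b t ht).fun_sub (hG t ht)
  have hconst := constant_of_derivWithin_zero
    (fun t ht => (hdiff t ht).differentiableWithinAt)
    (fun t ht => (hdiff t (Ico_subset_Icc_self ht)).derivWithin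
      (uniqueDiffOn_Icc zero_lt_one t (Ico_subset_Icc_self ht))) t ht
  have h00 : Plane.similarity r e α b hr he2 (γ 0) - Γ (ℓ 0) = 0 := by
    rw [hb]
    simp only [Plane.similarity_apply]
    abel
  rw [h00] at hconst
  exact sub_eq_zero.1 hconst

/-! ### Inverse functions and amplitudes -/

/-- `a` is the continuous inverse `ℝ → D` of `F : D → ℝ`. -/
structure IsContinuousInverse (F a : ℝ → ℝ) (D : Set ℝ) : Prop where
  mem : ∀ s, a s ∈ D
  right_inv : ∀ s, F (a s) = s
  left_inv : ∀ x ∈ D, a (F x) = x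
  continuous : Continuous a

/-- The inverse is monotone and its range is the open set D, so it cannot jump. Continuity of F is
not needed. -/
lemma StrictMonoOn.isContinuousInverse_invFunOn {F : ℝ → ℝ} {D : Set ℝ} (hF : StrictMonoOn F D)
    (hD : IsOpen D) (hs : ∀ s, ∃ x ∈ D, F x = s) :
    IsContinuousInverse F (Function.invFunOn F D) D := by
  have hmem : ∀ s, Function.invFunOn F D s ∈ D := fun s => Function.invFunOn_mem (hs s)
  have hright : ∀ s, F (Function.invFunOn F D s) = s := fun s => Function.invFunOn_eq (hs s)
  have hleft : ∀ x ∈ D, Function.invFunOn F D (F x) = x := fun x hx =>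
    hF.injOn (hmem _) hx (hright _)
  have hmono : Monotone (Function.invFunOn F D) := fun s t hst => by
    by_contra hlt
    have := hF (hmem t) (hmem s) (not_le.1 hlt)
    rw [hright, hright] at this
    exact absurd hst (not_le.2 this)
  refine ⟨hmem, hright, hleft, continuous_iff_continuousAt.2 fun s => ?_⟩
  refine continuousAt_of_monotoneOn_of_image_mem_nhds (s := univ) (hmono.monotoneOn _)
    Filter.univ_mem (Filter.mem_of_superset (hD.mem_nhds (hmem s)) fun x hx => ?_)
  exact ⟨F x, mem_univ _, hleft x hx⟩

lemma IsContinuousInverse.hasDerivAt {F a : ℝ → ℝ} {D : Set ℝ} (h : IsContinuousInverse F a D)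
    {s f' : ℝ} (hF : HasDerivAt F f' (a s)) (hf' : f' ≠ 0) : HasDerivAt a f'⁻¹ s :=
  hF.of_local_left_inverse h.continuous.continuousAt hf' (Filter.Eventually.of_forall h.right_inv)

/-- The inverse is injective, so it maps punctured neighbourhoods to punctured neighbourhoods. This
carries cos ≠ 0 over to the amplitude near each s, except possibly at s. -/
lemma IsContinuousInverse.eventually_nhdsNE {F a : ℝ → ℝ} {D : Set ℝ}
    (h : IsContinuousInverse F a D) {P : ℝ → Prop} (hP : ∀ x, ∀ᶠ y in 𝓝[≠] x, P y) (s : ℝ) :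
    ∀ᶠ y in 𝓝[≠] s, P (a y) := by
  have ht : Filter.Tendsto a (𝓝[≠] s) (𝓝[≠] (a s)) :=
    h.continuous.continuousAt.tendsto.inf (Filter.tendsto_principal_principal.2 fun y hy hya => hy <| by
      rw [mem_singleton_iff] at hya ⊢
      rw [← h.right_inv y, hya, h.right_inv])
  exact ht.eventually (hP (a s))

/-- If `f` has derivative `g` near `x` except at `x`, and both are continuous at `x`, then `f` has
derivative `g x` at `x`. -/
lemma hasDerivAt_of_eventually_nhdsNE {f g : ℝ → ℝ} {x : ℝ}
    (h : ∀ᶠ y in 𝓝[≠] x, HasDerivAt f (g y) y) (hf : ContinuousAt f x) (hg : ContinuousAt g x) :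
    HasDerivAt f (g x) x := by
  have hR : ∀ᶠ y in 𝓝[>] x, HasDerivAt f (g y) y :=
    nhdsWithin_mono x (fun y (hy : x < y) => ne_of_gt hy) h
  have hL : ∀ᶠ y in 𝓝[<] x, HasDerivAt f (g y) y :=
    nhdsWithin_mono x (fun y (hy : y < x) => ne_of_lt hy) h
  have A : HasDerivWithinAt f (g x) (Ici x) x := by
    refine hasDerivWithinAt_Ici_of_tendsto_deriv (s := {y | HasDerivAt f (g y) y})
      (fun y hy => HasDerivAt.differentiableAt hy |>.differentiableWithinAt)
      hf.continuousWithinAt hR ?_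
    exact (hg.tendsto.mono_left nhdsWithin_le_nhds).congr' (hR.mono fun y hy => hy.deriv.symm)
  have B : HasDerivWithinAt f (g x) (Iic x) x := by
    refine hasDerivWithinAt_Iic_of_tendsto_deriv (s := {y | HasDerivAt f (g y) y})
      (fun y hy => HasDerivAt.differentiableAt hy |>.differentiableWithinAt)
      hf.continuousWithinAt hL ?_
    exact (hg.tendsto.mono_left nhdsWithin_le_nhds).congr' (hL.mono fun y hy => hy.deriv.symm)
  simpa using B.union A

lemma eventually_cos_ne_zero (x : ℝ) : ∀ᶠ y in 𝓝[≠] x, cos y ≠ 0 := by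
  rcases eq_or_ne (cos x) 0 with h | h
  · refine (hasDerivAt_cos x).eventually_ne fun h' => ?_
    have := sin_sq_add_cos_sq x
    rw [h, neg_eq_zero.1 h'] at this
    norm_num at this
  · exact nhdsWithin_le_nhds (continuous_cos.continuousAt.eventually_ne h)

lemma ae_cos_ne_zero : ∀ᵐ x : ℝ, cos x ≠ 0 := by
  have hsub : {x : ℝ | ¬cos x ≠ 0} ⊆ range fun k : ℤ => (2 * k + 1) * π / 2 := by
    intro x hx
    obtain ⟨k, hk⟩ := cos_eq_zero_iff.1 (not_not.1 hx)
    exact ⟨k, hk.symm⟩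
  exact ((countable_range _).mono hsub).measure_zero volume

lemma one_sub_sq_mul_sin_sq_pos {q : ℝ} (hq : q ∈ Ioo (0 : ℝ) 1) (x : ℝ) :
    0 < 1 - q ^ 2 * sin x ^ 2 := by
  have h1 : q ^ 2 < 1 := by nlinarith [hq.1, hq.2]
  nlinarith [sin_sq_le_one x, sq_nonneg q, sq_nonneg (sin x)]

/-- Near a zero of cos, Jordan's inequality sin t ≥ 2t/π reduces the claim to integrability of t^b
with b > -1; symmetry and periodicity do the rest. -/
lemma intervalIntegrable_abs_cos_rpow {b : ℝ} (hb : -1 < b) (hb0 : b ≤ 0) (x y : ℝ) :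
    IntervalIntegrable (fun t => |cos t| ^ b) volume x y := by
  have h1 : IntervalIntegrable (fun t => |sin t| ^ b) volume 0 (π / 2) := by
    have h2 := (intervalIntegral.intervalIntegrable_rpow' (a := 0) (b := π / 2) hb).const_mul
      ((2 / π) ^ b)
    refine h2.mono_fun' (Measurable.aestronglyMeasurable (by fun_prop)) ?_
    rw [Filter.EventuallyLE, ae_restrict_iff' measurableSet_uIoc, uIoc_of_le (by positivity)]
    refine Filter.Eventually.of_forall fun t ht => ?_
    have hs := mul_le_sin ht.1.le ht.2
    have hpos : 0 < 2 / π * t := mul_pos (by positivity) ht.1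
    rw [norm_of_nonneg (by positivity), abs_of_pos (hpos.trans_le hs),
      ← mul_rpow (by positivity) ht.1.le]
    exact rpow_le_rpow_of_nonpos hpos hs hb0
  have h2 : IntervalIntegrable (fun t => |cos t| ^ b) volume 0 (π / 2) := by
    have := h1.comp_sub_left (π / 2)
    simp only [sin_pi_div_two_sub, sub_zero, sub_self] at this
    exact this.symm
  have h3 : IntervalIntegrable (fun t => |cos t| ^ b) volume (π / 2) π := by
    have := h2.comp_sub_left π
    simp only [cos_pi_sub, abs_neg, sub_zero, sub_half] at this
    exact this.symm
  have hper : Function.Periodic (fun t => |cos t| ^ b) π := fun t => by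
    simp [cos_add_pi]
  exact hper.intervalIntegrable₀ pi_ne_zero (h2.trans h3) x y

/-- Primitives of functions `≥ 1` are increasing bijections of the line. -/
lemma primitive_bijective {f : ℝ → ℝ} (hi : ∀ a b, IntervalIntegrable f volume a b)
    (h1 : ∀ᵐ x, 1 ≤ f x) :
    StrictMono (fun x => ∫ t in (0 : ℝ)..x, f t) ∧
      Function.Surjective fun x => ∫ t in (0 : ℝ)..x, f t := by
  have hle : ∀ x y, x ≤ y → y - x ≤ (∫ t in (0 : ℝ)..y, f t) - ∫ t in (0 : ℝ)..x, f t := by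
    intro x y hxy
    rw [intervalIntegral.integral_interval_sub_left (hi _ _) (hi _ _)]
    have := intervalIntegral.integral_mono_ae (μ := volume) (f := fun _ => 1) hxy
      intervalIntegrable_const (hi x y) h1
    simpa using this
  refine ⟨fun x y hxy => by linarith [hle x y hxy.le], ?_⟩
  refine (intervalIntegral.continuous_primitive hi 0).surjective ?_ ?_
  · refine Filter.tendsto_atTop_mono' _ ?_ Filter.tendsto_id
    filter_upwards [Filter.eventually_ge_atTop 0] with x hx
    simpa using hle 0 x hx
  · refine Filter.tendsto_atBot_mono' _ ?_ Filter.tendsto_id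
    filter_upwards [Filter.eventually_le_atBot 0] with x hx
    simpa using hle x 0 hx

lemma hasDerivAt_primitive {f : ℝ → ℝ} (hi : ∀ a b, IntervalIntegrable f volume a b)
    (hm : Measurable f) {x : ℝ} (hc : ContinuousAt f x) :
    HasDerivAt (fun x => ∫ t in (0 : ℝ)..x, f t) (f x) x :=
  intervalIntegral.integral_hasDerivAt_right (hi _ _)
    ⟨univ, Filter.univ_mem, hm.aestronglyMeasurable⟩ hc

section amplitudes

variable {p q : ℝ}

lemma exponent_bounds (hp1 : 1 < p) (hp2 : p ≤ 2) :
    -1 < 1 - 2 / p ∧ 1 - 2 / p ≤ 0 ∧ 1 ≤ 2 / p ∧ 2 / p < 2 := by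
  have h1 : 1 ≤ 2 / p := by rw [le_div_iff₀ (by linarith)]; linarith
  have h2 : 2 / p < 2 := by rw [div_lt_iff₀ (by linarith)]; linarith
  exact ⟨by linarith, by linarith, h1, h2⟩

lemma continuous_sqrt_one_sub (q : ℝ) : Continuous fun x : ℝ => √(1 - q ^ 2 * sin x ^ 2) := by
  fun_prop

lemma isContinuousInverse_am1 (hp1 : 1 < p) (hp2 : p ≤ 2) (hq : q ∈ Ioo (0 : ℝ) 1) :
    IsContinuousInverse
      (fun x => ∫ θ in (0 : ℝ)..x, |cos θ| ^ (1 - 2 / p) / √(1 - q ^ 2 * sin θ ^ 2))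
      (fun s => am1 p s q) univ ∧
    ∀ x, cos x ≠ 0 → HasDerivAt
      (fun x => ∫ θ in (0 : ℝ)..x, |cos θ| ^ (1 - 2 / p) / √(1 - q ^ 2 * sin θ ^ 2))
      (|cos x| ^ (1 - 2 / p) / √(1 - q ^ 2 * sin x ^ 2)) x := by
  obtain ⟨b1, b2, -, -⟩ := exponent_bounds hp1 hp2
  have hpos := one_sub_sq_mul_sin_sq_pos hq
  have hi : ∀ a b, IntervalIntegrable
      (fun θ => |cos θ| ^ (1 - 2 / p) / √(1 - q ^ 2 * sin θ ^ 2)) volume a b := fun a b => by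
    have hc : Continuous fun x : ℝ => (√(1 - q ^ 2 * sin x ^ 2))⁻¹ :=
      (continuous_sqrt_one_sub q).inv₀ fun x => (sqrt_pos.2 (hpos x)).ne'
    exact ((intervalIntegrable_abs_cos_rpow b1 b2 a b).mul_continuousOn hc.continuousOn).congr
      fun t _ => (div_eq_mul_inv _ _).symm
  obtain ⟨hm, hs⟩ := primitive_bijective hi (by
    filter_upwards [ae_cos_ne_zero] with x hx
    rw [le_div_iff₀ (sqrt_pos.2 (hpos x)), one_mul]
    refine le_trans ?_ (one_le_rpow_of_pos_of_le_one_of_nonpos (abs_pos.2 hx) (abs_cos_le_one x) b2)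
    exact Real.sqrt_le_one.2 (by nlinarith [sq_nonneg (q * sin x)]))
  constructor
  · have := (hm.strictMonoOn univ).isContinuousInverse_invFunOn isOpen_univ
      fun s => (hs s).imp fun x hx => ⟨mem_univ _, hx⟩
    simpa only [am1, ellF1, ellDomain, hq.2.ne, false_and, if_false] using this
  · intro x hx
    refine hasDerivAt_primitive hi (by fun_prop) ?_
    exact (continuous_cos.abs.continuousAt.rpow_const (Or.inl (abs_ne_zero.2 hx))).div
      (continuous_sqrt_one_sub q).continuousAt (sqrt_pos.2 (hpos x)).ne'

/-- The inverse function rule applies where cos does not vanish. At a zero of cos the integrand may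
blow up, but the reciprocal is continuous because 2/p - 1 ≥ 0, so the formula extends. -/
lemma hasDerivAt_am1 (hp1 : 1 < p) (hp2 : p ≤ 2) (hq : q ∈ Ioo (0 : ℝ) 1) (s : ℝ) :
    HasDerivAt (fun s => am1 p s q)
      (|cos (am1 p s q)| ^ (2 / p - 1) * √(1 - q ^ 2 * sin (am1 p s q) ^ 2)) s := by
  obtain ⟨b1, b2, b3, -⟩ := exponent_bounds hp1 hp2
  obtain ⟨hinv, hF⟩ := isContinuousInverse_am1 hp1 hp2 hq
  have hc := hinv.continuous
  refine hasDerivAt_of_eventually_nhdsNE (f := fun s => am1 p s q) (g := fun s =>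
    |cos (am1 p s q)| ^ (2 / p - 1) * √(1 - q ^ 2 * sin (am1 p s q) ^ 2)) ?_ hc.continuousAt ?_
  · filter_upwards [hinv.eventually_nhdsNE eventually_cos_ne_zero s] with y hy
    have hsq := sqrt_pos.2 (one_sub_sq_mul_sin_sq_pos hq (am1 p y q))
    have h0 := rpow_pos_of_pos (abs_pos.2 hy) (1 - 2 / p)
    refine (hinv.hasDerivAt (hF _ hy) (div_pos h0 hsq).ne').congr_deriv ?_
    rw [inv_div, div_eq_mul_inv, ← rpow_neg (abs_nonneg _), neg_sub, mul_comm]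
  · refine ContinuousAt.mul ?_ ((continuous_sqrt_one_sub q).comp hc).continuousAt
    exact ((continuous_cos.comp hc).abs.continuousAt).rpow_const (Or.inr (by linarith))

lemma isContinuousInverse_am2 (hp1 : 1 < p) (hq : q ∈ Ioo (0 : ℝ) 1) :
    IsContinuousInverse (fun x => ∫ θ in (0 : ℝ)..x, 1 / (1 - q ^ 2 * sin θ ^ 2) ^ (1 / p))
      (fun s => am2 p s q) univ ∧
    ∀ x, HasDerivAt (fun x => ∫ θ in (0 : ℝ)..x, 1 / (1 - q ^ 2 * sin θ ^ 2) ^ (1 / p))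
      (1 / (1 - q ^ 2 * sin x ^ 2) ^ (1 / p)) x := by
  have hpos := one_sub_sq_mul_sin_sq_pos hq
  have hc : Continuous fun θ : ℝ => 1 / (1 - q ^ 2 * sin θ ^ 2) ^ (1 / p) := by
    refine continuous_const.div ?_ fun x => (rpow_pos_of_pos (hpos x) _).ne'
    exact Continuous.rpow_const (by fun_prop) fun x => Or.inl (hpos x).ne'
  obtain ⟨hm, hs⟩ := primitive_bijective (fun a b => hc.intervalIntegrable a b)
    (Filter.Eventually.of_forall fun x => by
      rw [le_div_iff₀ (rpow_pos_of_pos (hpos x) _), one_mul]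
      refine rpow_le_one (hpos x).le ?_ (by positivity)
      nlinarith [sq_nonneg (q * sin x)])
  constructor
  · have := (hm.strictMonoOn univ).isContinuousInverse_invFunOn isOpen_univ
      fun s => (hs s).imp fun x hx => ⟨mem_univ _, hx⟩
    simpa only [am2, ellF2, ellDomain, hq.2.ne, false_and, if_false] using this
  · exact fun x => hasDerivAt_primitive (fun a b => hc.intervalIntegrable a b) hc.measurable
      hc.continuousAt

lemma hasDerivAt_am2 (hp1 : 1 < p) (hq : q ∈ Ioo (0 : ℝ) 1) (s : ℝ) :
    HasDerivAt (fun s => am2 p s q) (dnP p s q) s := by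
  obtain ⟨hinv, hF⟩ := isContinuousInverse_am2 hp1 hq
  have h0 := rpow_pos_of_pos (one_sub_sq_mul_sin_sq_pos hq (am2 p s q)) (1 / p)
  refine (hinv.hasDerivAt (hF _) (by positivity)).congr_deriv ?_
  rw [one_div, inv_inv, dnP]

lemma am1_one_eq_am2_one (p s : ℝ) : am1 p s 1 = am2 p s 1 := by
  simp only [am1, am2, ellF1, ellF2, if_true]

lemma continuousOn_inv_abs_cos_rpow (p : ℝ) :
    ContinuousOn (fun θ : ℝ => 1 / |cos θ| ^ (2 / p)) (Ioo (-(π / 2)) (π / 2)) := by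
  intro x hx
  have h := abs_pos.2 (cos_pos_of_mem_Ioo hx).ne'
  exact (continuousAt_const.div (continuous_cos.abs.continuousAt.rpow_const (Or.inl h.ne'))
    (rpow_pos_of_pos h _).ne').continuousWithinAt

lemma intervalIntegrable_inv_abs_cos_rpow (p : ℝ) {x y : ℝ} (hx : x ∈ Ioo (-(π / 2)) (π / 2))
    (hy : y ∈ Ioo (-(π / 2)) (π / 2)) :
    IntervalIntegrable (fun θ : ℝ => 1 / |cos θ| ^ (2 / p)) volume x y :=
  ((continuousOn_inv_abs_cos_rpow p).mono (ordConnected_Ioo.uIcc_subset hx hy)).intervalIntegrable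

lemma hasDerivAt_ellF1_one (p : ℝ) {x : ℝ} (hx : x ∈ Ioo (-(π / 2)) (π / 2)) :
    HasDerivAt (fun x => ∫ θ in (0 : ℝ)..x, 1 / |cos θ| ^ (2 / p)) (1 / |cos x| ^ (2 / p)) x := by
  have h0 : (0 : ℝ) ∈ Ioo (-(π / 2)) (π / 2) := ⟨by linarith [pi_pos], by linarith [pi_pos]⟩
  refine intervalIntegral.integral_hasDerivAt_right (intervalIntegrable_inv_abs_cos_rpow p h0 hx)
    ⟨univ, Filter.univ_mem, Measurable.aestronglyMeasurable (by fun_prop)⟩ ?_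
  exact (continuousOn_inv_abs_cos_rpow p).continuousAt (isOpen_Ioo.mem_nhds hx)

lemma inv_abs_cos_rpow_pos (p : ℝ) {x : ℝ} (hx : x ∈ Ioo (-(π / 2)) (π / 2)) :
    0 < 1 / |cos x| ^ (2 / p) := by
  have h := abs_pos.2 (cos_pos_of_mem_Ioo hx).ne'
  positivity

/-- Surjectivity is where p ≤ 2 enters: then cos^(2/p) ≤ cos, so the integrand is at least tan and
the integral at least -log cos on [0, π/2), which is unbounded. Negative values follow by oddness.
-/
lemma isContinuousInverse_am1_one (hp1 : 1 < p) (hp2 : p ≤ 2) :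
    IsContinuousInverse (fun x => ∫ θ in (0 : ℝ)..x, 1 / |cos θ| ^ (2 / p))
      (fun s => am1 p s 1) (Ioo (-(π / 2)) (π / 2)) := by
  have h0 : (0 : ℝ) ∈ Ioo (-(π / 2)) (π / 2) := ⟨by linarith [pi_pos], by linarith [pi_pos]⟩
  have hder : ∀ x ∈ Ioo (-(π / 2)) (π / 2), HasDerivAt
      (fun x => ∫ θ in (0 : ℝ)..x, 1 / |cos θ| ^ (2 / p)) (1 / |cos x| ^ (2 / p)) x :=
    fun x hx => hasDerivAt_ellF1_one p hx
  have hcont : ContinuousOn (fun x => ∫ θ in (0 : ℝ)..x, 1 / |cos θ| ^ (2 / p))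
      (Ioo (-(π / 2)) (π / 2)) := fun x hx => (hder x hx).continuousAt.continuousWithinAt
  have hmono : StrictMonoOn (fun x => ∫ θ in (0 : ℝ)..x, 1 / |cos θ| ^ (2 / p))
      (Ioo (-(π / 2)) (π / 2)) := by
    refine strictMonoOn_of_deriv_pos (convex_Ioo _ _) hcont fun x hx => ?_
    rw [interior_Ioo] at hx
    rw [(hder x hx).deriv]
    exact inv_abs_cos_rpow_pos p hx
  have hpos : ∀ s, 0 ≤ s → ∃ x ∈ Ioo (-(π / 2)) (π / 2),
      ∫ θ in (0 : ℝ)..x, 1 / |cos θ| ^ (2 / p) = s := by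
    intro s hs
    have hexp : exp (-s) ≤ 1 := exp_le_one_iff.2 (by linarith)
    -- Chosen so that -log (cos y) = s.
    set y := arccos (exp (-s))
    have hy0 : 0 ≤ y := arccos_nonneg _
    have hy : y ∈ Ioo (-(π / 2)) (π / 2) :=
      ⟨by linarith [pi_pos], arccos_lt_pi_div_two.2 (exp_pos _)⟩
    have hcy : cos y = exp (-s) := cos_arccos (by linarith [exp_pos (-s)]) hexp
    have hsub : ∀ x ∈ Icc 0 y, x ∈ Ioo (-(π / 2)) (π / 2) := fun x hx =>
      ⟨by linarith [pi_pos, hx.1], hx.2.trans_lt hy.2⟩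
    have hge : s ≤ ∫ θ in (0 : ℝ)..y, 1 / |cos θ| ^ (2 / p) := by
      have hd : ∀ x ∈ Icc 0 y, HasDerivAt
          (fun x => (∫ θ in (0 : ℝ)..x, 1 / |cos θ| ^ (2 / p)) + log (cos x))
          (1 / |cos x| ^ (2 / p) + -sin x / cos x) x := fun x hx =>
        (hder x (hsub x hx)).fun_add
          ((hasDerivAt_cos x).log (cos_pos_of_mem_Ioo (hsub x hx)).ne')
      have hm : MonotoneOn (fun x => (∫ θ in (0 : ℝ)..x, 1 / |cos θ| ^ (2 / p)) + log (cos x))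
          (Icc 0 y) := by
        refine monotoneOn_of_deriv_nonneg (convex_Icc _ _)
          (fun x hx => (hd x hx).continuousAt.continuousWithinAt)
          (fun x hx => (hd x (interior_subset hx)).differentiableAt.differentiableWithinAt)
          fun x hx => ?_
        have hx := interior_subset hx
        rw [(hd x hx).deriv]
        have hc := cos_pos_of_mem_Ioo (hsub x hx)
        have h1 : cos x ^ (2 / p) ≤ cos x := by
          have := rpow_le_rpow_of_exponent_ge hc (cos_le_one x) (exponent_bounds hp1 hp2).2.2.1
          rwa [rpow_one] at this
        have h2 : 1 / cos x ≤ 1 / cos x ^ (2 / p) :=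
          one_div_le_one_div_of_le (rpow_pos_of_pos hc _) h1
        have h3 : sin x / cos x ≤ 1 / cos x := by
          gcongr; exact sin_le_one x
        rw [abs_of_pos hc, neg_div]
        linarith
      have := hm ⟨le_rfl, hy0⟩ ⟨hy0, le_rfl⟩ hy0
      simp only [intervalIntegral.integral_same, cos_zero, log_one, hcy, log_exp] at this
      linarith
    obtain ⟨x, hx, hxs⟩ := intermediate_value_Icc hy0
      (hcont.mono hsub) (show s ∈ Icc _ _ from ⟨by simpa using hs, hge⟩)
    exact ⟨x, hsub x hx, hxs⟩
  have hodd : ∀ x : ℝ, ∫ θ in (0 : ℝ)..-x, 1 / |cos θ| ^ (2 / p)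
      = -∫ θ in (0 : ℝ)..x, 1 / |cos θ| ^ (2 / p) := fun x => by
    have := intervalIntegral.integral_comp_neg (a := 0) (b := x)
      (fun θ : ℝ => 1 / |cos θ| ^ (2 / p))
    simp only [cos_neg, neg_zero] at this
    rw [this, intervalIntegral.integral_symm]
  have := hmono.isContinuousInverse_invFunOn isOpen_Ioo (fun s => by
    rcases le_total 0 s with hs | hs
    · exact hpos s hs
    · obtain ⟨x, hx, hxs⟩ := hpos (-s) (by linarith)
      exact ⟨-x, ⟨by linarith [hx.2], by linarith [hx.1]⟩, by rw [hodd, hxs, neg_neg]⟩)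
  simpa only [am1, ellF1, ellDomain, hp2, and_self, if_true] using this

lemma cos_am1_one_pos (hp1 : 1 < p) (hp2 : p ≤ 2) (s : ℝ) : 0 < cos (am1 p s 1) :=
  cos_pos_of_mem_Ioo ((isContinuousInverse_am1_one hp1 hp2).mem s)

lemma sechP_eq (hp1 : 1 < p) (hp2 : p ≤ 2) (s : ℝ) :
    sechP p s = cos (am1 p s 1) ^ (2 / p) := by
  have hc := cos_am1_one_pos hp1 hp2 s
  rw [sechP, ellKOne, if_pos hp2, if_pos (EReal.coe_lt_top _), cnP, abs_of_pos hc,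
    ← rpow_add_one hc.ne']
  congr 1; ring

lemma hasDerivAt_am1_one (hp1 : 1 < p) (hp2 : p ≤ 2) (s : ℝ) :
    HasDerivAt (fun s => am1 p s 1) (sechP p s) s := by
  have hinv := isContinuousInverse_am1_one hp1 hp2
  have hmem := hinv.mem s
  refine (hinv.hasDerivAt (hasDerivAt_ellF1_one p hmem)
    (inv_abs_cos_rpow_pos p hmem).ne').congr_deriv ?_
  rw [one_div, inv_inv, sechP_eq hp1 hp2, abs_of_pos (cos_am1_one_pos hp1 hp2 s)]

end amplitudes

/-! ### Angles and curvatures of the five profiles -/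

theorem hasAngleCurvature_linear :
    HasAngleCurvature gammaLinear (fun _ => 0) (fun _ => 0) := fun s => by
  refine ⟨?_, hasDerivAt_const _ _⟩
  rw [cos_zero, sin_zero]
  exact Plane.hasDerivAt_mk (hasDerivAt_id s) (hasDerivAt_const s 0)

theorem hasAngleCurvature_circular :
    HasAngleCurvature gammaCircular (fun s => s + π / 2) (fun _ => 1) := fun s => by
  refine ⟨?_, (hasDerivAt_id s).add_const _⟩
  rw [cos_add_pi_div_two, sin_add_pi_div_two]
  exact Plane.hasDerivAt_mk (hasDerivAt_cos s) (hasDerivAt_sin s)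

theorem hasAngleCurvature_wavelike {p : ℝ} (hp1 : 1 < p) (hp2 : p ≤ 2) {q : ℝ}
    (hq : q ∈ Ioo (0 : ℝ) 1) :
    HasAngleCurvature (gammaWavelike p q) (fun s => 2 * arcsin (q * snP p s q))
      (fun s => 2 * q * cnP p s q) := by
  obtain ⟨b1, b2, b3, b4⟩ := exponent_bounds hp1 hp2
  obtain ⟨hinv, -⟩ := isContinuousInverse_am1 hp1 hp2 hq
  have hc := hinv.continuous
  have ham := hasDerivAt_am1 hp1 hp2 hq
  have hQ := fun s => one_sub_sq_mul_sin_sq_pos hq (am1 p s q)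
  have hp1' : p - 1 ≠ 0 := by linarith
  have hp0 : p ≠ 0 := by linarith
  have hab : ∀ s, (q * snP p s q) ^ 2 < 1 := fun s => by
    have := hQ s
    rw [snP]; nlinarith
  have hlt : ∀ s, -1 < q * snP p s q ∧ q * snP p s q < 1 := fun s => by
    exact abs_lt.1 ((sq_lt_one_iff_abs_lt_one _).1 (hab s))
  have hsq : ∀ s, √(1 - (q * snP p s q) ^ 2) = √(1 - q ^ 2 * sin (am1 p s q) ^ 2) := fun s => by
    rw [snP, mul_pow]
  have hsin : ∀ s, sin (2 * arcsin (q * snP p s q)) =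
      2 * q * sin (am1 p s q) * √(1 - q ^ 2 * sin (am1 p s q) ^ 2) := fun s => by
    rw [sin_two_mul, sin_arcsin (hlt s).1.le (hlt s).2.le, cos_arcsin, hsq, snP]; ring
  have hcos : ∀ s, cos (2 * arcsin (q * snP p s q)) =
      2 * (1 - q ^ 2 * sin (am1 p s q) ^ 2) - 1 := fun s => by
    rw [cos_two_mul, cos_arcsin, hsq, sq_sqrt (hQ s).le]
  intro s
  refine ⟨?_, ?_⟩
  · refine Plane.hasDerivAt_mk ?_ ?_
    · have hi : ∀ a b, IntervalIntegrable
          (fun θ => √(1 - q ^ 2 * sin θ ^ 2) * |cos θ| ^ (1 - 2 / p)) volume a b := fun a b =>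
        (intervalIntegrable_abs_cos_rpow b1 b2 a b).continuousOn_mul
          (continuous_sqrt_one_sub q).continuousOn
      have hE : Continuous fun x => ellE1 p x q := intervalIntegral.continuous_primitive hi 0
      have hcosc : Continuous fun s => 2 * (1 - q ^ 2 * sin (am1 p s q) ^ 2) - 1 := by
        have := continuous_sin.comp hc
        simp only [Function.comp_def] at this
        fun_prop
      simp only [hcos]
      -- The integral and amplitude derivatives carry mutually inverse powers of |cos|, which cancel
      -- only where cos ≠ 0; continuity covers the remaining points.
      refine hasDerivAt_of_eventually_nhdsNE
        (g := fun s => 2 * (1 - q ^ 2 * sin (am1 p s q) ^ 2) - 1) ?_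
        (((hE.comp hc).const_mul 2).sub continuous_id).continuousAt hcosc.continuousAt
      filter_upwards [hinv.eventually_nhdsNE eventually_cos_ne_zero s] with y hy
      have hd : HasDerivAt (fun x => ellE1 p x q)
          (√(1 - q ^ 2 * sin (am1 p y q) ^ 2) * |cos (am1 p y q)| ^ (1 - 2 / p)) (am1 p y q) :=
        hasDerivAt_primitive hi (by fun_prop) ((continuous_sqrt_one_sub q).continuousAt.mul
          (continuous_cos.abs.continuousAt.rpow_const (Or.inl (abs_ne_zero.2 hy))))
      refine (((hd.comp y (ham y)).const_mul 2).sub (hasDerivAt_id y)).congr_deriv ?_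
      have e1 : |cos (am1 p y q)| ^ (1 - 2 / p) * |cos (am1 p y q)| ^ (2 / p - 1) = 1 := by
        rw [← rpow_add (abs_pos.2 hy)]; simp
      have e2 := mul_self_sqrt (hQ y).le
      linear_combination 2 * √(1 - q ^ 2 * sin (am1 p y q) ^ 2) ^ 2 * e1 + 2 * e2
    -- cn is the signed power of cos of exponent 2/p. Composing with exponent p - 1 gives 2 - 2/p,
    -- which is `sgnPow (3 - 2 / p)`.
    · have hY : ∀ s, -(q * (p / (p - 1)) * (|cnP p s q| ^ (p - 2) * cnP p s q)) =
          -(q * (p / (p - 1)) * sgnPow (3 - 2 / p) (cos (am1 p s q))) := fun s => by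
        have e1 : cnP p s q = sgnPow (2 / p + 1) (cos (am1 p s q)) := by
          rw [cnP, sgnPow]; congr 2; ring
        change -(q * (p / (p - 1)) * sgnPow p (cnP p s q)) = _
        rw [e1, sgnPow_comp]
        congr 3
        field_simp; ring
      simp only [hY, hsin]
      refine hasDerivAt_of_eventually_nhdsNE (g := fun s =>
        2 * q * sin (am1 p s q) * √(1 - q ^ 2 * sin (am1 p s q) ^ 2)) ?_ ?_ ?_
      · filter_upwards [hinv.eventually_nhdsNE eventually_cos_ne_zero s] with y hy
        have hd := (hasDerivAt_sgnPow_of_ne (3 - 2 / p) hy).comp y (ham y).cos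
        refine ((hd.const_mul (q * (p / (p - 1)))).neg).congr_deriv ?_
        have e1 : |cos (am1 p y q)| ^ (3 - 2 / p - 2) * |cos (am1 p y q)| ^ (2 / p - 1) = 1 := by
          rw [← rpow_add (abs_pos.2 hy)]; ring_nf; simp
        have e2 : p / (p - 1) * (3 - 2 / p - 1) = 2 := by field_simp; ring
        linear_combination q * (p / (p - 1) * (3 - 2 / p - 1)) * sin (am1 p y q) *
          √(1 - q ^ 2 * sin (am1 p y q) ^ 2) * e1 +
          q * sin (am1 p y q) * √(1 - q ^ 2 * sin (am1 p y q) ^ 2) * e2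
      · exact ((((continuous_sgnPow (by linarith)).comp (continuous_cos.comp hc)).const_mul
          (q * (p / (p - 1)))).neg).continuousAt
      · exact (((continuous_sin.comp hc).const_mul (2 * q)).mul
          ((continuous_sqrt_one_sub q).comp hc)).continuousAt
  · have h1 : HasDerivAt (fun s => q * snP p s q) (q * (cos (am1 p s q) *
        (|cos (am1 p s q)| ^ (2 / p - 1) * √(1 - q ^ 2 * sin (am1 p s q) ^ 2)))) s :=
      ((ham s).sin).const_mul q
    refine (((hasDerivAt_arcsin (hlt s).1.ne' (hlt s).2.ne).comp s h1).const_mul 2).congr_deriv ?_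
    simp only [hsq, cnP]
    have := sqrt_pos.2 (hQ s)
    field_simp

theorem hasAngleCurvature_borderline {p : ℝ} (hp1 : 1 < p) (hp2 : p ≤ 2) :
    HasAngleCurvature (gammaBorderline p) (fun s => 2 * am1 p s 1)
      (fun s => 2 * sechP p s) := by
  have hinv := isContinuousInverse_am1_one hp1 hp2
  have hc := hinv.continuous
  have ham := hasDerivAt_am1_one hp1 hp2
  have hpos := cos_am1_one_pos hp1 hp2
  have hp1' : p - 1 ≠ 0 := by linarith
  have hp0 : p ≠ 0 := by linarith
  intro s
  refine ⟨Plane.hasDerivAt_mk ?_ ?_, (ham s).const_mul 2⟩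
  · have hsech : ∀ t, sechP p t ^ p = cos (am1 p t 1) ^ 2 := fun t => by
      rw [sechP_eq hp1 hp2, ← rpow_mul (hpos t).le, div_mul_cancel₀ _ hp0, rpow_two]
    have ht : HasDerivAt (tanhP p) (cos (am1 p s 1) ^ 2) s := by
      have hcc : Continuous fun t => cos (am1 p t 1) ^ 2 := (continuous_cos.comp hc).pow 2
      have := hasDerivAt_primitive (fun a b => hcc.intervalIntegrable a b) hcc.measurable
        (hcc.continuousAt (x := s))
      simp only [← hsech] at this
      rw [← hsech]
      exact this
    refine ((ht.const_mul 2).sub (hasDerivAt_id s)).congr_deriv ?_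
    rw [cos_two_mul]
  · have hY : ∀ s, sechP p s ^ (p - 1) = cos (am1 p s 1) ^ (2 / p * (p - 1)) := fun s => by
      rw [sechP_eq hp1 hp2, ← rpow_mul (hpos s).le]
    simp only [hY]
    refine ((((ham s).cos.rpow_const (p := 2 / p * (p - 1)) (Or.inl (hpos s).ne')).const_mul
      (p / (p - 1))).fun_neg).congr_deriv ?_
    rw [sechP_eq hp1 hp2, sin_two_mul]
    have e1 : cos (am1 p s 1) ^ (2 / p * (p - 1) - 1) * cos (am1 p s 1) ^ (2 / p)
        = cos (am1 p s 1) := by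
      rw [← rpow_add (hpos s)]
      convert rpow_one _ using 2
      field_simp; ring
    have e2 : p / (p - 1) * (2 / p * (p - 1)) = 2 := by field_simp
    linear_combination p / (p - 1) * (2 / p * (p - 1)) * sin (am1 p s 1) * e1 +
      sin (am1 p s 1) * cos (am1 p s 1) * e2

theorem hasAngleCurvature_orbitlike {p : ℝ} (hp1 : 1 < p) {q : ℝ}
    (hq : q ∈ Ioo (0 : ℝ) 1) :
    HasAngleCurvature (gammaOrbitlike p q) (fun s => 2 * am2 p s q)
      (fun s => 2 * dnP p s q) := by
  have ham := hasDerivAt_am2 hp1 hq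
  have hQ := one_sub_sq_mul_sin_sq_pos hq
  have hp1' : p - 1 ≠ 0 := by linarith
  have hp0 : p ≠ 0 := by linarith
  have hq0 : q ≠ 0 := hq.1.ne'
  intro s
  set z := 1 - q ^ 2 * sin (am2 p s q) ^ 2 with hz
  have hz0 : 0 < z := hQ _
  have hdn : dnP p s q = z ^ (1 / p) := rfl
  refine ⟨?_, (ham s).const_mul 2⟩
  have hx : HasDerivAt (fun s => 2 * ellE2 (p / (p - 1)) (am2 p s q) q + (q ^ 2 - 2) * s)
      (q ^ 2 * cos (2 * am2 p s q)) s := by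
    have hcc : Continuous fun θ : ℝ => (1 - q ^ 2 * sin θ ^ 2) ^ (1 / (p / (p - 1))) :=
      Continuous.rpow_const (by fun_prop) fun x => Or.inl (hQ x).ne'
    have hd : HasDerivAt (fun x => ellE2 (p / (p - 1)) x q)
        (z ^ (1 / (p / (p - 1)))) (am2 p s q) :=
      hasDerivAt_primitive (fun a b => hcc.intervalIntegrable a b) hcc.measurable hcc.continuousAt
    refine (((hd.comp s (ham s)).const_mul 2).fun_add
      ((hasDerivAt_id s).const_mul (q ^ 2 - 2))).congr_deriv ?_
    -- This explains the conjugate exponent in `ellE2`: the two reciprocal exponents add up to 1.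
    have e1 : z ^ (1 / (p / (p - 1))) * z ^ (1 / p) = z := by
      rw [← rpow_add hz0]
      convert rpow_one _ using 2
      field_simp; ring
    rw [hdn, e1, hz, cos_two_mul]
    linear_combination (-2) * q ^ 2 * sin_sq_add_cos_sq (am2 p s q)
  have hy : HasDerivAt (fun s => -(p / (p - 1) * dnP p s q ^ (p - 1)))
      (q ^ 2 * sin (2 * am2 p s q)) s := by
    have hY : ∀ s, dnP p s q ^ (p - 1) =
        (1 - q ^ 2 * sin (am2 p s q) ^ 2) ^ (1 / p * (p - 1)) := fun s => by
      rw [dnP, ← rpow_mul (hQ _).le]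
    simp only [hY]
    have hd : HasDerivAt (fun s => 1 - q ^ 2 * sin (am2 p s q) ^ 2)
        (-(q ^ 2 * (2 * sin (am2 p s q) * (cos (am2 p s q) * dnP p s q)))) s := by
      refine ((((ham s).sin.fun_pow 2).const_mul (q ^ 2)).const_sub 1).congr_deriv ?_
      simp
    refine ((((hd.rpow_const (p := 1 / p * (p - 1)) (Or.inl hz0.ne')).const_mul
      (p / (p - 1))).fun_neg)).congr_deriv ?_
    rw [hdn, sin_two_mul]
    have e1 : z ^ (1 / p * (p - 1) - 1) * z ^ (1 / p) = 1 := by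
      rw [← rpow_add hz0]
      convert rpow_zero _ using 2
      field_simp; ring
    have e2 : p / (p - 1) * (1 / p * (p - 1)) = 1 := by field_simp
    linear_combination p / (p - 1) * (1 / p * (p - 1)) * (2 * q ^ 2 * sin (am2 p s q) *
      cos (am2 p s q)) * e1 + 2 * q ^ 2 * sin (am2 p s q) * cos (am2 p s q) * e2
  have := (Plane.hasDerivAt_mk hx hy).const_smul (1 / q ^ 2)
  refine this.congr_deriv ?_
  ext i
  fin_cases i <;> simp [hq0]

/-! ### Matching initial data with the profiles -/

/-- The energy relation controls absolute values only; together with equal signs it gives the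
matching of initial values needed for comparison with a profile. -/
lemma sgnPow_mul_rpow_eq_of_nonneg {p k r v : ℝ} (hp : 1 < p) (hr : 0 < r) (hk : 0 ≤ k)
    (hv : 0 ≤ v) (h : |k| ^ p * r ^ p = |v| ^ (p / (p - 1))) :
    sgnPow p k * r ^ (p - 1) = v := by
  have hp1 : p - 1 ≠ 0 := by linarith
  have hp0 : p ≠ 0 := by linarith
  rw [abs_of_nonneg hk, abs_of_nonneg hv, ← mul_rpow hk hr.le] at h
  have h1 : k * r = v ^ (1 / (p - 1)) := by
    have := congrArg (fun x => x ^ (1 / p)) h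
    simp only [← rpow_mul (mul_nonneg hk hr.le), ← rpow_mul hv] at this
    rw [mul_one_div_cancel hp0, rpow_one] at this
    rw [this]
    congr 1; field_simp
  have h2 : sgnPow p k = k ^ (p - 1) := by
    rcases hk.eq_or_lt with rfl | hk
    · rw [sgnPow_zero, zero_rpow hp1]
    · exact sgnPow_of_pos p hk
  rw [h2, ← mul_rpow hk hr.le, h1, ← rpow_mul hv, one_div_mul_cancel hp1, rpow_one]

lemma sgnPow_mul_rpow_eq_of_nonpos {p k r v : ℝ} (hp : 1 < p) (hr : 0 < r) (hk : k ≤ 0)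
    (hv : v ≤ 0) (h : |k| ^ p * r ^ p = |v| ^ (p / (p - 1))) :
    sgnPow p k * r ^ (p - 1) = v := by
  have := sgnPow_mul_rpow_eq_of_nonneg hp hr (neg_nonneg.2 hk) (neg_nonneg.2 hv)
    (by rwa [abs_neg, abs_neg])
  rw [sgnPow_neg] at this
  linarith

namespace IsElasticSystem

variable {p A α : ℝ} {σ θ u : ℝ → ℝ} {γ : ℝ → Plane}

/-- Either A = 0 or c is a multiple of π, so the shift at most changes the sign of the coefficient.
-/
lemma sub_const (h : IsElasticSystem p A σ θ u) {c : ℝ} (hc : A * sin c = 0) :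
    IsElasticSystem p (A * cos c) σ (fun t => θ t - c) u where
  continuousOn := h.continuousOn
  pos := h.pos
  angle t ht := (h.angle t ht).sub_const _
  power t ht := (h.power t ht).congr_deriv (by
    rw [show θ t = θ t - c + c by ring, sin_add, add_sub_cancel_right]
    linear_combination -(σ t * cos (θ t - c)) * hc)

/-- Comparison with a profile curve whose curvature satisfies `|k|^(p-2) k = C - As y`. -/
theorem isRepresentedBy_of_profile (hp1 : 1 < p) (hp2 : p ≤ 2)
    (hγ : ∀ t ∈ Icc (0 : ℝ) 1, HasDerivWithinAt γ
        !₂[σ t * cos (θ t + α), σ t * sin (θ t + α)] (Icc 0 1) t)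
    (h : IsElasticSystem p A σ θ u) {Γ : ℝ → Plane} {θs ks : ℝ → ℝ}
    (hΓ : HasAngleCurvature Γ θs ks) {C As r e s₀ : ℝ}
    (hk : ∀ s, sgnPow p (ks s) = C - As * Γ s 1) (hr : 0 < r) (he : e = 1 ∨ e = -1)
    (hA : A = As * r ^ p) (hθ : θs s₀ = e * θ 0) (hu : sgnPow p (ks s₀) * r ^ (p - 1) = e * u 0) :
    IsRepresentedBy γ Γ := by
  refine h.isRepresentedBy (us := fun s => sgnPow p (ks s)) hp1 hp2 hγ hΓ
    (fun s => (sgnPow_sgnPow hp1 _).symm) (fun s => ?_) hr he hA hθ hu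
  have h1 := Plane.hasDerivAt_iff.1 (hΓ s).1 1
  simp only [Matrix.cons_val_one, Matrix.cons_val_fin_one] at h1
  simp only [hk]
  exact (h1.const_mul As).const_sub C

/-- The datum is an equilibrium. The line has k = 0 and y = 0, so it solves the system for every As,
and shifting the angle brings θ 0 to 0. -/
lemma isRepresentedBy_linear (hp1 : 1 < p) (hp2 : p ≤ 2)
    (hγ : ∀ t ∈ Icc (0 : ℝ) 1, HasDerivWithinAt γ
        !₂[σ t * cos (θ t + α), σ t * sin (θ t + α)] (Icc 0 1) t)
    (h : IsElasticSystem p A σ θ u) (hu : u 0 = 0) (hA : A * sin (θ 0) = 0) :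
    IsRepresentedBy γ gammaLinear := by
  refine (h.sub_const hA).isRepresentedBy_of_profile (α := α + θ 0) (C := 0) (r := 1) (e := 1)
    (s₀ := 0) (As := A * cos (θ 0)) hp1 hp2 (fun t ht => ?_) hasAngleCurvature_linear (fun s => ?_)
    one_pos (Or.inl rfl) (by simp) (by simp) (by simp [hu, sgnPow_zero])
  · rw [show θ t - θ 0 + (α + θ 0) = θ t + α by ring]
    exact hγ t ht
  · simp [sgnPow_zero, gammaLinear]

lemma isRepresentedBy_circular (hp1 : 1 < p) (hp2 : p ≤ 2)
    (hγ : ∀ t ∈ Icc (0 : ℝ) 1, HasDerivWithinAt γ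
        !₂[σ t * cos (θ t + α), σ t * sin (θ t + α)] (Icc 0 1) t)
    (h : IsElasticSystem p 0 σ θ u) (hu : u 0 ≠ 0) : IsRepresentedBy γ gammaCircular := by
  obtain ⟨e, he, heu⟩ : ∃ e : ℝ, (e = 1 ∨ e = -1) ∧ e * u 0 = |u 0| := by
    rcases lt_or_gt_of_ne hu with h | h
    · exact ⟨-1, Or.inr rfl, by rw [abs_of_neg h]; ring⟩
    · exact ⟨1, Or.inl rfl, by rw [abs_of_pos h]; ring⟩
  have hp : p - 1 ≠ 0 := by linarith
  -- The dilation factor is the modulus of the initial curvature, which makes the circle a unit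
  -- circle; s₀ solves s₀ + π/2 = e θ(0).
  refine h.isRepresentedBy_of_profile (C := 1) (As := 0) (r := |u 0| ^ (1 / (p - 1))) (e := e)
    (s₀ := e * θ 0 - π / 2) hp1 hp2 hγ hasAngleCurvature_circular (fun s => ?_)
    (rpow_pos_of_pos (abs_pos.2 hu) _) he (by simp) (by ring) ?_
  · rw [sgnPow_of_pos _ one_pos, one_rpow]; ring
  · rw [sgnPow_of_pos _ one_pos, one_rpow, heu, ← rpow_mul (abs_nonneg _), one_div_mul_cancel hp,
      rpow_one, one_mul]

lemma exists_scale {p A As : ℝ} (hp : 0 < p) (hA : 0 < A) (hAs : 0 < As) :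
    ∃ r : ℝ, 0 < r ∧ A = As * r ^ p := by
  refine ⟨(A / As) ^ (1 / p), by positivity, ?_⟩
  rw [← rpow_mul (by positivity), one_div_mul_cancel hp.ne', rpow_one]
  field_simp

lemma isRepresentedBy_wavelike (hp1 : 1 < p) (hp2 : p ≤ 2)
    (hγ : ∀ t ∈ Icc (0 : ℝ) 1, HasDerivWithinAt γ
        !₂[σ t * cos (θ t + α), σ t * sin (θ t + α)] (Icc 0 1) t)
    (h : IsElasticSystem p A σ θ u) (hθ : θ 0 ∈ Icc (-π) π) (hA : 0 < A) {q : ℝ}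
    (hq : q ∈ Ioo (0 : ℝ) 1)
    (hE : |u 0| ^ (p / (p - 1)) = p / (p - 1) * A * (2 * q ^ 2 - 1 + cos (θ 0))) :
    IsRepresentedBy γ (gammaWavelike p q) := by
  have hp : 0 < p - 1 := by linarith
  have hP : 0 < p / (p - 1) := by positivity
  have hq0 := hq.1
  obtain ⟨hinv, -⟩ := isContinuousInverse_am1 hp1 hp2 hq
  -- This As is read off from |k|^(p-2) k = -As y for k = 2 q cn and the second coordinate of
  -- `gammaWavelike`.
  obtain ⟨r, hr, hAr⟩ := exists_scale (p := p) (As := 2 ^ (p - 1) * q ^ (p - 2) / (p / (p - 1)))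
    (by linarith) hA (by positivity)
  have hcos : cos (θ 0) = 1 - 2 * sin (θ 0 / 2) ^ 2 := by
    rw [show θ 0 = 2 * (θ 0 / 2) by ring, cos_two_mul, mul_div_cancel_left₀ _ two_ne_zero]
    linear_combination 2 * sin_sq_add_cos_sq (θ 0 / 2)
  have hle : sin (θ 0 / 2) ^ 2 ≤ q ^ 2 := by
    have h1 : 0 ≤ p / (p - 1) * A * (2 * q ^ 2 - 1 + cos (θ 0)) := hE ▸ by positivity
    have h2 := nonneg_of_mul_nonneg_right h1 (by positivity)
    linarith
  have hab := abs_le_of_sq_le_sq' hle hq0.le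
  set z := sin (θ 0 / 2) / q with hz
  have hz1 : -1 ≤ z := by rw [hz, le_div_iff₀ hq0]; linarith [hab.1]
  have hz2 : z ≤ 1 := by rw [hz, div_le_iff₀ hq0]; linarith [hab.2]
  have hqz : q * z = sin (θ 0 / 2) := by rw [hz]; field_simp
  -- The initial angle fixes only sin x = sin(θ(0)/2)/q. The sign of u(0) picks one of the two
  -- solutions, since the wavelike curvature has the sign of cos x; no reflection is needed.
  obtain ⟨x, hx, hsign⟩ : ∃ x, sin x = z ∧ ((0 ≤ cos x ∧ 0 ≤ u 0) ∨ (cos x ≤ 0 ∧ u 0 ≤ 0)) := by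
    rcases le_total 0 (u 0) with hu | hu
    · exact ⟨arcsin z, sin_arcsin hz1 hz2, Or.inl ⟨cos_arcsin_nonneg z, hu⟩⟩
    · refine ⟨π - arcsin z, by rw [sin_pi_sub, sin_arcsin hz1 hz2], Or.inr ⟨?_, hu⟩⟩
      rw [cos_pi_sub]
      linarith [cos_arcsin_nonneg z]
  set s₀ := ∫ θ in (0 : ℝ)..x, |cos θ| ^ (1 - 2 / p) / √(1 - q ^ 2 * sin θ ^ 2)
  have ham : am1 p s₀ q = x := hinv.left_inv x (mem_univ x)
  have hcn : cnP p s₀ q = |cos x| ^ (2 / p - 1) * cos x := by rw [cnP, ham]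
  have habs : |2 * q * cnP p s₀ q| ^ p = 2 ^ p * q ^ p * cos x ^ 2 := by
    have e1 : |cnP p s₀ q| = |cos x| ^ (2 / p) := by
      have := abs_sgnPow (r := 2 / p + 1) (by have : 0 < 2 / p := by positivity
                                              linarith) (cos x)
      rw [sgnPow, show 2 / p + 1 - 2 = 2 / p - 1 by ring, ← hcn, add_sub_cancel_right] at this
      exact this
    rw [abs_mul, e1, abs_of_pos (by positivity), mul_rpow (by positivity) (by positivity),
      mul_rpow (by norm_num) hq0.le, ← rpow_mul (abs_nonneg _),
      div_mul_cancel₀ _ (by linarith), rpow_two, sq_abs]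
  have henergy : |2 * q * cnP p s₀ q| ^ p * r ^ p = |u 0| ^ (p / (p - 1)) := by
    have e1 : (2 : ℝ) ^ p = 2 ^ (p - 1) * 2 := by
      rw [← rpow_add_one two_ne_zero]; congr 1; ring
    have e2 : q ^ p = q ^ (p - 2) * q ^ 2 := by
      rw [← rpow_natCast q 2, ← rpow_add hq0]; congr 1; push_cast; ring
    have e3 : q ^ 2 * cos x ^ 2 = q ^ 2 - sin (θ 0 / 2) ^ 2 := by
      rw [← hqz, ← hx]
      linear_combination q ^ 2 * sin_sq_add_cos_sq x
    rw [habs, hE, e1, e2, hAr, hcos]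
    field_simp
    linear_combination 2 * e3
  refine h.isRepresentedBy_of_profile (C := 0) (r := r) (e := 1) (s₀ := s₀) hp1 hp2 hγ
    (hasAngleCurvature_wavelike hp1 hp2 hq) (fun s => ?_) hr (Or.inl rfl) hAr ?_ ?_
  · rw [sgnPow_mul, sgnPow_of_pos _ (by positivity), mul_rpow (by norm_num) hq0.le]
    simp only [gammaWavelike, Matrix.cons_val_one, Matrix.cons_val_fin_one, sgnPow]
    rw [show q ^ (p - 1) = q ^ (p - 2) * q by rw [← rpow_add_one hq0.ne']; congr 1; ring]
    field_simp
    ring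
  · rw [snP, ham, hx, hqz, arcsin_sin (by linarith [hθ.1]) (by linarith [hθ.2])]
    ring
  · have e1 : 0 ≤ |cos x| ^ (2 / p - 1) := by positivity
    rw [one_mul]
    rcases hsign with ⟨hc, hu⟩ | ⟨hc, hu⟩
    · refine sgnPow_mul_rpow_eq_of_nonneg hp1 hr ?_ hu henergy
      rw [hcn]; positivity
    · refine sgnPow_mul_rpow_eq_of_nonpos hp1 hr ?_ hu henergy
      rw [hcn]
      exact mul_nonpos_of_nonneg_of_nonpos (by positivity)
        (mul_nonpos_of_nonneg_of_nonpos e1 hc)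

lemma exists_sign_mul_eq_abs (x : ℝ) : ∃ e : ℝ, (e = 1 ∨ e = -1) ∧ e * x = |x| := by
  rcases le_total 0 x with h | h
  · exact ⟨1, Or.inl rfl, by rw [abs_of_nonneg h]; ring⟩
  · exact ⟨-1, Or.inr rfl, by rw [abs_of_nonpos h]; ring⟩

/-- The borderline curvature is positive, so a negative u(0) is handled by a reflection e. The open
range of θ(0) makes e θ(0)/2 an attainable amplitude. -/
lemma isRepresentedBy_borderline (hp1 : 1 < p) (hp2 : p ≤ 2)
    (hγ : ∀ t ∈ Icc (0 : ℝ) 1, HasDerivWithinAt γ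
        !₂[σ t * cos (θ t + α), σ t * sin (θ t + α)] (Icc 0 1) t)
    (h : IsElasticSystem p A σ θ u) (hθ : θ 0 ∈ Ioo (-π) π) (hA : 0 < A)
    (hE : |u 0| ^ (p / (p - 1)) = p / (p - 1) * A * (1 + cos (θ 0))) :
    IsRepresentedBy γ (gammaBorderline p) := by
  have hp : 0 < p - 1 := by linarith
  have hp0 : p ≠ 0 := by linarith
  have hinv := isContinuousInverse_am1_one hp1 hp2
  obtain ⟨r, hr, hAr⟩ := exists_scale (p := p) (As := 2 ^ (p - 1) / (p / (p - 1)))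
    (by linarith) hA (by positivity)
  obtain ⟨e, he, heu⟩ := exists_sign_mul_eq_abs (u 0)
  set x := e * θ 0 / 2 with hx
  have hxm : x ∈ Ioo (-(π / 2)) (π / 2) := by
    rcases he with rfl | rfl
    · constructor <;> linarith [hθ.1, hθ.2]
    · constructor <;> linarith [hθ.1, hθ.2]
  have hcos : cos (θ 0) = 2 * cos x ^ 2 - 1 := by
    rw [← cos_two_mul, hx, mul_div_cancel₀ _ two_ne_zero]
    rcases he with rfl | rfl <;> simp
  set s₀ := ∫ θ in (0 : ℝ)..x, 1 / |cos θ| ^ (2 / p)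
  have ham : am1 p s₀ 1 = x := hinv.left_inv x hxm
  have hsech : ∀ s, 0 < sechP p s := fun s => by
    rw [sechP_eq hp1 hp2]
    exact rpow_pos_of_pos (cos_am1_one_pos hp1 hp2 s) _
  refine h.isRepresentedBy_of_profile (C := 0) (r := r) (e := e) (s₀ := s₀) hp1 hp2 hγ
    (hasAngleCurvature_borderline hp1 hp2) (fun s => ?_) hr he hAr ?_ ?_
  · rw [sgnPow_of_pos _ (mul_pos two_pos (hsech s)), mul_rpow zero_le_two (hsech s).le]
    simp only [gammaBorderline, Matrix.cons_val_one, Matrix.cons_val_fin_one]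
    field_simp
    ring
  · rw [ham, hx]; ring
  · rw [heu]
    refine sgnPow_mul_rpow_eq_of_nonneg hp1 hr (mul_pos two_pos (hsech _)).le (abs_nonneg _) ?_
    have hc := cos_pos_of_mem_Ioo hxm
    rw [abs_abs, abs_of_pos (mul_pos two_pos (hsech _)), sechP_eq hp1 hp2, ham,
      mul_rpow zero_le_two (by positivity), ← rpow_mul hc.le, div_mul_cancel₀ _ hp0, rpow_two, hE,
      hAr, hcos, show (2 : ℝ) ^ p = 2 ^ (p - 1) * 2 by
        rw [← rpow_add_one two_ne_zero]; congr 1; ring]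
    field_simp
    ring

/-- Here too the curvature is positive and the sign of u(0) is absorbed by a reflection, but every
angle is attained by the amplitude. -/
lemma isRepresentedBy_orbitlike (hp1 : 1 < p) (hp2 : p ≤ 2)
    (hγ : ∀ t ∈ Icc (0 : ℝ) 1, HasDerivWithinAt γ
        !₂[σ t * cos (θ t + α), σ t * sin (θ t + α)] (Icc 0 1) t)
    (h : IsElasticSystem p A σ θ u) (hA : 0 < A) {q : ℝ} (hq : q ∈ Ioo (0 : ℝ) 1)
    (hE : |u 0| ^ (p / (p - 1)) = p / (p - 1) * A * (2 / q ^ 2 - 1 + cos (θ 0))) :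
    IsRepresentedBy γ (gammaOrbitlike p q) := by
  have hp : 0 < p - 1 := by linarith
  have hp0 : p ≠ 0 := by linarith
  have hq0 := hq.1
  obtain ⟨hinv, -⟩ := isContinuousInverse_am2 hp1 hq
  obtain ⟨r, hr, hAr⟩ := exists_scale (p := p) (As := 2 ^ (p - 1) * q ^ 2 / (p / (p - 1)))
    (by linarith) hA (by positivity)
  obtain ⟨e, he, heu⟩ := exists_sign_mul_eq_abs (u 0)
  set x := e * θ 0 / 2 with hx
  have hcos : cos (θ 0) = 1 - 2 * sin x ^ 2 := by
    have : cos (θ 0) = cos (2 * x) := by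
      rw [hx, mul_div_cancel₀ _ two_ne_zero]
      rcases he with rfl | rfl <;> simp
    rw [this, cos_two_mul]
    linear_combination 2 * sin_sq_add_cos_sq x
  set s₀ := ∫ θ in (0 : ℝ)..x, 1 / (1 - q ^ 2 * sin θ ^ 2) ^ (1 / p)
  have ham : am2 p s₀ q = x := hinv.left_inv x (mem_univ x)
  have hdn : ∀ s, 0 < dnP p s q := fun s =>
    rpow_pos_of_pos (one_sub_sq_mul_sin_sq_pos hq _) _
  refine h.isRepresentedBy_of_profile (C := 0) (r := r) (e := e) (s₀ := s₀) hp1 hp2 hγ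
    (hasAngleCurvature_orbitlike hp1 hq) (fun s => ?_) hr he hAr ?_ ?_
  · rw [sgnPow_of_pos _ (mul_pos two_pos (hdn s)), mul_rpow zero_le_two (hdn s).le]
    simp only [gammaOrbitlike, PiLp.smul_apply, Matrix.cons_val_one, Matrix.cons_val_fin_one,
      smul_eq_mul]
    field_simp
    ring
  · rw [ham, hx]; ring
  · rw [heu]
    refine sgnPow_mul_rpow_eq_of_nonneg hp1 hr (mul_pos two_pos (hdn _)).le (abs_nonneg _) ?_
    rw [abs_abs, abs_of_pos (mul_pos two_pos (hdn _)), mul_rpow zero_le_two (hdn _).le, dnP, ham,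
      ← rpow_mul (one_sub_sq_mul_sin_sq_pos hq x).le, one_div_mul_cancel hp0, rpow_one, hE,
      hAr, hcos, show (2 : ℝ) ^ p = 2 ^ (p - 1) * 2 by
        rw [← rpow_add_one two_ne_zero]; congr 1; ring]
    field_simp
    ring

end IsElasticSystem

/-! ### The classification -/

/-- Classification of planar `p`-elasticae. -/
theorem IsPElastica.exists_isRepresentedBy {p : ℝ} (hp1 : 1 < p) (hp2 : p ≤ 2) {γ : ℝ → Plane}
    (hγ : IsPElastica p γ) :
    ∃ Γ : ℝ → Plane,
      (Γ = gammaLinear ∨ (∃ q ∈ Ioo (0 : ℝ) 1, Γ = gammaWavelike p q) ∨ Γ = gammaBorderline p ∨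
        (∃ q ∈ Ioo (0 : ℝ) 1, Γ = gammaOrbitlike p q) ∨ Γ = gammaCircular) ∧
      IsRepresentedBy γ Γ := by
  obtain ⟨σ, θ', u, α, A, -, hA, hγ', hsys'⟩ := hγ.exists_system hp1
  -- The half-angle must lie in [-π/2, π/2] for the arcsine and the borderline amplitude.
  obtain ⟨n, hn, -⟩ := existsUnique_add_zsmul_mem_Ioc two_pi_pos (θ' 0) (-π)
  have hsys := hsys'.add_int_mul_two_pi n
  have hγ : ∀ t ∈ Icc (0 : ℝ) 1, HasDerivWithinAt γ
      !₂[σ t * cos (θ' t + n * (2 * π) + α), σ t * sin (θ' t + n * (2 * π) + α)] (Icc 0 1) t :=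
    fun t ht => by
      rw [add_right_comm, cos_add_int_mul_two_pi, sin_add_int_mul_two_pi]
      exact hγ' t ht
  rw [zsmul_eq_mul, show -π + 2 * π = π by ring] at hn
  set θ : ℝ → ℝ := fun t => θ' t + n * (2 * π)
  have hθ0 : θ 0 ∈ Ioc (-π) π := hn
  -- Equilibria are removed first; below, `hlin` excludes the degenerate energy levels.
  by_cases hlin : u 0 = 0 ∧ A * sin (θ 0) = 0
  · exact ⟨_, Or.inl rfl, hsys.isRepresentedBy_linear hp1 hp2 hγ hlin.1 hlin.2⟩
  rcases hA.eq_or_lt with rfl | hA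
  · refine ⟨_, Or.inr (Or.inr (Or.inr (Or.inr rfl))),
      hsys.isRepresentedBy_circular hp1 hp2 hγ fun h => hlin ⟨h, by simp⟩⟩
  have hp : 0 < p - 1 := by linarith
  have hP : 0 < p / (p - 1) * A := by positivity
  obtain ⟨E, hE⟩ : ∃ E, E = |u 0| ^ (p / (p - 1)) / (p / (p - 1) * A) := ⟨_, rfl⟩
  have hE0 : 0 ≤ E := by rw [hE]; positivity
  have hEu : |u 0| ^ (p / (p - 1)) = p / (p - 1) * A * E := by
    rw [hE]; field_simp
  have hu0 : E = 0 → u 0 = 0 := fun h => by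
    rw [h, mul_zero, rpow_eq_zero (abs_nonneg _) (by positivity)] at hEu
    exact abs_eq_zero.1 hEu
  have hsin : ∀ {c : ℝ}, c ^ 2 = 1 → cos (θ 0) = c → sin (θ 0) = 0 := fun hc h => by
    have := sin_sq_add_cos_sq (θ 0)
    rw [h, hc] at this
    exact pow_eq_zero_iff two_ne_zero |>.1 (by linarith)
  -- The normalized pendulum energy at t = 0.
  obtain ⟨e, he⟩ : ∃ e, e = E - cos (θ 0) := ⟨_, rfl⟩
  -- e ≤ -1 would force u(0) = 0 and cos θ(0) = 1, the stable equilibrium.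
  have he1 : -1 < e := by
    by_contra hlt
    have h1 := cos_le_one (θ 0)
    have h2 : E = 0 := by linarith
    exact hlin ⟨hu0 h2, by rw [hsin (c := 1) (by norm_num) (by linarith), mul_zero]⟩
  rcases lt_trichotomy e 1 with hlt | heq | hgt
  · have hq : √((1 + e) / 2) ^ 2 = (1 + e) / 2 := sq_sqrt (by linarith)
    have hqm : √((1 + e) / 2) ∈ Ioo (0 : ℝ) 1 :=
      ⟨sqrt_pos.2 (by linarith), (sqrt_lt_sqrt (by linarith)
        (by linarith : (1 + e) / 2 < 1)).trans_eq sqrt_one⟩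
    exact ⟨_, Or.inr (Or.inl ⟨_, hqm, rfl⟩), hsys.isRepresentedBy_wavelike hp1 hp2 hγ
      (Ioc_subset_Icc_self hθ0) hA hqm (by rw [hEu, hq, he]; ring)⟩
  -- On the level e = 1, the angle θ(0) = π would force E = 0, the unstable equilibrium.
  · refine ⟨_, Or.inr (Or.inr (Or.inl rfl)), hsys.isRepresentedBy_borderline hp1 hp2 hγ
      ⟨hθ0.1, lt_of_le_of_ne hθ0.2 fun hπ => hlin ?_⟩ hA (by rw [hEu]; congr 1; linarith)⟩
    have hc : cos (θ 0) = -1 := by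
      have hπ' : θ 0 = π := hπ
      rw [hπ', cos_pi]
    exact ⟨hu0 (by linarith), by rw [hsin (c := -1) (by norm_num) hc, mul_zero]⟩
  · have hq : √(2 / (1 + e)) ^ 2 = 2 / (1 + e) := sq_sqrt (by apply div_nonneg <;> linarith)
    have hqm : √(2 / (1 + e)) ∈ Ioo (0 : ℝ) 1 :=
      ⟨sqrt_pos.2 (div_pos two_pos (by linarith)),
        (sqrt_lt_sqrt (by apply div_nonneg <;> linarith)
          (by rw [div_lt_one] <;> linarith : 2 / (1 + e) < 1)).trans_eq sqrt_one⟩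
    refine ⟨_, Or.inr (Or.inr (Or.inr (Or.inl ⟨_, hqm, rfl⟩))),
      hsys.isRepresentedBy_orbitlike hp1 hp2 hγ hA hqm ?_⟩
    have : 2 / (2 / (1 + e)) = 1 + e := by field_simp
    rw [hEu, hq, this, he]; ring

end

theorem theorem1p1 (p : ℝ) (hp1 : 1 < p) (hp2 : p ≤ 2) :
    (∀ γ : ℝ → Plane, IsPElastica p γ →
      ∃ Γ : ℝ → Plane,
        (Γ = gammaLinear ∨
          (∃ q ∈ Set.Ioo (0 : ℝ) 1, Γ = gammaWavelike p q) ∨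
          Γ = gammaBorderline p ∨
          (∃ q ∈ Set.Ioo (0 : ℝ) 1, Γ = gammaOrbitlike p q) ∨
          Γ = gammaCircular) ∧
        ∃ (S : Plane ≃ᵈ Plane) (s₀ : ℝ), ∀ t ∈ Set.Icc (0 : ℝ) 1,
          S (γ t) = Γ (arclength (fun r => S (γ r)) t + s₀)) ∧
    HasAngleCurvature gammaLinear (fun _ => 0) (fun _ => 0) ∧
    (∀ q ∈ Set.Ioo (0 : ℝ) 1,
      HasAngleCurvature (gammaWavelike p q) (fun s => 2 * Real.arcsin (q * snP p s q))
        (fun s => 2 * q * cnP p s q)) ∧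
    HasAngleCurvature (gammaBorderline p) (fun s => 2 * am1 p s 1) (fun s => 2 * sechP p s) ∧
    (∀ s : ℝ, am1 p s 1 = am2 p s 1) ∧
    (∀ q ∈ Set.Ioo (0 : ℝ) 1,
      HasAngleCurvature (gammaOrbitlike p q) (fun s => 2 * am2 p s q)
        (fun s => 2 * dnP p s q)) ∧
    HasAngleCurvature gammaCircular (fun s => s + Real.pi / 2) (fun _ => 1) := by
  refine ⟨fun γ hγ => ?_, hasAngleCurvature_linear,
    fun q hq => hasAngleCurvature_wavelike hp1 hp2 hq, hasAngleCurvature_borderline hp1 hp2,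
    am1_one_eq_am2_one p, fun q hq => hasAngleCurvature_orbitlike hp1 hq,
    hasAngleCurvature_circular⟩
  obtain ⟨Γ, hΓ, hrep⟩ := hγ.exists_isRepresentedBy hp1 hp2
  exact ⟨Γ, hΓ, hrep⟩
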